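/- **Setting.** A *compositional workflow* $G$ over a finite set $S$ of steps and a finite set $R$ of release points is built recursively from single steps and single release points by serial composition $G_1;G_2$, parallel branching $G_1\parallel G_2$ and xor branching $G_1\otimes G_2$, where the operands are disjoint and every element of $S\cup R$ is used exactly once; $\mathcal B$ is the set of its xor branchings. Its set of *execution sequences* $\Sigma(G)$ is given by $\Sigma(v)=\{(v)\}$ for a single step or release point $v$; $\Sigma(G_1;G_2)$ is the set of concatenations $\sigma_1\sigma_2$, and $\Sigma(G_1\parallel G_2)$ the set of order-preserving interleavings of $\sigma_1$ and $\sigma_2$, with $\sigma_i\in\Sigma(G_i)$; and $\Sigma(G_1\otimes G_2)=\Sigma(G_1)\cup\Sigma(G_2)$. Write $S(\sigma)$ for the set of steps occurring in $\sigma$. Let $U$ be a finite set of users and $A\subseteq S\times U$ an authorization policy. A *plan* for $\sigma$ is a function $\pi:S(\sigma)\to U$. A *constraint with release points* is $c=(T,\Theta,P)$ with $T\subseteq S$, $P\subseteq R$ and $\Theta$ a set of functions $T\to U$. If $r_1,\dots,r_q$ are the elements of $P$ that occur in $\sigma$, in this order, let $T_0,\dots,T_q$ be the sets of steps of $T$ that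 occur in $\sigma$ before $r_1$, between $r_i$ and $r_{i+1}$ ($1\le i<q$), and after $r_q$ (for $q=0$, $T_0=T\cap S(\sigma)$). The plan $\pi$ *satisfies* $c$ for $\sigma$ if every $\pi|_{T_i}$ is the restriction to $T_i$ of some $\theta\in\Theta$. The constraint $c$ carries a weight $w_c(\sigma,\pi)=w_c\big((T_0,\dots,T_q),\pi\big)\in\mathbb Z_{\ge 0}$, determined by the list $(T_0,\dots,T_q)$ and the plan, which is $0$ if and only if $\pi$ satisfies $c$ for $\sigma$. All constraints are *user-independent*: for every permutation $\varphi$ of $U$, $\theta\in\Theta$ implies $\varphi\circ\theta\in\Theta$, and $w_c(\sigma,\varphi\circ\pi)=w_c(\sigma,\pi)$. The authorization weight of a plan is $w_A(\pi)=\sum_{u\in U}\omega(\pi^{-1}(u),u)$, where $\omega(D,u)\in\mathbb Z_{\ge0}$ for $D\subseteq S$, $u\in U$, and $\omega(D,u)=0$ if and only if $D\times\{u\}\subseteq A$. The cost is $w(\sigma,\pi)=\sum_{c\in C}w_c(\sigma,\pi)+w_A(\pi)$, where $C$ is the given finite collection of constraints. **Problem.** An instance of Bounded Cost WSP consists of such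 a workflow, $U$, $A$, the constraints $C$ and a budget $B\in\mathbb Z_{\ge0}$. The sets $S$, $R$, $U$, $A$ and the $T$ and $P$ of each constraint are listed explicitly, and the budget is written in binary. The families $\Theta$ with the weights $w_c$, and the weight $\omega$, are given by compact descriptions from which two fixed programs compute the values $w_c(\sigma,\pi)$ and $\omega(D,u)$, in binary, in time $q(n)$ for a fixed polynomial $q$, where $n$ is the length of the instance. With $f(\sigma)=1/|\Sigma(G)|$, the question is whether for every $\sigma\in\Sigma(G)$ there is a plan $\pi:S(\sigma)\to U$ with $f(\sigma)\,w(\sigma,\pi)\le B/|\Sigma(G)|$ (that is, with $w(\sigma,\pi)\le B$). **Theorem.** Let the two programs and $q$ be fixed, and let $\kappa=|S|+|R|+|\mathcal B|$. Bounded Cost WSP, parameterized by $\kappa$, is fixed-parameter tractable: there are an algorithm and a computable function $f_0$ such that the algorithm decides every instance in time $f_0(\kappa)\,\mathrm{poly}(n)$. Moreover it can be solved in time $$\mathcal O^*\!\left(2^{|\mathcal B|}\,|R|!\,(|R|+1)^{|S|}\,|S|^{|S|}\right),$$ where $\mathcal O^*$ hides factors polynomial in $n$, and $0^0=1$. (Time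 is counted in steps of a while-language on binary trees with unit-cost pointer operations, a model polynomially equivalent to Turing machines.) -/

import Mathlib

namespace BoundedWSP

/-! ### The machine model: programs on binary trees, with a step count -/

/-- Data values: binary trees with unlabelled leaves. -/
inductive Data : Type
  | nil : Data
  | cons : Data → Data → Data

/-- The number of vertices of a tree; this is the length of an encoded instance. -/
def Data.size : Data → ℕ
  | .nil => 1
  | .cons a b => a.size + b.size + 1

/-- Programs of a while-language whose only data type is `Data`. Every program transforms one tree;
several variables are kept in one tree by pairing. -/
inductive Code : Type
  | id : Code
  | nil : Code
  | head : Code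
  | tail : Code
  | pair : Code → Code → Code
  | comp : Code → Code → Code
  | cond : Code → Code → Code → Code
  | loop : Code → Code → Code

/-- `Runs M v w t`: program `M`, started on `v`, halts with output `w` after exactly `t` steps.
Every elementary operation is a bounded number of pointer operations (trees are shared, never
copied), and only emptiness of a tree can be tested, so that unit cost is polynomially equivalent to
Turing machine time. -/
inductive Code.Runs : Code → Data → Data → ℕ → Prop
  | id (v : Data) : Code.Runs .id v v 1
  | nil (v : Data) : Code.Runs .nil v .nil 1
  | head_nil : Code.Runs .head .nil .nil 1
  | head_cons (a b : Data) : Code.Runs .head (.cons a b) a 1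
  | tail_nil : Code.Runs .tail .nil .nil 1
  | tail_cons (a b : Data) : Code.Runs .tail (.cons a b) b 1
  | pair {f g : Code} {v a b : Data} {t₁ t₂ : ℕ} :
      Code.Runs f v a t₁ → Code.Runs g v b t₂ →
        Code.Runs (.pair f g) v (.cons a b) (t₁ + t₂ + 1)
  | comp {f g : Code} {v a b : Data} {t₁ t₂ : ℕ} :
      Code.Runs g v a t₁ → Code.Runs f a b t₂ →
        Code.Runs (.comp f g) v b (t₁ + t₂ + 1)
  | cond_then {c f g : Code} {v x y w : Data} {t₁ t₂ : ℕ} :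
      Code.Runs c v (.cons x y) t₁ → Code.Runs f v w t₂ →
        Code.Runs (.cond c f g) v w (t₁ + t₂ + 1)
  | cond_else {c f g : Code} {v w : Data} {t₁ t₂ : ℕ} :
      Code.Runs c v .nil t₁ → Code.Runs g v w t₂ →
        Code.Runs (.cond c f g) v w (t₁ + t₂ + 1)
  | loop_stop {c f : Code} {v : Data} {t : ℕ} :
      Code.Runs c v .nil t → Code.Runs (.loop c f) v v (t + 1)
  | loop_step {c f : Code} {v x y v' w : Data} {t₁ t₂ t₃ : ℕ} :
      Code.Runs c v (.cons x y) t₁ → Code.Runs f v v' t₂ → Code.Runs (.loop c f) v' w t₃ →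
        Code.Runs (.loop c f) v w (t₁ + t₂ + t₃ + 1)

/-! ### Decision problems, running times and fixed-parameter tractability -/

/-- A decision problem: instances, their encoding as input data, and the positive instances. -/
structure DecisionProblem where
  Inst : Type
  enc : Inst → Data
  Yes : Inst → Prop

/-- The length of an encoded instance. -/
def DecisionProblem.size (Q : DecisionProblem) (x : Q.Inst) : ℕ := (Q.enc x).size

/-- `M` halts on every instance `x` within `τ x` steps, and its output is a nonempty tree exactly
for the positive instances. -/
def DecisionProblem.DecidesWithin (Q : DecisionProblem) (M : Code) (τ : Q.Inst → ℕ) : Prop :=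
  ∀ x : Q.Inst, ∃ (out : Data) (t : ℕ),
    M.Runs (Q.enc x) out t ∧ t ≤ τ x ∧ (out ≠ Data.nil ↔ Q.Yes x)

/-- Solvable in time `O*(g)`: in time `g` times a polynomial in the length of the instance. -/
def DecisionProblem.SolvableInOStar (Q : DecisionProblem) (g : Q.Inst → ℕ) : Prop :=
  ∃ (M : Code) (p : Polynomial ℕ), Q.DecidesWithin M (fun x => g x * p.eval (Q.size x))

/-- Fixed-parameter tractable with respect to the parameter `κ`. -/
def DecisionProblem.FPT (Q : DecisionProblem) (κ : Q.Inst → ℕ) : Prop :=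
  ∃ f : ℕ → ℕ, Computable f ∧ Q.SolvableInOStar (fun x => f (κ x))

/-! ### Compositional workflows and their execution sequences -/

/-- A vertex that is executed: one of `s` steps or one of `r` release points. -/
abbrev Activity (s r : ℕ) : Type := Fin s ⊕ Fin r

/-- The recursive construction of a compositional workflow: a single step or release point, serial
composition, parallel branching, xor branching. -/
inductive Workflow (s r : ℕ) : Type
  | atom : Activity s r → Workflow s r
  | seq : Workflow s r → Workflow s r → Workflow s r
  | par : Workflow s r → Workflow s r → Workflow s r
  | xor : Workflow s r → Workflow s r → Workflow s r

/-- The steps and release points from which a workflow is built, with multiplicity. -/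
def Workflow.activities {s r : ℕ} : Workflow s r → List (Activity s r)
  | .atom v => [v]
  | .seq G₁ G₂ => G₁.activities ++ G₂.activities
  | .par G₁ G₂ => G₁.activities ++ G₂.activities
  | .xor G₁ G₂ => G₁.activities ++ G₂.activities

/-- The number of xor branchings. -/
def Workflow.xorCount {s r : ℕ} : Workflow s r → ℕ
  | .atom _ => 0
  | .seq G₁ G₂ => G₁.xorCount + G₂.xorCount
  | .par G₁ G₂ => G₁.xorCount + G₂.xorCount
  | .xor G₁ G₂ => G₁.xorCount + G₂.xorCount + 1

/-- All interleavings of two sequences that preserve the order within both. -/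
def interleavings {α : Type} [DecidableEq α] : List α → List α → Finset (List α)
  | [], bs => {bs}
  | a :: as, [] => {a :: as}
  | a :: as, b :: bs =>
      (interleavings as (b :: bs)).image (List.cons a) ∪
        (interleavings (a :: as) bs).image (List.cons b)
termination_by as bs => as.length + bs.length

/-- The set of execution sequences of a workflow. -/
def Workflow.execSeqs {s r : ℕ} : Workflow s r → Finset (List (Activity s r))
  | .atom v => {[v]}
  | .seq G₁ G₂ => Finset.image₂ (fun σ τ => σ ++ τ) G₁.execSeqs G₂.execSeqs
  | .par G₁ G₂ => G₁.execSeqs.biUnion fun σ => G₂.execSeqs.biUnion fun τ => interleavings σ τ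
  | .xor G₁ G₂ => G₁.execSeqs ∪ G₂.execSeqs

/-- The set of steps that occur in a sequence of steps and release points. -/
def stepsOf {s r : ℕ} (σ : List (Activity s r)) : Finset (Fin s) :=
  (σ.filterMap Sum.getLeft?).toFinset

/-! ### Plans, weighted constraints with release points, and costs -/

/-- A partial plan: an assignment of users to some of the steps. -/
abbrev Plan (s u : ℕ) : Type := Fin s → Option (Fin u)

/-- `π` is a function from `D` to the set of users. -/
def Plan.HasDomain {s u : ℕ} (π : Plan s u) (D : Finset (Fin s)) : Prop :=
  ∀ x, (π x).isSome ↔ x ∈ D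

/-- The plan `φ ∘ π`. -/
def Plan.permute {s u : ℕ} (φ : Equiv.Perm (Fin u)) (π : Plan s u) : Plan s u :=
  fun x => (π x).map φ

/-- The set of steps to which `π` assigns the user `a`. -/
def Plan.fiber {s u : ℕ} (π : Plan s u) (a : Fin u) : Finset (Fin s) :=
  Finset.univ.filter fun x => π x = some a

/-- A constraint `(T, Θ, P)` with release points. -/
structure ReleaseConstraint (s r u : ℕ) where
  /-- the scope `T` -/
  scope : Finset (Fin s)
  /-- the release points `P` -/
  releases : Finset (Fin r)
  /-- the family `Θ` of functions from `T` to the users -/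
  allowed : Set ({x // x ∈ scope} → Fin u)

/-- The restriction of `π` to `Q` lies in the restriction of `Θ` to `Q`, where `Q ⊆ T`. -/
def ReleaseConstraint.SatisfiesOn {s r u : ℕ} (c : ReleaseConstraint s r u) (π : Plan s u)
    (Q : Finset (Fin s)) : Prop :=
  ∃ θ ∈ c.allowed, ∀ x : {x // x ∈ c.scope}, (x : Fin s) ∈ Q → π x = some (θ x)

/-- The list `T₀, …, T_q` of the parts of the scope between consecutive release points of the
constraint in the sequence `σ`. -/
def ReleaseConstraint.blocks {s r u : ℕ} (c : ReleaseConstraint s r u)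
    (σ : List (Activity s r)) : List (Finset (Fin s)) :=
  (σ.splitOnP fun v => decide (∃ x ∈ c.releases, v = Sum.inr x)).map
    fun τ => c.scope ∩ stepsOf τ

/-- A user-independent weighted constraint with release points. The weight of a plan `π` for an
execution sequence is given by `weight [T₀, …, T_q] π`: it is zero exactly if the constraint is
satisfied, that is, if `π` restricted to every `T_i` satisfies the restriction of the constraint
to `T_i`. -/
structure WeightedConstraint (s r u : ℕ) extends ReleaseConstraint s r u where
  weight : List (Finset (Fin s)) → Plan s u → ℕ
  weight_eq_zero_iff : ∀ (Qs : List (Finset (Fin s))) (π : Plan s u),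
    weight Qs π = 0 ↔ ∀ Q ∈ Qs, toReleaseConstraint.SatisfiesOn π Q
  allowed_permute : ∀ (φ : Equiv.Perm (Fin u)), ∀ θ ∈ allowed, (fun x => φ (θ x)) ∈ allowed
  weight_permute : ∀ (φ : Equiv.Perm (Fin u)) (Qs : List (Finset (Fin s))) (π : Plan s u),
    weight Qs (π.permute φ) = weight Qs π
  /-- the compact description of the constraint in the input -/
  descr : Data

/-- A constrained compositional workflow schema with weights, together with a budget. The sets of
steps, release points and users are `Fin s`, `Fin r` and `Fin u`. -/
structure Schema where
  s : ℕ
  r : ℕ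
  u : ℕ
  workflow : Workflow s r
  /-- operands of a composition are disjoint -/
  nodup : workflow.activities.Nodup
  /-- the workflow comprises all steps and release points -/
  complete : ∀ v, v ∈ workflow.activities
  /-- the authorization policy -/
  auth : Finset (Fin s × Fin u)
  /-- `authWeight D a` is the cost of assigning exactly the set `D` of steps to the user `a` -/
  authWeight : Finset (Fin s) → Fin u → ℕ
  authWeight_eq_zero_iff : ∀ D a, authWeight D a = 0 ↔ ∀ x ∈ D, (x, a) ∈ auth
  /-- the compact description of the authorization weights in the input -/
  authDescr : Data
  constraints : List (WeightedConstraint s r u)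
  budget : ℕ

/-- The constraint weight of a plan for an execution sequence. -/
def Schema.constraintCost (W : Schema) (σ : List (Activity W.s W.r)) (π : Plan W.s W.u) : ℕ :=
  (W.constraints.map fun c => c.weight (c.blocks σ) π).sum

/-- The authorization weight of a plan. -/
def Schema.authCost (W : Schema) (π : Plan W.s W.u) : ℕ :=
  ∑ a : Fin W.u, W.authWeight (π.fiber a) a

/-- The cost `w(σ, π)`. -/
def Schema.cost (W : Schema) (σ : List (Activity W.s W.r)) (π : Plan W.s W.u) : ℕ :=
  W.constraintCost σ π + W.authCost π

/-- The relative cost `f(σ) · w(σ, π)`, for the uniform distribution `f` on the set of execution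
sequences. -/
def Schema.relativeCost (W : Schema) (σ : List (Activity W.s W.r)) (π : Plan W.s W.u) : ℚ :=
  (1 / (W.workflow.execSeqs.card : ℚ)) * (W.cost σ π : ℚ)

/-- The schema has bounded cost. -/
def Schema.BoundedCost (W : Schema) : Prop :=
  ∀ σ ∈ W.workflow.execSeqs, ∃ π : Plan W.s W.u, π.HasDomain (stepsOf σ) ∧
    W.relativeCost σ π ≤ (W.budget : ℚ) / (W.workflow.execSeqs.card : ℚ)

/-! ### Encodings -/

/-- The list of the encoded entries. -/
def encList {α : Type} (e : α → Data) : List α → Data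
  | [] => .nil
  | a :: l => .cons (e a) (encList e l)

/-- Unary numbers, for indices and cardinalities. -/
def encUnary : ℕ → Data
  | 0 => .nil
  | n + 1 => .cons .nil (encUnary n)

def encBool : Bool → Data
  | false => .nil
  | true => .cons .nil .nil

/-- Binary numbers (least significant bit first), for weights and the budget. -/
def encBinary (n : ℕ) : Data := encList encBool n.bits

/-- Sets, by their characteristic vectors. -/
def encFinset {n : ℕ} (D : Finset (Fin n)) : Data :=
  encList encBool (List.ofFn fun x => decide (x ∈ D))

def encPlan {s u : ℕ} (π : Plan s u) : Data :=
  encList (fun o : Option (Fin u) => match o with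
    | none => Data.nil
    | some a => Data.cons .nil (encUnary a)) (List.ofFn π)

def encWorkflow {s r : ℕ} : Workflow s r → Data
  | .atom (.inl x) => .cons (encUnary 0) (encUnary x)
  | .atom (.inr x) => .cons (encUnary 1) (encUnary x)
  | .seq G₁ G₂ => .cons (encUnary 2) (.cons (encWorkflow G₁) (encWorkflow G₂))
  | .par G₁ G₂ => .cons (encUnary 3) (.cons (encWorkflow G₁) (encWorkflow G₂))
  | .xor G₁ G₂ => .cons (encUnary 4) (.cons (encWorkflow G₁) (encWorkflow G₂))

def encAuth {s u : ℕ} (A : Finset (Fin s × Fin u)) : Data :=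
  encList id (List.ofFn fun x : Fin s => encFinset (Finset.univ.filter fun a => (x, a) ∈ A))

def encConstraint {s r u : ℕ} (c : WeightedConstraint s r u) : Data :=
  .cons (encFinset c.scope) (.cons (encFinset c.releases) c.descr)

/-- The encoding of a schema with its budget. -/
def Schema.enc (W : Schema) : Data :=
  encList id
    [encUnary W.s, encUnary W.r, encUnary W.u, encWorkflow W.workflow, encAuth W.auth,
      W.authDescr, encList encConstraint W.constraints, encBinary W.budget]

/-! ### Bounded Cost WSP -/

/-- The weights of `W` are computed, from the compact descriptions in the input, by the program `mC`
(for constraints) and the program `mA` (for authorization) within `q(n)` steps, where `n` is the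
length of the encoding of `W`. -/
structure Schema.WeightsComputedBy (W : Schema) (mC mA : Code) (q : Polynomial ℕ) : Prop where
  constraint : ∀ c ∈ W.constraints, ∀ σ ∈ W.workflow.execSeqs, ∀ π : Plan W.s W.u,
    π.HasDomain (stepsOf σ) → ∃ t ≤ q.eval W.enc.size,
      mC.Runs
        (encList id [encConstraint c, encUnary W.u, encList encFinset (c.blocks σ), encPlan π])
        (encBinary (c.weight (c.blocks σ) π)) t
  auth : ∀ (D : Finset (Fin W.s)) (a : Fin W.u), ∃ t ≤ q.eval W.enc.size,
    mA.Runs (encList id [W.authDescr, encUnary W.u, encFinset D, encUnary a])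
      (encBinary (W.authWeight D a)) t

/-- Bounded Cost WSP, for schemas whose weights are computed by the programs `mC` and `mA` in time
`q(n)`. -/
def boundedCostWSP (mC mA : Code) (q : Polynomial ℕ) : DecisionProblem where
  Inst := {W : Schema // W.WeightsComputedBy mC mA q}
  enc W := W.1.enc
  Yes W := W.1.BoundedCost

end BoundedWSP

/-!
The release points matter only through the way in which they cut an execution sequence into blocks:
two sequences of the same activities have the same costs as soon as every constraint sees the same
blocks, so the order of the steps between two consecutive release points is irrelevant. An
execution sequence is therefore described well enough by the order of all `r` release points (the
absent ones may stand anywhere) and the gap in which every step lies. This is encoded by a *key* for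
every activity, odd for release points and even for steps. There are `r! * (r + 1) ^ s` tables of
keys, and `exists_tables` shows that every execution sequence is sorted by one of them. For a fixed
table, `RawWorkflow.canonical` computes recursively at most one execution sequence for every
resolution of the xor branchings: a serial composition either respects the keys or is discarded,
and a parallel branching merges two sorted sequences. The canonical sequences are execution
sequences (`exists_execSeq_of_mem_canonical`), every sorted execution sequence is a permutation of
a canonical one (`exists_mem_canonical`), and two sorted permutations of each other have the same
blocks (`blocks_eq_of_sorted`). So it suffices to find a plan for every canonical sequence of every
table.

For one sequence, `s ^ s` colourings of the steps are enumerated. By user-independence, the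
constraint weights depend only on which steps share their user, that is, on the colour classes. It
remains to give different users to the classes such that the authorization weight is minimal. This
assignment problem is solved for an order of the classes that is also encoded in the colouring: the
classes pick the best free user one after the other. For a suitable order this is optimal: if
every class's favourite among the free users is held by another class in an optimal assignment,
rotating the users along a cycle of "holds the favourite of" gives some class its favourite without
loss (`exists_reassignment`), and that class may pick first (`exists_serial_order`,
`exists_greedyPlan_eq`). The resulting procedure is `Schema.decides`, correct by
`Schema.decides_iff`.

On the machine side, `Computes F Γ g` says that a single program computes `g i` from the
environment `Γ i`, for all `i`, within `F.time i + 1` times a polynomial in the size of `i`. Such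
statements are composed like the functions themselves: loops over a list of `l` entries multiply
the time factor by `l`, and loop states are encodings of typed values that satisfy an invariant.
Two points need more than that. The weights are numbers in binary, and their length is polynomial
because a program raises the height of a tree by at most one in every step
(`Code.Runs.height_le`). And the recursion on the workflow is replaced by the evaluation of its
postfix notation with a stack (`Computes.canonical`), where the number of sequences obtained by
combining the lists in the stack at most doubles with every xor branching. `Reads.decides`
collects the time bound of the theorem; since it is at most `(κ + 1) ^ (4 * κ)`, which is a
computable function of the parameter `κ`, fixed-parameter tractability follows.
-/

namespace BoundedWSP

open Polynomial

/-! ### Uniform computations over indexed families -/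

/-- The left subtree, with default `nil`; this is what `Code.head` computes. -/
def Data.hd : Data → Data
  | .nil => .nil
  | .cons a _ => a

/-- The right subtree, with default `nil`; this is what `Code.tail` computes. -/
def Data.tl : Data → Data
  | .nil => .nil
  | .cons _ b => b

/-- The setting of a uniform computation over an index type: the valid indices, a size measure on
them in which running times may be polynomial, and a factor of the running time that is not hidden
in a polynomial. -/
structure Frame (ι : Type) where
  Valid : ι → Prop
  size : ι → ℕ
  time : ι → ℕ

/-- The frame with fewer valid indices. -/
def Frame.and {ι : Type} (F : Frame ι) (Q : ι → Prop) : Frame ι :=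
  ⟨fun i => F.Valid i ∧ Q i, F.size, F.time⟩

/-- The frame with another running time factor. -/
def Frame.setTime {ι : Type} (F : Frame ι) (T : ι → ℕ) : Frame ι := ⟨F.Valid, F.size, T⟩

/-- The frame for a computation in which one more variable is bound, with values restricted
by `Q`. -/
def Frame.ext {ι α : Type} (F : Frame ι) (Q : ι → α → Prop) : Frame (ι × α) :=
  ⟨fun x => F.Valid x.1 ∧ Q x.1 x.2, fun x => F.size x.1, fun x => F.time x.1⟩

/-- The environment `Γ` extended by one more variable, encoded by `e`. -/
def push {ι α : Type} (Γ : ι → Data) (e : α → Data) : ι × α → Data :=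
  fun x => .cons (Γ x.1) (e x.2)

/-- One program computes `g i` from `Γ i`, for every valid index `i` of the frame, in time
`(time i + 1) * p (size i)` for some polynomial `p`. -/
def Computes {ι : Type} (F : Frame ι) (Γ g : ι → Data) : Prop :=
  ∃ (M : Code) (p : ℕ[X]), ∀ i, F.Valid i →
    ∃ t ≤ (F.time i + 1) * p.eval (F.size i), M.Runs (Γ i) (g i) t

/-- `m` is bounded by a polynomial in the size. -/
def Frame.PolyBdd {ι : Type} (F : Frame ι) (m : ι → ℕ) : Prop :=
  ∃ q : ℕ[X], ∀ i, F.Valid i → m i ≤ q.eval (F.size i)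

/-- `m` is bounded by the time that the frame allows. -/
def Frame.Allows {ι : Type} (F : Frame ι) (m : ι → ℕ) : Prop :=
  ∃ q : ℕ[X], ∀ i, F.Valid i → m i ≤ (F.time i + 1) * q.eval (F.size i)

section
variable {ι α β γ : Type} {F : Frame ι} {Γ f g : ι → Data}

theorem Frame.PolyBdd.const (k : ℕ) : F.PolyBdd fun _ => k :=
  ⟨C k, fun i _ => by simp⟩

theorem Frame.PolyBdd.add {a b : ι → ℕ} (ha : F.PolyBdd a) (hb : F.PolyBdd b) :
    F.PolyBdd fun i => a i + b i := by
  obtain ⟨p, hp⟩ := ha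
  obtain ⟨q, hq⟩ := hb
  exact ⟨p + q, fun i hi => by rw [eval_add]; exact Nat.add_le_add (hp i hi) (hq i hi)⟩

theorem Frame.PolyBdd.mul {a b : ι → ℕ} (ha : F.PolyBdd a) (hb : F.PolyBdd b) :
    F.PolyBdd fun i => a i * b i := by
  obtain ⟨p, hp⟩ := ha
  obtain ⟨q, hq⟩ := hb
  exact ⟨p * q, fun i hi => by rw [eval_mul]; exact Nat.mul_le_mul (hp i hi) (hq i hi)⟩

theorem Frame.PolyBdd.of_le {a b : ι → ℕ} (hb : F.PolyBdd b) (h : ∀ i, F.Valid i → a i ≤ b i) :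
    F.PolyBdd a := by
  obtain ⟨q, hq⟩ := hb
  exact ⟨q, fun i hi => (h i hi).trans (hq i hi)⟩

theorem Frame.PolyBdd.lift {a : ι → ℕ} (h : F.PolyBdd a) {Q : ι → α → Prop} :
    (F.ext Q).PolyBdd fun x => a x.1 := by
  obtain ⟨q, hq⟩ := h
  exact ⟨q, fun x hx => hq x.1 hx.1⟩

theorem Frame.PolyBdd.and {a : ι → ℕ} (h : F.PolyBdd a) {Q : ι → Prop} :
    (F.and Q).PolyBdd a := by
  obtain ⟨q, hq⟩ := h
  exact ⟨q, fun x hx => hq x hx.1⟩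

theorem Frame.PolyBdd.setTime {a : ι → ℕ} (h : F.PolyBdd a) {T : ι → ℕ} :
    (F.setTime T).PolyBdd a := h

theorem Frame.PolyBdd.size : F.PolyBdd F.size := ⟨X, fun i _ => by simp⟩

/-- A polynomially bounded number of repetitions is allowed. -/
theorem Frame.PolyBdd.allows {a : ι → ℕ} (h : F.PolyBdd a) :
    F.Allows fun i => (a i + 1) * (F.time i + 1) := by
  obtain ⟨q, hq⟩ := h.add (.const 1)
  exact ⟨q, fun i hi => (Nat.mul_le_mul_right _ (hq i hi)).trans (mul_comm _ _).le⟩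

theorem Computes.congr (h : Computes F Γ f) (e : ∀ i, F.Valid i → f i = g i) :
    Computes F Γ g := by
  obtain ⟨M, p, h⟩ := h
  exact ⟨M, p, fun i hi => e i hi ▸ h i hi⟩

/-- Composition with reindexing. -/
theorem Computes.reindex {κ : Type} {F' : Frame κ} {Γ' g' : κ → Data}
    (h : Computes F' Γ' g') (φ : ι → κ) (hv : ∀ i, F.Valid i → F'.Valid (φ i))
    (hs : ∀ i, F.Valid i → F'.size (φ i) = F.size i)
    (ht : ∀ i, F.Valid i → F'.time (φ i) ≤ F.time i) :
    Computes F (fun i => Γ' (φ i)) (fun i => g' (φ i)) := by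
  obtain ⟨M, p, h⟩ := h
  refine ⟨M, p, fun i hi => ?_⟩
  obtain ⟨t, h1, h2⟩ := h _ (hv i hi)
  rw [hs i hi] at h1
  exact ⟨t, h1.trans (Nat.mul_le_mul_right _ (Nat.succ_le_succ (ht i hi))), h2⟩

theorem Computes.and (h : Computes F Γ g) {Q : ι → Prop} : Computes (F.and Q) Γ g :=
  h.reindex (fun i => i) (fun _ hi => hi.1) (fun _ _ => rfl) fun _ _ => le_rfl

/-- Time that is already allowed need not be written into the frame. -/
theorem Computes.ofTime {T : ι → ℕ} (h : Computes (F.setTime T) Γ g)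
    (hT : F.Allows fun i => T i + 1) : Computes F Γ g := by
  obtain ⟨M, p, h⟩ := h
  obtain ⟨q, hq⟩ := hT
  refine ⟨M, q * p, fun i hi => ?_⟩
  obtain ⟨t, h1, h2⟩ := h i hi
  refine ⟨t, h1.trans ?_, h2⟩
  rw [eval_mul, ← mul_assoc]
  exact Nat.mul_le_mul_right _ (hq i hi)

theorem Computes.id : Computes F Γ Γ :=
  ⟨.id, 1, fun i _ => ⟨1, by simp, .id _⟩⟩

theorem Computes.nil : Computes F Γ fun _ => .nil :=
  ⟨.nil, 1, fun i _ => ⟨1, by simp, .nil _⟩⟩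

theorem time_add {T a b t₁ t₂ : ℕ} (h₁ : t₁ ≤ (T + 1) * a) (h₂ : t₂ ≤ (T + 1) * b) :
    t₁ + t₂ + 1 ≤ (T + 1) * (a + b + 1) := by
  have : 1 ≤ T + 1 := Nat.le_add_left _ _
  rw [mul_add, mul_add, mul_one]
  omega

theorem Computes.comp (hf : Computes F Γ f) (hg : Computes F f g) : Computes F Γ g := by
  obtain ⟨M, p, hf⟩ := hf
  obtain ⟨N, q, hg⟩ := hg
  refine ⟨.comp N M, p + q + 1, fun i hi => ?_⟩
  obtain ⟨t, h1, h2⟩ := hf i hi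
  obtain ⟨t', h1', h2'⟩ := hg i hi
  exact ⟨_, by simpa using time_add h1 h1', .comp h2 h2'⟩

theorem Computes.cons (hf : Computes F Γ f) (hg : Computes F Γ g) :
    Computes F Γ fun i => .cons (f i) (g i) := by
  obtain ⟨M, p, hf⟩ := hf
  obtain ⟨N, q, hg⟩ := hg
  refine ⟨.pair M N, p + q + 1, fun i hi => ?_⟩
  obtain ⟨t, h1, h2⟩ := hf i hi
  obtain ⟨t', h1', h2'⟩ := hg i hi
  exact ⟨_, by simpa using time_add h1 h1', .pair h2 h2'⟩

theorem Computes.const (d : Data) : Computes F Γ fun _ => d := by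
  induction d with
  | nil => exact .nil
  | cons a b ha hb => exact ha.cons hb

theorem Code.runs_head (d : Data) : Code.head.Runs d d.hd 1 := by
  cases d
  · exact .head_nil
  · exact .head_cons _ _

theorem Code.runs_tail (d : Data) : Code.tail.Runs d d.tl 1 := by
  cases d
  · exact .tail_nil
  · exact .tail_cons _ _

theorem Computes.hd (hf : Computes F Γ f) : Computes F Γ fun i => (f i).hd :=
  hf.comp ⟨.head, 1, fun i _ => ⟨1, by simp, Code.runs_head _⟩⟩

theorem Computes.tl (hf : Computes F Γ f) : Computes F Γ fun i => (f i).tl :=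
  hf.comp ⟨.tail, 1, fun i _ => ⟨1, by simp, Code.runs_tail _⟩⟩

theorem Computes.snd (h : Computes F Γ fun i => .cons (f i) (g i)) : Computes F Γ g := h.tl

/-- Application of a given program that is known to be fast on the relevant data. -/
theorem Computes.call (h : Computes F Γ f) {M : Code} {q : ι → ℕ} (hq : F.PolyBdd q)
    (hM : ∀ i, F.Valid i → ∃ t ≤ q i, M.Runs (f i) (g i) t) : Computes F Γ g := by
  obtain ⟨p, hp⟩ := hq
  refine h.comp ⟨M, p, fun i hi => ?_⟩
  obtain ⟨t, h1, h2⟩ := hM i hi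
  exact ⟨t, (h1.trans (hp i hi)).trans (Nat.le_mul_of_pos_left _ (Nat.succ_pos _)), h2⟩

/-- Case distinction by the emptiness of a tree. -/
theorem Computes.cases {d : ι → Data} (hd : Computes F Γ d)
    (hf : Computes (F.and fun i => d i ≠ .nil) Γ g)
    (hg : Computes (F.and fun i => d i = .nil) Γ g) : Computes F Γ g := by
  obtain ⟨D, p, hd⟩ := hd
  obtain ⟨M, q, hf⟩ := hf
  obtain ⟨N, r, hg⟩ := hg
  refine ⟨.cond D M N, p + (q + r) + 1, fun i hi => ?_⟩
  obtain ⟨t, h1, h2⟩ := hd i hi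
  rcases h : d i with _ | ⟨x, y⟩
  · obtain ⟨t', h1', h2'⟩ := hg i ⟨hi, h⟩
    rw [h] at h2
    change t' ≤ (F.time i + 1) * r.eval (F.size i) at h1'
    exact ⟨_, by simpa using time_add h1 (h1'.trans (Nat.mul_le_mul_left _
      (Nat.le_add_left _ (q.eval (F.size i))))), .cond_else h2 h2'⟩
  · obtain ⟨t', h1', h2'⟩ := hf i ⟨hi, by simp [h]⟩
    rw [h] at h2
    change t' ≤ (F.time i + 1) * q.eval (F.size i) at h1'
    exact ⟨_, by simpa using time_add h1 (h1'.trans (Nat.mul_le_mul_left _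
      (Nat.le_add_right _ (r.eval (F.size i))))), .cond_then h2 h2'⟩

theorem Computes.lift (h : Computes F Γ g) {Q : ι → α → Prop} {e : α → Data} :
    Computes (F.ext Q) (push Γ e) fun x => g x.1 :=
  Computes.comp (f := fun x => Γ x.1) (Computes.id (Γ := push Γ e)).hd
    (h.reindex (F := F.ext Q) Prod.fst (fun _ hi => hi.1) (fun _ _ => rfl) fun _ _ => le_rfl)

theorem Computes.top {Q : ι → α → Prop} {e : α → Data} :
    Computes (F.ext Q) (push Γ e) fun x => e x.2 :=
  (Computes.id (Γ := push Γ e)).tl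

/-! ### Loops -/

/-- The while loop. The variable is initially `b i`; `fin i` maps every value of the variable to the
value at the end of the loop, and `μ` bounds the number of remaining rounds. -/
theorem Computes.while {e : β → Data} {b : ι → β} (Inv : ι → β → Prop) {c : ι → β → Data}
    (st fin : ι → β → β) (μ : ι → β → ℕ)
    (hb : Computes F Γ fun i => e (b i))
    (hc : Computes (F.ext Inv) (push Γ e) fun x => c x.1 x.2)
    (hst : Computes ((F.ext Inv).and fun x => c x.1 x.2 ≠ .nil) (push Γ e)
      fun x => e (st x.1 x.2))
    (h0 : ∀ i, F.Valid i → Inv i (b i))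
    (hstep : ∀ i v, F.Valid i → Inv i v → c i v ≠ .nil →
      Inv i (st i v) ∧ μ i (st i v) < μ i v ∧ fin i v = fin i (st i v))
    (hfin : ∀ i v, F.Valid i → Inv i v → c i v = .nil → fin i v = v)
    (hμ : F.PolyBdd fun i => μ i (b i)) :
    Computes F Γ fun i => e (fin i (b i)) := by
  obtain ⟨D, p, hc⟩ := hc
  obtain ⟨M, q, hst⟩ := hst
  suffices h : Computes F (fun i => push Γ e (i, b i)) fun i => push Γ e (i, fin i (b i)) from
    (Computes.id.cons hb).comp h.snd
  obtain ⟨r, hr⟩ := hμ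
  refine ⟨.loop D (.pair .head M), (r + 1) * (p + q + 4), fun i hi => ?_⟩
  have key : ∀ k v, Inv i v → μ i v ≤ k →
      ∃ t ≤ (k + 1) * ((F.time i + 1) * (p.eval (F.size i) + q.eval (F.size i) + 4)),
      (Code.loop D (.pair .head M)).Runs (push Γ e (i, v)) (push Γ e (i, fin i v)) t := by
    intro k
    induction k with
    | zero =>
      intro v hv hk
      obtain ⟨t, h1, h2⟩ := hc (i, v) ⟨hi, hv⟩
      by_cases h : c i v = .nil
      · rw [hfin i v hi hv h]
        refine ⟨t + 1, ?_, Code.Runs.loop_stop (h ▸ h2)⟩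
        simp only [Frame.ext] at h1
        nlinarith
      · have := (hstep i v hi hv h).2.1
        omega
    | succ k ih =>
      intro v hv hk
      obtain ⟨t, h1, h2⟩ := hc (i, v) ⟨hi, hv⟩
      by_cases h : c i v = .nil
      · rw [hfin i v hi hv h]
        refine ⟨t + 1, ?_, Code.Runs.loop_stop (h ▸ h2)⟩
        simp only [Frame.ext] at h1
        nlinarith [Nat.zero_le (k * ((F.time i + 1) *
          (p.eval (F.size i) + q.eval (F.size i) + 4)))]
      · obtain ⟨h3, h4, h5⟩ := hstep i v hi hv h
        obtain ⟨t', h1', h2'⟩ := hst (i, v) ⟨⟨hi, hv⟩, h⟩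
        obtain ⟨t'', h1'', h2''⟩ := ih (st i v) h3 (by omega)
        simp only at h2
        rcases hcv : c i v with _ | ⟨x, y⟩
        · exact absurd hcv h
        rw [hcv] at h2
        rw [h5]
        refine ⟨_, ?_, .loop_step h2 (.pair (.head_cons _ _) h2') h2''⟩
        simp only [Frame.ext, Frame.and] at h1 h1'
        rw [Nat.succ_mul (k + 1)]
        generalize (k + 1) * ((F.time i + 1) *
          (p.eval (F.size i) + q.eval (F.size i) + 4)) = A at h1'' ⊢
        nlinarith
  obtain ⟨t, h1, h2⟩ := key _ _ (h0 i hi) (hr i hi)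
  refine ⟨t, h1.trans (le_of_eq ?_), h2⟩
  simp
  ring

/-- Left folds over lists. The invariant may refer to the part of the list that has still to be
processed, and the time factor `T` of one round may differ from that of the whole loop. -/
theorem Computes.foldlTime {ea : α → Data} {eb : β → Data} {l : ι → List α} {b : ι → β}
    {st : ι → β → α → β} (T : ι → ℕ) (Inv : ι → List α → β → Prop)
    (hl : Computes F Γ fun i => encList ea (l i)) (hb : Computes F Γ fun i => eb (b i))
    (hst : Computes (((F.setTime T).ext fun _ (_ : α) => True).ext
      fun x v => ∃ l', Inv x.1 (x.2 :: l') v) (push (push Γ ea) eb)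
      fun x => eb (st x.1.1 x.2 x.1.2))
    (h0 : ∀ i, F.Valid i → Inv i (l i) (b i))
    (hstep : ∀ i a l v, F.Valid i → Inv i (a :: l) v → Inv i l (st i v a))
    (hT : F.Allows fun i => ((l i).length + 1) * (T i + 1)) :
    Computes F Γ fun i => eb ((l i).foldl (st i) (b i)) := by
  obtain ⟨M, q, hst⟩ := hst
  let s : ι → List α → β → Data := fun i l v => .cons (Γ i) (.cons (encList ea l) (eb v))
  suffices h : Computes F (fun i => s i (l i) (b i)) fun i => s i [] ((l i).foldl (st i) (b i)) from
    (Computes.id.cons (hl.cons hb)).comp h.snd.snd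
  let N : Code := .pair .head (.pair (.comp .tail (.comp .head .tail))
    (.comp M (.pair (.pair .head (.comp .head (.comp .head .tail))) (.comp .tail .tail))))
  obtain ⟨r, hr⟩ := hT
  refine ⟨.loop (.comp .head .tail) N, r * (q + 40), fun i hi => ?_⟩
  have key : ∀ l v, Inv i l v →
      ∃ t ≤ (l.length + 1) * ((T i + 1) * (q.eval (F.size i) + 40)),
      (Code.loop (.comp .head .tail) N).Runs (s i l v) (s i [] (l.foldl (st i) v)) t := by
    intro l
    induction l with
    | nil =>
      intro v _
      refine ⟨1 + 1 + 1 + 1, ?_, Code.Runs.loop_stop (.comp (.tail_cons _ _) (.head_cons _ _))⟩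
      nlinarith [Nat.zero_le (T i * (q.eval (F.size i) + 40))]
    | cons a l ih =>
      intro v hv
      obtain ⟨t, h1, h2⟩ := hst ((i, a), v) ⟨⟨hi, trivial⟩, l, hv⟩
      obtain ⟨t', h1', h2'⟩ := ih _ (hstep i a l v hi hv)
      refine ⟨_, ?_, .loop_step (.comp (.tail_cons _ _) (.head_cons _ _))
        (.pair (.head_cons _ _) (.pair (.comp (.comp (.tail_cons _ _) (.head_cons _ _))
          (.tail_cons _ _)) (.comp (.pair (.pair (.head_cons _ _) (.comp (.comp (.tail_cons _ _)
            (.head_cons _ _)) (.head_cons _ _))) (.comp (.tail_cons _ _) (.tail_cons _ _))) h2)))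
        h2'⟩
      simp only [Frame.ext, Frame.setTime] at h1
      rw [List.length_cons, Nat.succ_mul (l.length + 1)]
      generalize (l.length + 1) * ((T i + 1) * (q.eval (F.size i) + 40)) = A at h1' ⊢
      nlinarith
  obtain ⟨t, h1, h2⟩ := key _ _ (h0 i hi)
  refine ⟨t, h1.trans ?_, h2⟩
  have := Nat.mul_le_mul_right (q.eval (F.size i) + 40) (hr i hi)
  simp only [eval_mul, eval_add, eval_ofNat]
  rw [← mul_assoc, ← mul_assoc]
  exact this

/-- Left folds over lists of polynomial length. -/
theorem Computes.foldl {ea : α → Data} {eb : β → Data} {l : ι → List α} {b : ι → β}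
    {st : ι → β → α → β} (Inv : ι → β → Prop)
    (hl : Computes F Γ fun i => encList ea (l i)) (hb : Computes F Γ fun i => eb (b i))
    (hst : Computes ((F.ext fun i (a : α) => a ∈ l i).ext fun x v => Inv x.1 v)
      (push (push Γ ea) eb) fun x => eb (st x.1.1 x.2 x.1.2))
    (h0 : ∀ i, F.Valid i → Inv i (b i))
    (hstep : ∀ i a v, F.Valid i → a ∈ l i → Inv i v → Inv i (st i v a))
    (hlen : F.PolyBdd fun i => (l i).length) :
    Computes F Γ fun i => eb ((l i).foldl (st i) (b i)) := by
  refine Computes.foldlTime F.time (fun i l' v => l' <:+ l i ∧ Inv i v) hl hb ?_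
    (fun i hi => ⟨List.suffix_rfl, h0 i hi⟩)
    (fun i a l' v hi h => ⟨(List.suffix_cons _ _).trans h.1,
      hstep i a v hi (h.1.subset List.mem_cons_self) h.2⟩) hlen.allows
  refine hst.reindex (fun x => x) ?_ (fun _ _ => rfl) fun _ _ => le_rfl
  rintro ⟨⟨i, a⟩, v⟩ ⟨⟨hi, -⟩, l', h, h'⟩
  exact ⟨⟨hi, h.subset List.mem_cons_self⟩, h'⟩

end

/-! ### Booleans, unary numbers and lists -/

/-- Pairs, encoded componentwise. -/
def encPair {α β : Type} (ea : α → Data) (eb : β → Data) (x : α × β) : Data :=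
  .cons (ea x.1) (eb x.2)

/-- Optional values. -/
def encOption {α : Type} (e : α → Data) : Option α → Data
  | none => .nil
  | some a => .cons .nil (e a)

section
variable {ι α β γ : Type} {F : Frame ι} {Γ f g : ι → Data}

theorem Frame.PolyBdd.toAllows {a : ι → ℕ} (h : F.PolyBdd a) : F.Allows a := by
  obtain ⟨q, hq⟩ := h
  exact ⟨q, fun i hi => (hq i hi).trans (Nat.le_mul_of_pos_left _ (Nat.succ_pos _))⟩

theorem Frame.Allows.add {a b : ι → ℕ} (ha : F.Allows a) (hb : F.Allows b) :
    F.Allows fun i => a i + b i := by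
  obtain ⟨p, hp⟩ := ha
  obtain ⟨q, hq⟩ := hb
  exact ⟨p + q, fun i hi => by
    rw [eval_add, mul_add]; exact Nat.add_le_add (hp i hi) (hq i hi)⟩

theorem Frame.Allows.of_le {a b : ι → ℕ} (hb : F.Allows b) (h : ∀ i, F.Valid i → a i ≤ b i) :
    F.Allows a := by
  obtain ⟨q, hq⟩ := hb
  exact ⟨q, fun i hi => (h i hi).trans (hq i hi)⟩

/-- A computation in an extended environment that ignores the last but one variable. -/
theorem Computes.liftMid {Q₂ : ι → β → Prop} {e₂ : β → Data} {g : ι × β → Data}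
    (h : Computes (F.ext Q₂) (push Γ e₂) g) {Q₁ : ι → α → Prop} {e₁ : α → Data}
    {Q₃ : ι × α → β → Prop} (hQ : ∀ i a b, F.Valid i → Q₁ i a → Q₃ (i, a) b → Q₂ i b) :
    Computes ((F.ext Q₁).ext Q₃) (push (push Γ e₁) e₂) fun x => g (x.1.1, x.2) :=
  Computes.comp (f := fun x => push Γ e₂ (x.1.1, x.2))
    (Computes.cons (f := fun x : (ι × α) × β => Γ x.1.1)
      (Computes.id (Γ := push (push Γ e₁) e₂)).hd.hd Computes.top)
    (h.reindex (F := (F.ext Q₁).ext Q₃) (fun x => (x.1.1, x.2))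
      (fun _ hx => ⟨hx.1.1, hQ _ _ _ hx.1.1 hx.1.2 hx.2⟩) (fun _ _ => rfl) fun _ _ => le_rfl)

theorem Computes.bcases {b : ι → Bool} (hb : Computes F Γ fun i => encBool (b i))
    (h₁ : Computes (F.and fun i => b i = true) Γ g)
    (h₂ : Computes (F.and fun i => b i = false) Γ g) : Computes F Γ g := by
  refine hb.cases (h₁.reindex (fun i => i) ?_ (fun _ _ => rfl) fun _ _ => le_rfl)
    (h₂.reindex (fun i => i) ?_ (fun _ _ => rfl) fun _ _ => le_rfl)
  · rintro i ⟨hi, h⟩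
    refine ⟨hi, ?_⟩
    rcases Bool.eq_false_or_eq_true (b i) with hb | hb
    · exact hb
    · exact absurd (by rw [hb]; rfl) h
  · rintro i ⟨hi, h⟩
    refine ⟨hi, ?_⟩
    rcases Bool.eq_false_or_eq_true (b i) with hb | hb
    · rw [hb] at h; cases h
    · exact hb

theorem Computes.ite {b : ι → Bool} {e : β → Data} {x y : ι → β}
    (hb : Computes F Γ fun i => encBool (b i))
    (hx : Computes (F.and fun i => b i = true) Γ fun i => e (x i))
    (hy : Computes (F.and fun i => b i = false) Γ fun i => e (y i)) :
    Computes F Γ fun i => e (if b i then x i else y i) :=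
  hb.bcases (hx.congr fun i hi => by rw [if_pos hi.2])
    (hy.congr fun i hi => by rw [if_neg (by simp [hi.2])])

/-- Functions of a Boolean argument. -/
theorem Computes.boolElim {b : ι → Bool} {h : Bool → ι → Data}
    (hb : Computes F Γ fun i => encBool (b i)) (hh : ∀ c, Computes F Γ (h c)) :
    Computes F Γ fun i => h (b i) i :=
  hb.bcases ((hh true).and.congr fun i hi => by rw [hi.2])
    ((hh false).and.congr fun i hi => by rw [hi.2])

theorem Computes.pairFst {ea : α → Data} {eb : β → Data} {v : ι → α × β}
    (h : Computes F Γ fun i => encPair ea eb (v i)) : Computes F Γ fun i => ea (v i).1 := h.hd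

theorem Computes.pairSnd {ea : α → Data} {eb : β → Data} {v : ι → α × β}
    (h : Computes F Γ fun i => encPair ea eb (v i)) : Computes F Γ fun i => eb (v i).2 := h.tl

theorem Computes.pairMk {ea : α → Data} {eb : β → Data} {a : ι → α} {b : ι → β}
    (ha : Computes F Γ fun i => ea (a i)) (hb : Computes F Γ fun i => eb (b i)) :
    Computes F Γ fun i => encPair ea eb (a i, b i) := ha.cons hb

theorem Computes.not {b : ι → Bool} (hb : Computes F Γ fun i => encBool (b i)) :
    Computes F Γ fun i => encBool (!b i) :=
  hb.boolElim (h := fun c _ => encBool (!c)) fun _ => .const _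

theorem Computes.bool₂ (op : Bool → Bool → Bool) {a b : ι → Bool}
    (ha : Computes F Γ fun i => encBool (a i)) (hb : Computes F Γ fun i => encBool (b i)) :
    Computes F Γ fun i => encBool (op (a i) (b i)) :=
  ha.boolElim (h := fun c i => encBool (op c (b i))) fun c =>
    hb.boolElim (h := fun d _ => encBool (op c d)) fun d => .const (encBool (op c d))

theorem Computes.bool₃ (op : Bool → Bool → Bool → Bool) {a b c : ι → Bool}
    (ha : Computes F Γ fun i => encBool (a i)) (hb : Computes F Γ fun i => encBool (b i))
    (hc : Computes F Γ fun i => encBool (c i)) :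
    Computes F Γ fun i => encBool (op (a i) (b i) (c i)) :=
  ha.boolElim (h := fun d i => encBool (op d (b i) (c i))) fun d => hb.bool₂ (op d) hc

theorem Computes.isNil {d : ι → Data} {b : ι → Bool} (hd : Computes F Γ d)
    (h : ∀ i, F.Valid i → (d i = .nil ↔ b i = true)) : Computes F Γ fun i => encBool (b i) :=
  hd.cases
    ((Computes.const (encBool false)).congr fun i hi => by
      cases hb : b i
      · rfl
      · exact absurd ((h i hi.1).2 hb) hi.2)
    ((Computes.const (encBool true)).congr fun i hi => by rw [(h i hi.1).1 hi.2])

theorem encList_eq_nil {e : α → Data} {l : List α} : encList e l = .nil ↔ l = [] := by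
  cases l <;> simp [encList]

theorem encUnary_eq_nil {k : ℕ} : encUnary k = .nil ↔ k = 0 := by
  cases k <;> simp [encUnary]

theorem hd_encList {e : α → Data} {d : α} (hd : e d = .nil) (l : List α) :
    (encList e l).hd = e (l.headD d) := by
  cases l
  · exact hd.symm
  · rfl

theorem tl_encList {e : α → Data} (l : List α) : (encList e l).tl = encList e l.tail := by
  cases l <;> rfl

theorem encUnary_eq_encList (k : ℕ) :
    encUnary k = encList (fun _ : Unit => Data.nil) (List.replicate k ()) := by
  induction k with
  | zero => rfl
  | succ k ih => rw [encUnary, ih]; rfl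

theorem foldl_replicate_unit (h : β → β) (k : ℕ) (b : β) :
    (List.replicate k ()).foldl (fun v _ => h v) b = h^[k] b := by
  induction k generalizing b with
  | zero => rfl
  | succ k ih => exact ih (h b)

/-- Iteration, a number of times that is given in unary. -/
theorem Computes.iterate {k : ι → ℕ} {e : β → Data} {b : ι → β} {st : ι → β → β}
    (T : ι → ℕ) (Inv : ι → ℕ → β → Prop)
    (hk : Computes F Γ fun i => encUnary (k i)) (hb : Computes F Γ fun i => e (b i))
    (hst : Computes ((F.setTime T).ext fun i v => ∃ j, Inv i (j + 1) v) (push Γ e)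
      fun x => e (st x.1 x.2))
    (h0 : ∀ i, F.Valid i → Inv i (k i) (b i))
    (hstep : ∀ i j v, F.Valid i → Inv i (j + 1) v → Inv i j (st i v))
    (hT : F.Allows fun i => (k i + 1) * (T i + 1)) :
    Computes F Γ fun i => e ((st i)^[k i] (b i)) := by
  have := Computes.foldlTime (F := F) (Γ := Γ) (ea := fun _ : Unit => Data.nil) (eb := e)
    (l := fun i => List.replicate (k i) ()) (b := b) (st := fun i v _ => st i v) T
    (fun i l v => Inv i l.length v) (hk.congr fun i _ => encUnary_eq_encList _) hb
    (hst.liftMid fun i _ v _ _ ⟨l', h⟩ => ⟨_, h⟩) (fun i hi => by simpa using h0 i hi)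
    (fun i _ l v hi h => hstep i _ v hi h) (by simpa using hT)
  exact this.congr fun i _ => by rw [foldl_replicate_unit]

/-- Iteration a polynomial number of times. -/
theorem Computes.iteratePoly {k : ι → ℕ} {e : β → Data} {b : ι → β} {st : ι → β → β}
    (hk : Computes F Γ fun i => encUnary (k i)) (hb : Computes F Γ fun i => e (b i))
    (hst : Computes (F.ext fun _ _ => True) (push Γ e) fun x => e (st x.1 x.2))
    (hlen : F.PolyBdd k) : Computes F Γ fun i => e ((st i)^[k i] (b i)) :=
  Computes.iterate F.time (fun _ _ _ => True) hk hb
    (hst.reindex (fun x => x) (fun _ h => ⟨h.1, trivial⟩) (fun _ _ => rfl) fun _ _ => le_rfl)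
    (fun _ _ => trivial) (fun _ _ _ _ _ => trivial) hlen.allows

theorem Computes.succ {k : ι → ℕ} (h : Computes F Γ fun i => encUnary (k i)) :
    Computes F Γ fun i => encUnary (k i + 1) := Computes.nil.cons h

theorem Computes.pred {k : ι → ℕ} (h : Computes F Γ fun i => encUnary (k i)) :
    Computes F Γ fun i => encUnary (k i - 1) :=
  h.tl.congr fun i _ => by cases k i <;> rfl

theorem Computes.sub {a b : ι → ℕ} (ha : Computes F Γ fun i => encUnary (a i))
    (hb : Computes F Γ fun i => encUnary (b i)) (hlen : F.PolyBdd b) :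
    Computes F Γ fun i => encUnary (a i - b i) := by
  refine (Computes.iteratePoly (st := fun _ v => v - 1) hb ha Computes.top.pred hlen).congr
    fun i _ => ?_
  rw [show (fun v => v - 1) = Nat.pred from rfl, Nat.pred_iterate]

theorem Computes.isZero {k : ι → ℕ} (h : Computes F Γ fun i => encUnary (k i)) :
    Computes F Γ fun i => encBool (decide (k i = 0)) :=
  h.isNil fun i _ => by rw [encUnary_eq_nil, decide_eq_true_iff]

theorem Computes.le {a b : ι → ℕ} (ha : Computes F Γ fun i => encUnary (a i))
    (hb : Computes F Γ fun i => encUnary (b i)) (hlen : F.PolyBdd b) :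
    Computes F Γ fun i => encBool (decide (a i ≤ b i)) :=
  (ha.sub hb hlen).isZero.congr fun i _ => by simp only [Nat.sub_eq_zero_iff_le]

theorem Computes.eq {a b : ι → ℕ} (ha : Computes F Γ fun i => encUnary (a i))
    (hb : Computes F Γ fun i => encUnary (b i)) (hla : F.PolyBdd a) (hlb : F.PolyBdd b) :
    Computes F Γ fun i => encBool (decide (a i = b i)) :=
  ((ha.le hb hlb).bool₂ (fun x y => x && y) (hb.le ha hla)).congr fun i _ => by
    rw [← Bool.decide_and]
    simp only [← Nat.le_antisymm_iff]

theorem Computes.double {a : ι → ℕ} (ha : Computes F Γ fun i => encUnary (a i))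
    (hla : F.PolyBdd a) : Computes F Γ fun i => encUnary (2 * a i) :=
  (Computes.iteratePoly (st := fun _ v => v + 2) ha (.const (encUnary 0))
    Computes.top.succ.succ hla).congr fun i _ => by simp [mul_comm]

theorem Computes.headD {e : α → Data} {d : α} (hd : e d = .nil) {l : ι → List α}
    (hl : Computes F Γ fun i => encList e (l i)) : Computes F Γ fun i => e ((l i).headD d) :=
  hl.hd.congr fun _ _ => hd_encList hd _

theorem Computes.ltail {e : α → Data} {l : ι → List α}
    (hl : Computes F Γ fun i => encList e (l i)) : Computes F Γ fun i => encList e (l i).tail :=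
  hl.tl.congr fun _ _ => tl_encList _

theorem Computes.isEmpty {e : α → Data} {l : ι → List α}
    (hl : Computes F Γ fun i => encList e (l i)) : Computes F Γ fun i => encBool (l i).isEmpty :=
  hl.isNil fun i _ => by rw [encList_eq_nil, List.isEmpty_iff]

theorem Computes.lcons {e : α → Data} {a : ι → α} {l : ι → List α}
    (ha : Computes F Γ fun i => e (a i)) (hl : Computes F Γ fun i => encList e (l i)) :
    Computes F Γ fun i => encList e (a i :: l i) := ha.cons hl

theorem Computes.getD {e : α → Data} {d : α} (hd : e d = .nil) {l : ι → List α} {k : ι → ℕ}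
    (hl : Computes F Γ fun i => encList e (l i)) (hk : Computes F Γ fun i => encUnary (k i))
    (hlen : F.PolyBdd k) : Computes F Γ fun i => e ((l i).getD (k i) d) := by
  refine ((Computes.iteratePoly (st := fun _ v => v.tail) hk hl
    Computes.top.ltail hlen).headD hd).congr fun i _ => ?_
  congr 1
  generalize l i = m
  induction k i generalizing m with
  | zero => cases m <;> rfl
  | succ k ih =>
    rw [Function.iterate_succ_apply, ih]
    cases m
    · simp
    · rfl

theorem Computes.reverseAppend {e : α → Data} {l m : ι → List α}
    (hl : Computes F Γ fun i => encList e (l i)) (hm : Computes F Γ fun i => encList e (m i))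
    (hlen : F.Allows fun i => (l i).length) :
    Computes F Γ fun i => encList e ((l i).reverse ++ m i) := by
  refine (Computes.foldlTime (st := fun _ v a => a :: v) (fun _ => 0) (fun _ _ _ => True) hl hm
    (Computes.lcons (Computes.top (e := e)).lift Computes.top) (fun _ _ => trivial)
    (fun _ _ _ _ _ _ => trivial) (by simpa using hlen.add (Frame.PolyBdd.const 1).toAllows)).congr
    fun i _ => ?_
  rw [List.foldl_flip_cons_eq_append']

theorem Computes.reverse {e : α → Data} {l : ι → List α}
    (hl : Computes F Γ fun i => encList e (l i)) (hlen : F.Allows fun i => (l i).length) :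
    Computes F Γ fun i => encList e (l i).reverse :=
  (hl.reverseAppend (m := fun _ => []) Computes.nil hlen).congr fun _ _ => by
    rw [List.append_nil]

theorem Computes.append {e : α → Data} {l m : ι → List α}
    (hl : Computes F Γ fun i => encList e (l i)) (hm : Computes F Γ fun i => encList e (m i))
    (hlen : F.Allows fun i => (l i).length) :
    Computes F Γ fun i => encList e (l i ++ m i) :=
  ((hl.reverse hlen).reverseAppend hm (by simpa using hlen)).congr fun _ _ => by
    rw [List.reverse_reverse]

/-- Concatenation of the lists that a function takes on the entries of a list. -/
theorem Computes.flatMapTime {ea : α → Data} {eb : β → Data} {l : ι → List α}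
    {h : ι → α → List β} (T : ι → ℕ)
    (hl : Computes F Γ fun i => encList ea (l i))
    (hh : Computes ((F.setTime T).ext fun i a => a ∈ l i) (push Γ ea)
      fun x => encList eb (h x.1 x.2))
    (hlen : ((F.setTime T).ext fun i a => a ∈ l i).Allows fun x => (h x.1 x.2).length)
    (hT : F.Allows fun i => ((l i).length + 1) * (T i + 1)) :
    Computes F Γ fun i => encList eb ((l i).flatMap (h i)) := by
  have h1 : Computes F Γ fun i => encList eb ((l i).flatMap (h i)).reverse := by
    refine (Computes.foldlTime (st := fun i v a => (h i a).reverse ++ v) (b := fun _ => []) T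
      (fun i l' _ => l' <:+ l i) hl (Computes.const (encList eb [])) ?_ (fun _ _ => List.suffix_rfl)
      (fun i a l' _ _ h => (List.suffix_cons _ _).trans h) hT).congr fun i _ => ?_
    · refine Computes.reverseAppend (F := ((F.setTime T).ext _).ext _) (e := eb)
        (l := fun x => h x.1.1 x.1.2) ?_ Computes.top ?_
      · refine hh.lift.reindex (F := ((F.setTime T).ext _).ext _) (fun x => x) ?_
          (fun _ _ => rfl) (fun _ _ => le_rfl) (κ := (ι × α) × List β)
          (F' := ((F.setTime T).ext fun i a => a ∈ l i).ext fun _ _ => True)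
        rintro x ⟨⟨hi, -⟩, l', hl'⟩
        exact ⟨⟨hi, hl'.subset List.mem_cons_self⟩, trivial⟩
      · obtain ⟨q, hq⟩ := hlen
        refine ⟨q, ?_⟩
        rintro x ⟨⟨hi, -⟩, l', hl'⟩
        exact hq x.1 ⟨hi, hl'.subset List.mem_cons_self⟩
    · have key : ∀ (m : List α) (v : List β),
          m.foldl (fun v a => (h i a).reverse ++ v) v = (m.flatMap (h i)).reverse ++ v := by
        intro m
        induction m with
        | nil => intro v; rfl
        | cons a m ih => intro v; simp [ih]
      rw [key, List.append_nil]
  refine (h1.reverse ?_).congr fun i _ => by rw [List.reverse_reverse]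
  obtain ⟨q, hq⟩ := hlen
  obtain ⟨r, hr⟩ := hT
  refine ⟨r * q, fun i hi => ?_⟩
  have key : ∀ m : List α, (∀ a ∈ m, a ∈ l i) →
      (m.flatMap (h i)).length ≤ m.length * ((T i + 1) * q.eval (F.size i)) := by
    intro m
    induction m with
    | nil => intro _; simp
    | cons a m ih =>
      intro hm
      have h2 := ih fun b hb => hm b (List.mem_cons_of_mem _ hb)
      have h3 := hq (i, a) ⟨hi, hm a List.mem_cons_self⟩
      simp only [Frame.ext, Frame.setTime] at h3
      rw [List.flatMap_cons, List.length_append, List.length_cons, Nat.succ_mul]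
      omega
  simp only [List.length_reverse, eval_mul]
  rw [← mul_assoc]
  refine (key _ fun _ h => h).trans ?_
  rw [← mul_assoc]
  exact Nat.mul_le_mul_right _ ((Nat.mul_le_mul_right _ (Nat.le_succ _)).trans (hr i hi))

theorem Computes.mapTime {ea : α → Data} {eb : β → Data} {l : ι → List α} {h : ι → α → β}
    (T : ι → ℕ) (hl : Computes F Γ fun i => encList ea (l i))
    (hh : Computes ((F.setTime T).ext fun i a => a ∈ l i) (push Γ ea) fun x => eb (h x.1 x.2))
    (hT : F.Allows fun i => ((l i).length + 1) * (T i + 1)) :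
    Computes F Γ fun i => encList eb ((l i).map (h i)) :=
  (Computes.flatMapTime (h := fun i a => [h i a]) T hl (hh.cons .nil)
    (Frame.PolyBdd.const 1).toAllows hT).congr fun i _ => by rw [List.map_eq_flatMap]

theorem Computes.map {ea : α → Data} {eb : β → Data} {l : ι → List α} {h : ι → α → β}
    (hl : Computes F Γ fun i => encList ea (l i))
    (hh : Computes (F.ext fun i a => a ∈ l i) (push Γ ea) fun x => eb (h x.1 x.2))
    (hT : F.PolyBdd fun i => (l i).length) :
    Computes F Γ fun i => encList eb ((l i).map (h i)) :=
  hl.mapTime F.time hh hT.allows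

theorem Computes.allTime {ea : α → Data} {l : ι → List α} {h : ι → α → Bool}
    (T : ι → ℕ) (hl : Computes F Γ fun i => encList ea (l i))
    (hh : Computes ((F.setTime T).ext fun i a => a ∈ l i) (push Γ ea)
      fun x => encBool (h x.1 x.2))
    (hT : F.Allows fun i => ((l i).length + 1) * (T i + 1)) :
    Computes F Γ fun i => encBool ((l i).all (h i)) := by
  refine (Computes.foldlTime (eb := encBool) (st := fun i v a => v && h i a)
      (b := fun _ => true) T (fun i l' _ => l' <:+ l i) hl (.const (encBool true)) ?_
      (fun _ _ => List.suffix_rfl) (fun i a l' _ _ h => (List.suffix_cons _ _).trans h)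
      hT).congr fun i _ => ?_
  · refine Computes.bool₂ (fun x y => x && y) Computes.top ?_
    refine hh.lift.reindex (F := ((F.setTime T).ext _).ext _) (fun x => x) ?_
      (fun _ _ => rfl) (fun _ _ => le_rfl) (κ := (ι × α) × Bool)
      (F' := ((F.setTime T).ext fun i a => a ∈ l i).ext fun _ _ => True)
    rintro x ⟨⟨hi, -⟩, l', hl'⟩
    exact ⟨⟨hi, hl'.subset List.mem_cons_self⟩, trivial⟩
  · have key : ∀ (m : List α) (v : Bool),
        m.foldl (fun v a => v && h i a) v = (v && m.all (h i)) := by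
      intro m
      induction m with
      | nil => simp
      | cons a m ih => intro v; simp [ih, Bool.and_assoc]
    rw [key, Bool.true_and]

theorem Computes.anyTime {ea : α → Data} {l : ι → List α} {h : ι → α → Bool}
    (T : ι → ℕ) (hl : Computes F Γ fun i => encList ea (l i))
    (hh : Computes ((F.setTime T).ext fun i a => a ∈ l i) (push Γ ea)
      fun x => encBool (h x.1 x.2))
    (hT : F.Allows fun i => ((l i).length + 1) * (T i + 1)) :
    Computes F Γ fun i => encBool ((l i).any (h i)) :=
  (hl.allTime (h := fun i a => !h i a) T hh.not hT).not.congr fun i _ => by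
    simp [List.all_eq_not_any_not]

theorem Computes.all {ea : α → Data} {l : ι → List α} {h : ι → α → Bool}
    (hl : Computes F Γ fun i => encList ea (l i))
    (hh : Computes (F.ext fun i a => a ∈ l i) (push Γ ea) fun x => encBool (h x.1 x.2))
    (hT : F.PolyBdd fun i => (l i).length) :
    Computes F Γ fun i => encBool ((l i).all (h i)) :=
  hl.allTime F.time hh hT.allows

theorem Computes.any {ea : α → Data} {l : ι → List α} {h : ι → α → Bool}
    (hl : Computes F Γ fun i => encList ea (l i))
    (hh : Computes (F.ext fun i a => a ∈ l i) (push Γ ea) fun x => encBool (h x.1 x.2))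
    (hT : F.PolyBdd fun i => (l i).length) :
    Computes F Γ fun i => encBool ((l i).any (h i)) :=
  hl.anyTime F.time hh hT.allows

theorem Computes.range {k : ι → ℕ} (hk : Computes F Γ fun i => encUnary (k i))
    (hlen : F.PolyBdd k) : Computes F Γ fun i => encList encUnary (List.range (k i)) := by
  have h : Computes F Γ fun i => encPair encUnary (encList encUnary)
      ((fun v : ℕ × List ℕ => (v.1 + 1, v.1 :: v.2))^[k i] (0, [])) :=
    Computes.iteratePoly (e := encPair encUnary (encList encUnary)) (b := fun _ => (0, []))
      (st := fun _ v => (v.1 + 1, v.1 :: v.2)) hk (.const (.cons .nil .nil))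
      (Computes.pairMk Computes.top.pairFst.succ
        (Computes.lcons (e := encUnary) Computes.top.pairFst Computes.top.pairSnd)) hlen
  have key : ∀ n, (fun v : ℕ × List ℕ => (v.1 + 1, v.1 :: v.2))^[n] (0, [])
      = (n, (List.range n).reverse) := by
    intro n
    induction n with
    | zero => rfl
    | succ n ih => rw [Function.iterate_succ_apply', ih, List.range_succ]; simp
  refine ((h.congr fun i _ => by rw [key]; rfl : Computes F Γ fun i =>
    Data.cons (encUnary (k i)) (encList encUnary (List.range (k i)).reverse)).snd.reverse
      (by simpa using hlen.toAllows)).congr fun i _ => by rw [List.reverse_reverse]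

/-- Tables of the values of a function on an initial segment of the natural numbers. -/
theorem Computes.tab {e : β → Data} {k : ι → ℕ} {h : ι → ℕ → β}
    (hk : Computes F Γ fun i => encUnary (k i)) (hlen : F.PolyBdd k)
    (hh : Computes (F.ext fun i x => x < k i) (push Γ encUnary) fun x => e (h x.1 x.2)) :
    Computes F Γ fun i => encList e ((List.range (k i)).map (h i)) :=
  (hk.range hlen).map (hh.reindex (fun x => x) (fun _ hx => ⟨hx.1, List.mem_range.1 hx.2⟩)
    (fun _ _ => rfl) fun _ _ => le_rfl) (by simpa using hlen)

end

/-! ### Binary arithmetic -/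

/-- The number with the given binary digits, least significant digit first. Leading zeros are
allowed, so that a number has several representations. -/
def bitsVal : List Bool → ℕ
  | [] => 0
  | b :: l => b.toNat + 2 * bitsVal l

theorem bitsVal_eq (l : List Bool) : bitsVal l = (l.headD false).toNat + 2 * bitsVal l.tail := by
  cases l <;> rfl

theorem bitsVal_append (l m : List Bool) :
    bitsVal (l ++ m) = bitsVal l + 2 ^ l.length * bitsVal m := by
  induction l with
  | nil => simp [bitsVal]
  | cons b l ih => simp only [List.cons_append, bitsVal, ih, List.length_cons, pow_succ]; ring

theorem bitsVal_bits (n : ℕ) : bitsVal n.bits = n := by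
  induction n using Nat.binaryRec' with
  | zero => rfl
  | bit b n h ih =>
    rw [Nat.bits_append_bit n b h, bitsVal, ih, Nat.bit_val, add_comm]

/-- One digit of the addition with carry: the state consists of the carry, the remaining digits of
both summands, and the digits of the sum in reverse order. -/
def addStep (v : Bool × List Bool × List Bool × List Bool) :
    Bool × List Bool × List Bool × List Bool :=
  ((v.1 && v.2.1.headD false) || (v.1 && v.2.2.1.headD false) ||
      (v.2.1.headD false && v.2.2.1.headD false),
    v.2.1.tail, v.2.2.1.tail,
    (v.1 ^^ (v.2.1.headD false ^^ v.2.2.1.headD false)) :: v.2.2.2)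

/-- Addition of binary numbers. -/
def addBits (l m : List Bool) : List Bool :=
  let v := (l ++ m).foldl (fun v _ => addStep v) (false, l, m, [])
  v.2.2.2.reverse ++ [v.1]

theorem addStep_foldl (k : List Bool) (c : Bool) (l m o : List Bool)
    (h : l.length ≤ k.length) (h' : m.length ≤ k.length) :
    let v := k.foldl (fun v _ => addStep v) (c, l, m, o)
    bitsVal (v.2.2.2.reverse ++ [v.1]) =
      bitsVal o.reverse + 2 ^ o.length * (c.toNat + bitsVal l + bitsVal m) ∧
    v.2.2.2.length = k.length + o.length := by
  induction k generalizing c l m o with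
  | nil =>
    obtain rfl := List.length_eq_zero_iff.1 (Nat.le_zero.1 h)
    obtain rfl := List.length_eq_zero_iff.1 (Nat.le_zero.1 h')
    simp [bitsVal_append, bitsVal]
  | cons a k ih =>
    rw [List.foldl_cons]
    simp only [List.length_cons] at h h'
    obtain ⟨h1, h2⟩ := ih ((c && l.headD false) || (c && m.headD false) ||
      (l.headD false && m.headD false)) l.tail m.tail ((c ^^ (l.headD false ^^ m.headD false)) :: o)
      (by rw [List.length_tail]; omega) (by rw [List.length_tail]; omega)
    refine ⟨h1.trans ?_, h2.trans (by simp only [List.length_cons]; omega)⟩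
    rw [bitsVal_eq l, bitsVal_eq m, List.reverse_cons, bitsVal_append]
    cases c <;> cases l.headD false <;> cases m.headD false <;>
      simp [bitsVal, pow_succ] <;> ring

theorem bitsVal_addBits (l m : List Bool) : bitsVal (addBits l m) = bitsVal l + bitsVal m := by
  have := (addStep_foldl (l ++ m) false l m [] (by simp) (by simp)).1
  rw [addBits, this]
  simp [bitsVal]

theorem length_addBits (l m : List Bool) :
    (addBits l m).length = l.length + m.length + 1 := by
  have := (addStep_foldl (l ++ m) false l m [] (by simp) (by simp)).2
  simpa [addBits] using this

/-- One digit of the comparison: the last digit in which the numbers differ decides. -/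
def leStep (v : Bool × List Bool × List Bool) : Bool × List Bool × List Bool :=
  (if v.2.1.headD false == v.2.2.headD false then v.1 else v.2.2.headD false,
    v.2.1.tail, v.2.2.tail)

/-- Comparison of binary numbers. -/
def leBits (l m : List Bool) : Bool :=
  ((l ++ m).foldl (fun v _ => leStep v) (true, l, m)).1

theorem leStep_foldl (k : List Bool) (c : Bool) (l m : List Bool)
    (h : l.length ≤ k.length) (h' : m.length ≤ k.length) :
    (k.foldl (fun v _ => leStep v) (c, l, m)).1 = true ↔
      bitsVal l < bitsVal m ∨ bitsVal l = bitsVal m ∧ c = true := by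
  induction k generalizing c l m with
  | nil =>
    obtain rfl := List.length_eq_zero_iff.1 (Nat.le_zero.1 h)
    obtain rfl := List.length_eq_zero_iff.1 (Nat.le_zero.1 h')
    simp [bitsVal]
  | cons a k ih =>
    rw [List.foldl_cons]
    simp only [List.length_cons] at h h'
    refine (ih _ l.tail m.tail (by rw [List.length_tail]; omega)
      (by rw [List.length_tail]; omega)).trans ?_
    rw [bitsVal_eq l, bitsVal_eq m]
    cases l.headD false <;> cases m.headD false <;> simp <;> omega

theorem leBits_iff (l m : List Bool) : leBits l m = true ↔ bitsVal l ≤ bitsVal m := by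
  rw [leBits, leStep_foldl _ _ _ _ (by simp) (by simp)]
  simp [Nat.le_iff_lt_or_eq]

/-- The sum of a list of binary numbers. -/
def sumBits (L : List (List Bool)) : List Bool := L.foldl addBits []

theorem bitsVal_sumBits (L : List (List Bool)) : bitsVal (sumBits L) = (L.map bitsVal).sum := by
  have key : ∀ (L : List (List Bool)) (v : List Bool),
      bitsVal (L.foldl addBits v) = bitsVal v + (L.map bitsVal).sum := by
    intro L
    induction L with
    | nil => simp
    | cons l L ih => intro v; simp [ih, bitsVal_addBits, add_assoc]
  rw [sumBits, key L []]
  simp [bitsVal]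

theorem length_foldl_addBits (L : List (List Bool)) (v : List Bool) :
    (L.foldl addBits v).length = v.length + (L.map fun l => l.length + 1).sum := by
  induction L generalizing v with
  | nil => simp
  | cons l L ih => simp [ih, length_addBits, add_assoc]

section
variable {ι : Type} {F : Frame ι} {Γ : ι → Data}

theorem Computes.addBits {l m : ι → List Bool}
    (hl : Computes F Γ fun i => encList encBool (l i))
    (hm : Computes F Γ fun i => encList encBool (m i))
    (hll : F.PolyBdd fun i => (l i).length) (hlm : F.PolyBdd fun i => (m i).length) :
    Computes F Γ fun i => encList encBool (addBits (l i) (m i)) := by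
  have hlen : F.PolyBdd fun i => (l i ++ m i).length := by simpa using hll.add hlm
  let eb : Bool × List Bool × List Bool × List Bool → Data :=
    encPair encBool (encPair (encList encBool) (encPair (encList encBool) (encList encBool)))
  have h : Computes F Γ fun i => eb
      ((l i ++ m i).foldl (fun v _ => addStep v) (false, l i, m i, [])) := by
    refine Computes.foldl (eb := eb) (b := fun i => (false, l i, m i, []))
      (st := fun _ v _ => addStep v) (fun _ _ => True)
      (hl.append hm hll.toAllows) ((Computes.const .nil).cons (hl.cons (hm.cons .nil))) ?_
      (fun _ _ => trivial) (fun _ _ _ _ _ _ => trivial) hlen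
    have t := Computes.top (F := F.ext fun i a => a ∈ l i ++ m i) (Γ := push Γ encBool) (e := eb)
      (Q := fun _ _ => True)
    have tx := t.pairSnd.pairFst.headD (e := encBool) (d := false) rfl
    have ty := t.pairSnd.pairSnd.pairFst.headD (e := encBool) (d := false) rfl
    exact (Computes.bool₃ (fun c x y => (c && x) || (c && y) || (x && y)) t.pairFst tx ty).pairMk
      (t.pairSnd.pairFst.ltail.pairMk (t.pairSnd.pairSnd.pairFst.ltail.pairMk
        (Computes.lcons (e := encBool)
          (Computes.bool₃ (fun c x y => c ^^ (x ^^ y)) t.pairFst tx ty) t.pairSnd.pairSnd.pairSnd)))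
  have h' := h.pairSnd.pairSnd.pairSnd
  have hle : F.PolyBdd fun i =>
      ((l i ++ m i).foldl (fun v _ => addStep v) (false, l i, m i, [])).2.2.2.length :=
    hlen.of_le fun i _ => by
      rw [(addStep_foldl (l i ++ m i) false (l i) (m i) [] (by simp) (by simp)).2]; simp
  exact (h'.reverse hle.toAllows).append (Computes.lcons (e := encBool) h.pairFst .nil)
    (by simpa using hle.toAllows)

theorem Computes.leBits {l m : ι → List Bool}
    (hl : Computes F Γ fun i => encList encBool (l i))
    (hm : Computes F Γ fun i => encList encBool (m i))
    (hll : F.PolyBdd fun i => (l i).length) (hlm : F.PolyBdd fun i => (m i).length) :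
    Computes F Γ fun i => encBool (leBits (l i) (m i)) := by
  have hlen : F.PolyBdd fun i => (l i ++ m i).length := by simpa using hll.add hlm
  let eb : Bool × List Bool × List Bool → Data :=
    encPair encBool (encPair (encList encBool) (encList encBool))
  have h : Computes F Γ fun i => eb
      ((l i ++ m i).foldl (fun v _ => leStep v) (true, l i, m i)) := by
    refine Computes.foldl (eb := eb) (b := fun i => (true, l i, m i))
      (st := fun _ v _ => leStep v) (fun _ _ => True)
      (hl.append hm hll.toAllows) ((Computes.const (encBool true)).cons (hl.cons hm)) ?_
      (fun _ _ => trivial) (fun _ _ _ _ _ _ => trivial) hlen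
    have t := Computes.top (F := F.ext fun i a => a ∈ l i ++ m i) (Γ := push Γ encBool) (e := eb)
      (Q := fun _ _ => True)
    have tx := t.pairSnd.pairFst.headD (e := encBool) (d := false) rfl
    have ty := t.pairSnd.pairSnd.headD (e := encBool) (d := false) rfl
    exact (Computes.bool₃ (fun c x y => if x == y then c else y) t.pairFst tx ty).pairMk
      (t.pairSnd.pairFst.ltail.pairMk t.pairSnd.pairSnd.ltail)
  exact h.pairFst

theorem Computes.sumBits {L : ι → List (List Bool)}
    (hL : Computes F Γ fun i => encList (encList encBool) (L i))
    (hlen : F.PolyBdd fun i => ((L i).map fun l => l.length + 1).sum) :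
    Computes F Γ fun i => encList encBool (sumBits (L i)) := by
  have h1 : ∀ M : List (List Bool), M.length ≤ (M.map fun l => l.length + 1).sum := by
    intro M
    induction M with
    | nil => simp
    | cons l M ih => simp only [List.length_cons, List.map_cons, List.sum_cons]; omega
  refine Computes.foldlTime (eb := encList encBool) (b := fun _ => [])
    (st := fun _ v a => BoundedWSP.addBits v a) F.time
    (fun i M v => v.length + (M.map fun l => l.length + 1).sum ≤
      ((L i).map fun l => l.length + 1).sum) hL (.const .nil) ?_ (by simp) ?_
    (hlen.of_le fun i _ => h1 _).allows
  · refine Computes.addBits Computes.top Computes.top.lift ?_ ?_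
    · refine (hlen.setTime.lift.lift).of_le ?_
      rintro x ⟨-, M, hM⟩
      simp only [List.map_cons, List.sum_cons] at hM ⊢
      omega
    · refine (hlen.setTime.lift.lift).of_le ?_
      rintro x ⟨-, M, hM⟩
      simp only [List.map_cons, List.sum_cons] at hM ⊢
      omega
  · intro i a M v _ h
    simp only [List.map_cons, List.sum_cons, length_addBits] at h ⊢
    omega

end

/-- The height of a tree; it bounds the length of an encoded list. -/
def Data.height : Data → ℕ
  | .nil => 0
  | .cons a b => max a.height b.height + 1

/-- A program can raise the height of a tree by at most one in every step. -/
theorem Code.Runs.height_le {M : Code} {v w : Data} {t : ℕ} (h : M.Runs v w t) :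
    w.height ≤ v.height + t := by
  induction h with
  | id => omega
  | nil => simp only [Data.height]; omega
  | head_nil => omega
  | head_cons => simp only [Data.height]; omega
  | tail_nil => omega
  | tail_cons => simp only [Data.height]; omega
  | pair => simp only [Data.height]; omega
  | _ => omega

theorem length_le_height {α : Type} (e : α → Data) (l : List α) :
    l.length ≤ (encList e l).height := by
  induction l with
  | nil => simp
  | cons a l ih => simp only [List.length_cons, encList, Data.height]; omega

theorem height_encList_le {α : Type} {e : α → Data} {l : List α} {k : ℕ}
    (h : ∀ a ∈ l, (e a).height ≤ k) : (encList e l).height ≤ l.length + k := by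
  induction l with
  | nil => simp [encList, Data.height]
  | cons a l ih =>
    have h1 := h a List.mem_cons_self
    have h2 := ih fun b hb => h b (List.mem_cons_of_mem _ hb)
    simp only [encList, Data.height, List.length_cons]
    omega

theorem height_encUnary (k : ℕ) : (encUnary k).height = k := by
  induction k with
  | zero => rfl
  | succ k ih => simp [encUnary, Data.height, ih]

theorem height_encBool_le (b : Bool) : (encBool b).height ≤ 1 := by
  cases b <;> simp [encBool, Data.height]

theorem Data.height_lt_size (d : Data) : d.height < d.size := by
  induction d with
  | nil => simp [Data.height, Data.size]
  | cons a b ha hb => simp only [Data.height, Data.size]; omega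

theorem length_lt_size {α : Type} (e : α → Data) (l : List α) : l.length < (encList e l).size :=
  (length_le_height e l).trans_lt (Data.height_lt_size _)

theorem lt_size_encUnary (k : ℕ) : k < (encUnary k).size := by
  have := Data.height_lt_size (encUnary k)
  rwa [height_encUnary] at this

theorem size_lt_of_mem {α : Type} {e : α → Data} {l : List α} {a : α} (h : a ∈ l) :
    (e a).size < (encList e l).size := by
  induction l with
  | nil => simp at h
  | cons b l ih =>
    rcases List.mem_cons.1 h with rfl | h
    · simp only [encList, Data.size]; omega
    · have := ih h
      simp only [encList, Data.size]; omega

/-! ### Workflows as untyped trees -/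

/-- An activity without its bounds: release points are tagged by `true`, steps by `false`. -/
abbrev RawActivity : Type := Bool × ℕ

/-- The encoding of an activity, the same as that of an activity with bounds. -/
def encActivity : RawActivity → Data := encPair encBool encUnary

/-- A workflow without bounds on the indices. The kinds of inner nodes are `0` for serial
composition, `1` for parallel branching, and `2` for xor branching. -/
inductive RawWorkflow : Type
  | leaf : RawActivity → RawWorkflow
  | node : ℕ → RawWorkflow → RawWorkflow → RawWorkflow

/-- The encoding of a workflow, the same as that of a workflow with bounds (`encRaw_raw`). -/
def encRaw : RawWorkflow → Data
  | .leaf a => encActivity a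
  | .node k G H => .cons (encUnary (k + 2)) (.cons (encRaw G) (encRaw H))

/-- The activity without its bound. -/
def rawActivity {s r : ℕ} : Activity s r → RawActivity
  | .inl x => (false, x)
  | .inr x => (true, x)

/-- The workflow without the bounds on its indices. -/
def Workflow.raw {s r : ℕ} : Workflow s r → RawWorkflow
  | .atom v => .leaf (rawActivity v)
  | .seq G H => .node 0 G.raw H.raw
  | .par G H => .node 1 G.raw H.raw
  | .xor G H => .node 2 G.raw H.raw

theorem encRaw_raw {s r : ℕ} (G : Workflow s r) : encRaw G.raw = encWorkflow G := by
  induction G with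
  | atom v => cases v <;> rfl
  | seq G H ihG ihH => simp only [Workflow.raw, encRaw, encWorkflow, ihG, ihH]
  | par G H ihG ihH => simp only [Workflow.raw, encRaw, encWorkflow, ihG, ihH]
  | xor G H ihG ihH => simp only [Workflow.raw, encRaw, encWorkflow, ihG, ihH]

/-- Entries of the postfix notation of a workflow: activities, and kinds of inner nodes. -/
abbrev Token : Type := RawActivity ⊕ ℕ

/-- The encoding of a token: the left subtree tells activities and inner nodes apart. -/
def encToken : Token → Data
  | .inl a => .cons .nil (encActivity a)
  | .inr k => .cons (.cons .nil .nil) (encUnary k)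

/-- The postfix notation of a workflow. -/
def RawWorkflow.postfixTokens : RawWorkflow → List Token
  | .leaf a => [.inl a]
  | .node k G H => G.postfixTokens ++ (H.postfixTokens ++ [.inr k])

/-- One step of the translation into postfix notation. The first component of the state is a stack
of trees that have still to be translated, the second one the part of the output behind them. -/
def flattenStep : List RawWorkflow × List Token → List RawWorkflow × List Token
  | ([], o) => ([], o)
  | (.leaf a :: t, o) => (t, .inl a :: o)
  | (.node k G H :: t, o) => (H :: G :: t, .inr k :: o)

/-- The state in which the translation ends. -/
def flattenFin (v : List RawWorkflow × List Token) : List RawWorkflow × List Token :=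
  ([], v.1.foldl (fun o G => G.postfixTokens ++ o) v.2)

section
variable {ι α : Type} {F : Frame ι} {Γ : ι → Data}

theorem Computes.postfixTokens {G : ι → RawWorkflow}
    (hG : Computes F Γ fun i => encRaw (G i))
    (hlen : F.PolyBdd fun i => (G i).postfixTokens.length) :
    Computes F Γ fun i => encList encToken (G i).postfixTokens := by
  let e : List RawWorkflow × List Token → Data := encPair (encList encRaw) (encList encToken)
  have h : Computes F Γ fun i => e (flattenFin ([G i], [])) := by
    have t : ∀ Q : ι → List RawWorkflow × List Token → Prop,
      Computes (F.ext Q) (push Γ e) fun x => e x.2 := fun Q => Computes.top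
    refine Computes.while (e := e) (b := fun i => ([G i], [])) (fun _ _ => True)
      (c := fun _ v => encList encRaw v.1) (fun _ v => flattenStep v) (fun _ v => flattenFin v)
      (fun _ v => (v.1.map fun G => G.postfixTokens.length).sum)
      ((hG.cons .nil).cons .nil) (t _).pairFst ?_ (fun _ _ => trivial) ?_ ?_
      (by simpa using hlen)
    · -- leaves and inner nodes are told apart by their tag, which is at most one for leaves
      have ht := (t fun _ _ => True).and (Q := fun x => encList encRaw x.2.1 ≠ .nil)
      refine Computes.cases ht.hd.hd.hd.tl ?_ ?_
      · refine Computes.congr (((ht.hd.hd.tl.tl.cons (ht.hd.hd.tl.hd.cons ht.hd.tl)).cons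
          (((Computes.const (.cons .nil .nil)).cons ht.hd.hd.hd.tl.tl).cons ht.tl)).and) ?_
        rintro ⟨i, _ | ⟨_ | ⟨k, G, H⟩, w⟩, o⟩ ⟨⟨-, h⟩, h'⟩
        · exact absurd rfl h
        · rename_i a; rcases a with ⟨_ | _, k⟩ <;> exact absurd rfl h'
        · rfl
      · refine Computes.congr (ht.hd.tl.cons ((Computes.nil.cons ht.hd.hd).cons ht.tl)).and ?_
        rintro ⟨i, _ | ⟨_ | ⟨k, G, H⟩, w⟩, o⟩ ⟨⟨-, h⟩, h'⟩
        · exact absurd rfl h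
        · rfl
        · cases h'
    · rintro i ⟨_ | ⟨_ | ⟨k, G, H⟩, w⟩, o⟩ - - h
      · exact absurd rfl h
      · exact ⟨trivial, by simp [flattenStep, RawWorkflow.postfixTokens], rfl⟩
      · refine ⟨trivial, ?_, ?_⟩
        · simp [flattenStep, RawWorkflow.postfixTokens]; omega
        · simp [flattenFin, flattenStep, RawWorkflow.postfixTokens]
    · rintro i ⟨_ | ⟨G, w⟩, o⟩ - - h
      · rfl
      · cases h
  exact h.pairSnd.congr fun i _ => by simp [flattenFin]

/-- Computations without an extra time factor can be used under any time factor. -/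
theorem Computes.slow {g : ι → Data} (h : Computes (F.setTime fun _ => 0) Γ g) {T : ι → ℕ} :
    Computes (F.setTime T) Γ g :=
  h.reindex (fun i => i) (fun _ h => h) (fun _ _ => rfl) fun _ _ => Nat.zero_le _

/-- The variant of `Computes.lift` for computations without an extra time factor. -/
theorem Computes.lift₀ {β : Type} {g : ι → Data} (h : Computes (F.setTime fun _ => 0) Γ g)
    {Q : ι → β → Prop} {e : β → Data} :
    Computes ((F.ext Q).setTime fun _ => 0) (push Γ e) fun x => g x.1 := h.lift

/-- The variant of `Computes.top` for computations without an extra time factor. -/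
theorem Computes.top₀ {β : Type} {Q : ι → β → Prop} {e : β → Data} :
    Computes ((F.ext Q).setTime fun _ => 0) (push Γ e) fun x => e x.2 :=
  Computes.top (F := F.setTime fun _ => 0)

/-- The last variable of an environment is available in every frame. -/
theorem Computes.var {β : Type} {F : Frame (ι × β)} {e : β → Data} :
    Computes F (push Γ e) fun x => e x.2 :=
  (Computes.id (Γ := push Γ e)).tl

/-- The last but one variable of an environment is available in every frame. -/
theorem Computes.var₂ {β γ : Type} {F : Frame ((ι × β) × γ)} {e : β → Data} {e' : γ → Data} :
    Computes F (push (push Γ e) e') fun x => e x.1.2 :=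
  (Computes.id (Γ := push (push Γ e) e')).hd.tl

theorem Computes.liftTo {β : Type} {F' : Frame (ι × β)} {e : β → Data} {g : ι → Data}
    (h : Computes F Γ g) (hv : ∀ x, F'.Valid x → F.Valid x.1)
    (hs : ∀ x, F'.Valid x → F.size x.1 = F'.size x)
    (ht : ∀ x, F'.Valid x → F.time x.1 ≤ F'.time x) :
    Computes F' (push Γ e) fun x => g x.1 :=
  Computes.comp (f := fun x => Γ x.1) (Computes.id (Γ := push Γ e)).hd
    (h.reindex (F := F') Prod.fst hv hs ht)

theorem Frame.PolyBdd.reindex {κ : Type} {F' : Frame κ} {a : ι → ℕ} (h : F.PolyBdd a) (φ : κ → ι)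
    (hv : ∀ x, F'.Valid x → F.Valid (φ x)) (hs : ∀ x, F'.Valid x → F.size (φ x) = F'.size x) :
    F'.PolyBdd fun x => a (φ x) := by
  obtain ⟨q, hq⟩ := h
  exact ⟨q, fun x hx => hs x hx ▸ hq _ (hv x hx)⟩

theorem Computes.headOfNe {e : α → Data} (d : α) {l : ι → List α}
    (hl : Computes F Γ fun i => encList e (l i)) (hne : ∀ i, F.Valid i → l i ≠ []) :
    Computes F Γ fun i => e ((l i).headD d) :=
  hl.hd.congr fun i hi => by
    cases h : l i
    · exact absurd h (hne i hi)
    · rfl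

end

/-! ### Canonical execution sequences -/

/-- The key of an activity, from a table for the steps and a table for the release points. -/
def keyOf (t : List ℕ × List ℕ) (a : RawActivity) : ℕ :=
  if a.1 then t.2.getD a.2 0 else t.1.getD a.2 0

/-- Comparison of activities by their keys. -/
def keyLe (t : List ℕ × List ℕ) (a b : RawActivity) : Bool := decide (keyOf t a ≤ keyOf t b)

/-- The combination of the lists of canonical sequences of the operands of a node of kind `k`. -/
def combine (t : List ℕ × List ℕ) (k : ℕ) (X Y : List (List RawActivity)) :
    List (List RawActivity) :=
  if k = 0 then
    X.flatMap fun σ => Y.flatMap fun τ =>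
      if (σ.all fun a => τ.all fun b => keyLe t a b) then [σ ++ τ] else []
  else if k = 1 then
    X.flatMap fun σ => Y.map fun τ => σ.merge τ (keyLe t)
  else X ++ Y

/-- The canonical execution sequences: those which are sorted by the keys, and in which activities
of different operands of a parallel branching that have the same key stand in the order of the
operands. -/
def RawWorkflow.canonical (t : List ℕ × List ℕ) : RawWorkflow → List (List RawActivity)
  | .leaf a => [[a]]
  | .node k G H => combine t k (G.canonical t) (H.canonical t)

/-- Evaluation of postfix notation with a stack. -/
def evalStep (t : List ℕ × List ℕ) (S : List (List (List RawActivity))) :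
    Token → List (List (List RawActivity))
  | .inl a => [[a]] :: S
  | .inr k => combine t k (S.tail.headD []) (S.headD []) :: S.tail.tail

theorem foldl_evalStep (t : List ℕ × List ℕ) (G : RawWorkflow)
    (S : List (List (List RawActivity))) :
    G.postfixTokens.foldl (evalStep t) S = G.canonical t :: S := by
  induction G generalizing S with
  | leaf a => rfl
  | node k G H ihG ihH =>
    simp [RawWorkflow.postfixTokens, ihG, ihH, RawWorkflow.canonical, evalStep]

/-- One step of merging: the state consists of the rests of both lists and the reversed output. -/
def mergeStep (t : List ℕ × List ℕ) (v : List RawActivity × List RawActivity × List RawActivity) :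
    List RawActivity × List RawActivity × List RawActivity :=
  if (if v.2.1.isEmpty then true else if v.1.isEmpty then false
      else keyLe t (v.1.headD (false, 0)) (v.2.1.headD (false, 0)))
  then (v.1.tail, v.2.1, v.1.headD (false, 0) :: v.2.2)
  else (v.1, v.2.1.tail, v.2.1.headD (false, 0) :: v.2.2)

section
variable {ι : Type} {F : Frame ι} {Γ : ι → Data}

/-- The encoding of a table for the steps and a table for the release points. -/
def encTables : List ℕ × List ℕ → Data := encPair (encList encUnary) (encList encUnary)

theorem keyOf_le {t : List ℕ × List ℕ} {N : ℕ} (h : ∀ k ∈ t.1 ++ t.2, k ≤ N) (a : RawActivity) :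
    keyOf t a ≤ N := by
  have key : ∀ (l : List ℕ) (j : ℕ), (∀ k ∈ l, k ≤ N) → l.getD j 0 ≤ N := by
    intro l j hl
    rw [List.getD_eq_getElem?_getD]
    cases hj : l[j]?
    · simp
    · exact hl _ (List.mem_of_getElem? hj)
  unfold keyOf
  split
  · exact key _ _ fun k hk => h k (by simp [hk])
  · exact key _ _ fun k hk => h k (by simp [hk])

theorem Computes.keyLe {t : ι → List ℕ × List ℕ} {a b : ι → RawActivity} {N : ι → ℕ}
    (hN : F.PolyBdd N) (ht : Computes F Γ fun i => encTables (t i))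
    (htN : ∀ i, F.Valid i → ∀ k ∈ (t i).1 ++ (t i).2, k ≤ N i)
    (ha : Computes F Γ fun i => encActivity (a i)) (hb : Computes F Γ fun i => encActivity (b i))
    (haN : ∀ i, F.Valid i → (a i).2 ≤ N i) (hbN : ∀ i, F.Valid i → (b i).2 ≤ N i) :
    Computes F Γ fun i => encBool (keyLe (t i) (a i) (b i)) := by
  have key : ∀ c : ι → RawActivity, Computes F Γ (fun i => encActivity (c i)) →
      (∀ i, F.Valid i → (c i).2 ≤ N i) → Computes F Γ fun i => encUnary (keyOf (t i) (c i)) :=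
    fun c hc hcN => Computes.ite (e := encUnary) hc.pairFst
      (ht.pairSnd.getD (e := encUnary) rfl hc.pairSnd (hN.of_le hcN)).and
      (ht.pairFst.getD (e := encUnary) rfl hc.pairSnd (hN.of_le hcN)).and
  exact (key a ha haN).le (key b hb hbN) (hN.of_le fun i hi => keyOf_le (htN i hi) _)

theorem Computes.merge {t : ι → List ℕ × List ℕ} {σ τ : ι → List RawActivity} {N : ι → ℕ}
    (hN : F.PolyBdd N) (ht : Computes F Γ fun i => encTables (t i))
    (htN : ∀ i, F.Valid i → ∀ k ∈ (t i).1 ++ (t i).2, k ≤ N i)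
    (hσ : Computes F Γ fun i => encList encActivity (σ i))
    (hτ : Computes F Γ fun i => encList encActivity (τ i))
    (hσN : ∀ i, F.Valid i → ∀ a ∈ σ i, a.2 ≤ N i) (hτN : ∀ i, F.Valid i → ∀ a ∈ τ i, a.2 ≤ N i)
    (hlσ : F.PolyBdd fun i => (σ i).length) (hlτ : F.PolyBdd fun i => (τ i).length) :
    Computes F Γ fun i => encList encActivity ((σ i).merge (τ i) (BoundedWSP.keyLe (t i))) := by
  let eL : List RawActivity → Data := encList encActivity
  let e : List RawActivity × List RawActivity × List RawActivity → Data :=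
    encPair eL (encPair eL eL)
  let fin : ι → List RawActivity × List RawActivity × List RawActivity →
      List RawActivity × List RawActivity × List RawActivity :=
    fun i v => ([], [], (v.1.merge v.2.1 (BoundedWSP.keyLe (t i))).reverse ++ v.2.2)
  let Inv : ι → List RawActivity × List RawActivity × List RawActivity → Prop :=
    fun i v => (∀ a ∈ v.1, a.2 ≤ N i) ∧ ∀ a ∈ v.2.1, a.2 ≤ N i
  have h : Computes F Γ fun i => e (fin i (σ i, τ i, [])) := by
    have v := Computes.top (F := F) (Γ := Γ) (e := e) (Q := Inv)
    refine Computes.while (e := e) (b := fun i => (σ i, τ i, [])) Inv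
      (c := fun _ v => encBool (!(v.1.isEmpty && v.2.1.isEmpty))) (fun i v => mergeStep (t i) v) fin
      (fun _ v => v.1.length + v.2.1.length) (hσ.cons (hτ.cons .nil))
      (Computes.bool₂ (fun x y => !(x && y)) v.pairFst.isEmpty v.pairSnd.pairFst.isEmpty) ?_
      (fun i hi => ⟨hσN i hi, hτN i hi⟩) ?_ ?_ (hlσ.add hlτ)
    · have v' := v.and (Q := fun x => encBool (!(x.2.1.isEmpty && x.2.2.1.isEmpty)) ≠ .nil)
      have hne : ∀ x : ι × List RawActivity × List RawActivity × List RawActivity,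
          encBool (!(x.2.1.isEmpty && x.2.2.1.isEmpty)) ≠ .nil → x.2.1 ≠ [] ∨ x.2.2.1 ≠ [] := by
        rintro ⟨i, x, y, o⟩ h
        by_contra! h'
        simp only at h' h
        rw [h'.1, h'.2] at h
        exact h rfl
      refine Computes.ite (e := e) ?_ ?_ ?_
      · refine Computes.ite (e := encBool) v'.pairSnd.pairFst.isEmpty (.const (encBool true)) ?_
        refine Computes.ite (e := encBool) v'.pairFst.isEmpty.and (.const (encBool false)) ?_
        refine Computes.keyLe (N := fun x => N x.1) hN.lift.and.and.and ht.lift.and.and.and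
          (fun x hx => htN _ hx.1.1.1.1)
          (v'.pairFst.and.and.headOfNe _ fun x hx => by simpa using hx.2)
          (v'.pairSnd.pairFst.and.and.headOfNe _ fun x hx => by simpa using hx.1.2) ?_ ?_
        · rintro ⟨i, _ | ⟨a, x⟩, y, o⟩ ⟨⟨⟨⟨hi, hx⟩, -⟩, h1⟩, h2⟩
          · simp at h2
          · exact hx.1 a (by simp)
        · rintro ⟨i, x, _ | ⟨a, y⟩, o⟩ ⟨⟨⟨⟨hi, hx⟩, -⟩, h1⟩, h2⟩
          · simp at h1
          · exact hx.2 a (by simp)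
      · refine (v'.and.pairFst.ltail).pairMk (v'.and.pairSnd.pairFst.pairMk
          (Computes.lcons (e := encActivity) (v'.and.pairFst.headOfNe _ ?_) v'.and.pairSnd.pairSnd))
        rintro ⟨i, x, y, o⟩ ⟨⟨-, h1⟩, h2⟩ rfl
        rcases hne _ h1 with h | h
        · exact h rfl
        · simp_all
      · refine v'.and.pairFst.pairMk (v'.and.pairSnd.pairFst.ltail.pairMk
          (Computes.lcons (e := encActivity) (v'.and.pairSnd.pairFst.headOfNe _ ?_)
            v'.and.pairSnd.pairSnd))
        rintro ⟨i, x, y, o⟩ ⟨-, h2⟩ h3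
        simp only at h3
        simp [h3] at h2
    · rintro i ⟨_ | ⟨a, x⟩, _ | ⟨b, y⟩, o⟩ - ⟨hx, hy⟩ h
      · exact absurd rfl h
      · exact ⟨⟨hx, fun c hc => hy c (List.mem_cons_of_mem _ hc)⟩, by simp [mergeStep],
          by simp [mergeStep, fin]⟩
      · exact ⟨⟨fun c hc => hx c (List.mem_cons_of_mem _ hc), hy⟩, by simp [mergeStep],
          by simp [mergeStep, fin]⟩
      · cases hab : BoundedWSP.keyLe (t i) a b
        · refine ⟨?_, by simp [mergeStep, hab], by simp [mergeStep, fin, hab]⟩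
          simpa [mergeStep, hab] using
            ⟨hx, fun c hc => hy c (List.mem_cons_of_mem _ hc)⟩
        · refine ⟨?_, by simp [mergeStep, hab],
            by simp [mergeStep, fin, hab]⟩
          simpa [mergeStep, hab] using
            ⟨fun c hc => hx c (List.mem_cons_of_mem _ hc), hy⟩
    · rintro i ⟨_ | ⟨a, x⟩, _ | ⟨b, y⟩, o⟩ - - h
      · simp [fin]
      · cases h
      · cases h
      · cases h
  refine (h.pairSnd.pairSnd.reverse (e := encActivity) ?_).congr fun i _ => by simp [fin]
  refine ((hlσ.add hlτ).of_le fun i _ => ?_).toAllows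
  simp [fin, List.length_merge]

end

/-! ### Programs for combining canonical sequences -/

section
variable {ι : Type} {F : Frame ι} {Γ : ι → Data}

/-- The encoding of a sequence of activities. -/
def encSeq : List RawActivity → Data := encList encActivity

/-- All lengths and all indices in a list of sequences are at most `N`. -/
def SeqsBdd (N : ℕ) (X : List (List RawActivity)) : Prop :=
  ∀ σ ∈ X, σ.length ≤ N ∧ ∀ a ∈ σ, a.2 ≤ N

/-- The serial compositions of one sequence with all sequences of a list. -/
theorem Computes.seqWith {t : ι → List ℕ × List ℕ} {σ : ι → List RawActivity}
    {Y : ι → List (List RawActivity)} {N : ι → ℕ}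
    (hN : F.PolyBdd N) (ht : Computes (F.setTime fun _ => 0) Γ fun i => encTables (t i))
    (htN : ∀ i, F.Valid i → ∀ k ∈ (t i).1 ++ (t i).2, k ≤ N i)
    (hσ : Computes (F.setTime fun _ => 0) Γ fun i => encSeq (σ i))
    (hY : Computes (F.setTime fun _ => 0) Γ fun i => encList encSeq (Y i))
    (hσN : ∀ i, F.Valid i → SeqsBdd (N i) [σ i]) (hYN : ∀ i, F.Valid i → SeqsBdd (N i) (Y i)) :
    Computes (F.setTime fun i => (Y i).length) Γ fun i => encList encSeq ((Y i).flatMap fun τ =>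
      if (σ i).all fun a => τ.all fun b => BoundedWSP.keyLe (t i) a b then [σ i ++ τ] else []) := by
  refine Computes.flatMapTime (eb := encSeq) (fun _ => 0) hY.slow ?_ ?_ ?_
  · have hlσ : F.PolyBdd fun i => (σ i).length := hN.of_le fun i hi => (hσN i hi _ (by simp)).1
    refine Computes.ite (e := encList encSeq)
      (F := (F.setTime fun _ => 0).ext fun i a => a ∈ Y i) ?_ ?_ (.const .nil)
    · refine Computes.all (ea := encActivity) hσ.lift ?_ hlσ.setTime.lift
      refine Computes.all (ea := encActivity) Computes.top.lift ?_ ?_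
      · refine Computes.keyLe (N := fun x => N x.1.1.1) hN.setTime.lift.lift.lift ht.lift.lift.lift
          (fun x hx => htN _ hx.1.1.1) Computes.top.lift Computes.top ?_ ?_
        · exact fun x hx => (hσN _ hx.1.1.1 _ (by simp)).2 _ hx.1.2
        · exact fun x hx => (hYN _ hx.1.1.1 _ hx.1.1.2).2 _ hx.2
      · exact hN.setTime.lift.lift.of_le fun x hx => (hYN _ hx.1.1 _ hx.1.2).1
    · exact (Computes.append (e := encActivity) hσ.lift Computes.top
        hlσ.setTime.lift.toAllows).and.cons .nil
  · refine (Frame.PolyBdd.const 1).toAllows.of_le fun x _ => ?_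
    split <;> simp
  · exact ⟨1, fun i _ => by simp [Frame.setTime]⟩

/-- The merges of one sequence with all sequences of a list. -/
theorem Computes.parWith {t : ι → List ℕ × List ℕ} {σ : ι → List RawActivity}
    {Y : ι → List (List RawActivity)} {N : ι → ℕ}
    (hN : F.PolyBdd N) (ht : Computes (F.setTime fun _ => 0) Γ fun i => encTables (t i))
    (htN : ∀ i, F.Valid i → ∀ k ∈ (t i).1 ++ (t i).2, k ≤ N i)
    (hσ : Computes (F.setTime fun _ => 0) Γ fun i => encSeq (σ i))
    (hY : Computes (F.setTime fun _ => 0) Γ fun i => encList encSeq (Y i))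
    (hσN : ∀ i, F.Valid i → SeqsBdd (N i) [σ i]) (hYN : ∀ i, F.Valid i → SeqsBdd (N i) (Y i)) :
    Computes (F.setTime fun i => (Y i).length) Γ fun i => encList encSeq
      ((Y i).map fun τ => (σ i).merge τ (BoundedWSP.keyLe (t i))) := by
  refine Computes.mapTime (eb := encSeq) (fun _ => 0) hY.slow ?_ ?_
  · refine Computes.merge (N := fun x => N x.1) (F := (F.setTime fun _ => 0).ext fun i a => a ∈ Y i)
      hN.setTime.lift ht.lift (fun x hx => htN _ hx.1) hσ.lift Computes.top ?_ ?_ ?_ ?_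
    · exact fun x hx => (hσN _ hx.1 _ (by simp)).2
    · exact fun x hx => (hYN _ hx.1 _ hx.2).2
    · exact hN.setTime.lift.of_le fun x hx => (hσN _ hx.1 _ (by simp)).1
    · exact hN.setTime.lift.of_le fun x hx => (hYN _ hx.1 _ hx.2).1
  · exact ⟨1, fun i _ => by simp [Frame.setTime]⟩

theorem succ_mul_succ_le (a b : ℕ) : (a + 1) * (b + 1) ≤ (max a 1 * max b 1 + 1) * 4 := by
  have h1 : a + 1 ≤ 2 * max a 1 := by omega
  have h2 : b + 1 ≤ 2 * max b 1 := by omega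
  have := Nat.mul_le_mul h1 h2
  nlinarith

/-- The time is that of a loop over all pairs. An empty list counts as one of length one, since the
time factor must not vanish for the work that remains. -/
theorem Computes.combine {t : ι → List ℕ × List ℕ} {k : ι → ℕ}
    {X Y : ι → List (List RawActivity)} {N : ι → ℕ}
    (hN : F.PolyBdd N) (ht : Computes (F.setTime fun _ => 0) Γ fun i => encTables (t i))
    (htN : ∀ i, F.Valid i → ∀ k ∈ (t i).1 ++ (t i).2, k ≤ N i)
    (hk : Computes (F.setTime fun _ => 0) Γ fun i => encUnary (k i))
    (hX : Computes (F.setTime fun _ => 0) Γ fun i => encList encSeq (X i))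
    (hY : Computes (F.setTime fun _ => 0) Γ fun i => encList encSeq (Y i))
    (hXN : ∀ i, F.Valid i → SeqsBdd (N i) (X i)) (hYN : ∀ i, F.Valid i → SeqsBdd (N i) (Y i)) :
    Computes (F.setTime fun i => max (X i).length 1 * max (Y i).length 1) Γ
      fun i => encList encSeq (combine (t i) (k i) (X i) (Y i)) := by
  have hT : (F.setTime fun i => max (X i).length 1 * max (Y i).length 1).Allows
      fun i => ((X i).length + 1) * ((Y i).length + 1) :=
    ⟨4, fun i _ => by simpa [Frame.setTime] using succ_mul_succ_le _ _⟩
  have hlY : ((F.setTime fun i => (Y i).length).ext fun i a => a ∈ X i).Allows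
      fun x => (Y x.1).length := ⟨1, fun i _ => by simp [Frame.ext, Frame.setTime]⟩
  have hσN : ∀ x, (F.ext fun i a => a ∈ X i).Valid x → SeqsBdd (N x.1) [x.2] := by
    intro x hx σ hσ
    rw [List.mem_singleton.1 hσ]
    exact hXN _ hx.1 _ hx.2
  have h0 : Computes (F.setTime fun i => max (X i).length 1 * max (Y i).length 1) Γ
      fun i => encList encSeq ((X i).flatMap fun σ => (Y i).flatMap fun τ =>
        if (σ.all fun a => τ.all fun b => BoundedWSP.keyLe (t i) a b) then [σ ++ τ] else []) := by
    refine Computes.flatMapTime (ea := encSeq) (eb := encSeq) (fun i => (Y i).length) hX.slow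
      ?_ ?_ hT
    · exact Computes.seqWith (F := F.ext fun i a => a ∈ X i) (N := fun x => N x.1) hN.lift ht.lift₀
        (fun x hx => htN _ hx.1) Computes.top₀ hY.lift₀ hσN (fun x hx => hYN _ hx.1)
    · refine hlY.of_le fun x _ => ?_
      have key : ∀ (f : List RawActivity → List (List RawActivity)) (Z : List (List RawActivity)),
          (∀ τ, (f τ).length ≤ 1) → (Z.flatMap f).length ≤ Z.length := by
        intro f Z hf
        induction Z with
        | nil => simp
        | cons τ Z ih => have := hf τ; simp only [List.flatMap_cons, List.length_append,
            List.length_cons]; omega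
      exact key _ _ fun τ => by split <;> simp
  have h1 : Computes (F.setTime fun i => max (X i).length 1 * max (Y i).length 1) Γ
      fun i => encList encSeq ((X i).flatMap fun σ => (Y i).map fun τ =>
        σ.merge τ (BoundedWSP.keyLe (t i))) := by
    refine Computes.flatMapTime (ea := encSeq) (eb := encSeq) (fun i => (Y i).length) hX.slow
      ?_ ?_ hT
    · exact Computes.parWith (F := F.ext fun i a => a ∈ X i) (N := fun x => N x.1) hN.lift ht.lift₀
        (fun x hx => htN _ hx.1) Computes.top₀ hY.lift₀ hσN (fun x hx => hYN _ hx.1)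
    · exact hlY.of_le (F := (F.setTime fun i => (Y i).length).ext fun i a => a ∈ X i)
        fun x _ => by simp
  have h2 : Computes (F.setTime fun i => max (X i).length 1 * max (Y i).length 1) Γ
      fun i => encList encSeq (X i ++ Y i) :=
    hX.slow.append hY.slow (hT.of_le fun i _ => by nlinarith)
  refine (Computes.ite (e := encList encSeq) hk.slow.isZero h0.and (Computes.ite
    (e := encList encSeq) hk.slow.pred.isZero.and h1.and.and h2.and.and)).congr fun i _ => ?_
  unfold BoundedWSP.combine
  rcases k i with _ | _ | k <;> simp

end

/-! ### Evaluation of the workflow -/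

/-- The length of a longest sequence in a list. -/
def maxLength (X : List (List RawActivity)) : ℕ := (X.map List.length).foldr max 0

theorem length_le_maxLength {X : List (List RawActivity)} {σ : List RawActivity} (h : σ ∈ X) :
    σ.length ≤ maxLength X := by
  induction X with
  | nil => simp at h
  | cons τ X ih =>
    simp only [maxLength, List.map_cons, List.foldr_cons] at ih ⊢
    rcases List.mem_cons.1 h with rfl | h
    · exact le_max_left _ _
    · exact (ih h).trans (le_max_right _ _)

theorem maxLength_le {X : List (List RawActivity)} {m : ℕ} (h : ∀ σ ∈ X, σ.length ≤ m) :
    maxLength X ≤ m := by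
  induction X with
  | nil => exact Nat.zero_le _
  | cons τ X ih =>
    exact max_le (h _ List.mem_cons_self) (ih fun σ hσ => h σ (List.mem_cons_of_mem _ hσ))

theorem mem_combine {t : List ℕ × List ℕ} {k : ℕ} {X Y : List (List RawActivity)}
    {ρ : List RawActivity} (h : ρ ∈ combine t k X Y) :
    (∃ σ ∈ X, ∃ τ ∈ Y, ρ.Perm (σ ++ τ)) ∨ ρ ∈ X ∨ ρ ∈ Y := by
  unfold combine at h
  split at h
  · simp only [List.mem_flatMap] at h
    obtain ⟨σ, hσ, τ, hτ, h⟩ := h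
    split at h
    · rw [List.mem_singleton.1 h]
      exact .inl ⟨σ, hσ, τ, hτ, .refl _⟩
    · simp at h
  · split at h
    · simp only [List.mem_flatMap, List.mem_map] at h
      obtain ⟨σ, hσ, τ, hτ, rfl⟩ := h
      exact .inl ⟨σ, hσ, τ, hτ, List.merge_perm_append _⟩
    · exact .inr (List.mem_append.1 h)

theorem maxLength_combine_le (t : List ℕ × List ℕ) (k : ℕ) (X Y : List (List RawActivity)) :
    maxLength (combine t k X Y) ≤ maxLength X + maxLength Y := by
  refine maxLength_le fun ρ hρ => ?_
  rcases mem_combine hρ with ⟨σ, hσ, τ, hτ, h⟩ | h | h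
  · rw [h.length_eq, List.length_append]
    exact Nat.add_le_add (length_le_maxLength hσ) (length_le_maxLength hτ)
  · exact (length_le_maxLength h).trans (Nat.le_add_right _ _)
  · exact (length_le_maxLength h).trans (Nat.le_add_left _ _)

theorem length_flatMap_le {α β : Type} (l : List α) (f : α → List β) (m : ℕ)
    (h : ∀ a ∈ l, (f a).length ≤ m) : (l.flatMap f).length ≤ l.length * m := by
  induction l with
  | nil => simp
  | cons a l ih =>
    have h1 := h a List.mem_cons_self
    have h2 := ih fun b hb => h b (List.mem_cons_of_mem _ hb)
    rw [List.flatMap_cons, List.length_append, List.length_cons, Nat.succ_mul]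
    omega

theorem length_combine_le (t : List ℕ × List ℕ) (k : ℕ) (X Y : List (List RawActivity)) :
    max (combine t k X Y).length 1 ≤
      max X.length 1 * max Y.length 1 * if k ≤ 1 then 1 else 2 := by
  have h1 : 1 ≤ max X.length 1 := le_max_right _ _
  have h2 : 1 ≤ max Y.length 1 := le_max_right _ _
  have h3 : X.length * Y.length ≤ max X.length 1 * max Y.length 1 :=
    Nat.mul_le_mul (le_max_left _ _) (le_max_left _ _)
  have h4 := Nat.mul_le_mul h1 h2
  unfold combine
  split
  · rw [if_pos (by omega), mul_one]
    refine max_le ((length_flatMap_le _ _ Y.length fun σ _ => ?_).trans h3) (by omega)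
    refine (length_flatMap_le _ _ 1 fun τ _ => ?_).trans (by omega)
    split <;> simp
  · split
    · rw [if_pos (by omega), mul_one]
      exact max_le ((length_flatMap_le _ _ Y.length fun σ _ => by simp).trans h3) (by omega)
    · rw [if_neg (by omega), List.length_append]
      have h5 : X.length ≤ max X.length 1 := le_max_left _ _
      have h6 : Y.length ≤ max Y.length 1 := le_max_left _ _
      generalize max X.length 1 = x at *
      generalize max Y.length 1 = y at *
      refine max_le ?_ ?_
      · nlinarith
      · nlinarith

/-- Whether an entry of the postfix notation is an xor branching. -/
def Token.isXor : Token → Bool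
  | .inl _ => false
  | .inr k => decide (2 ≤ k)

/-- The number of sequences in a stack, counted as if one sequence of every list were combined. -/
def stackCount (S : List (List (List RawActivity))) : ℕ := (S.map fun X => max X.length 1).prod

theorem stackCount_eq (S : List (List (List RawActivity))) :
    stackCount S = max (S.headD []).length 1 * stackCount S.tail := by
  cases S <;> simp [stackCount]

theorem stackCount_pos (S : List (List (List RawActivity))) : 0 < stackCount S := by
  induction S with
  | nil => simp [stackCount]
  | cons X S ih => rw [stackCount_eq]; exact Nat.mul_pos (by simp) ih

theorem stackCount_evalStep_le (t : List ℕ × List ℕ) (S : List (List (List RawActivity)))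
    (a : Token) : stackCount (evalStep t S a) ≤ stackCount S * if a.isXor then 2 else 1 := by
  rcases a with a | k
  · simp [evalStep, stackCount, Token.isXor]
  · rw [stackCount_eq, stackCount_eq S, stackCount_eq S.tail]
    have h := Nat.mul_le_mul_right (stackCount S.tail.tail)
      (length_combine_le t k (S.tail.headD []) (S.headD []))
    have h' : (if k ≤ 1 then 1 else 2) = if Token.isXor (.inr k) then 2 else 1 := by
      simp only [Token.isXor, decide_eq_true_eq]
      split <;> split <;> omega
    rw [h'] at h
    refine (show _ ≤ _ from h).trans (le_of_eq ?_)
    ring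

/-- The sum of the lengths of a longest sequence of every list in a stack. It bounds the length of
every sequence that the evaluation can still build from the stack. -/
def stackLength (S : List (List (List RawActivity))) : ℕ := (S.map maxLength).sum

theorem stackLength_eq (S : List (List (List RawActivity))) :
    stackLength S = maxLength (S.headD []) + stackLength S.tail := by
  cases S <;> simp [stackLength, maxLength]

theorem stackLength_evalStep_le (t : List ℕ × List ℕ) (S : List (List (List RawActivity)))
    (a : Token) : stackLength (evalStep t S a) ≤ stackLength S + 1 := by
  rcases a with a | k
  · simp [evalStep, stackLength, maxLength]; omega
  · rw [stackLength_eq, stackLength_eq S, stackLength_eq S.tail]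
    have := maxLength_combine_le t k (S.tail.headD []) (S.headD [])
    simp only [evalStep, List.headD_cons, List.tail_cons]
    omega

/-- The indices of all activities in a stack are at most `N`. -/
def StackIndexBdd (N : ℕ) (S : List (List (List RawActivity))) : Prop :=
  ∀ X ∈ S, ∀ σ ∈ X, ∀ a ∈ σ, a.2 ≤ N

theorem StackIndexBdd.headD {N : ℕ} {S : List (List (List RawActivity))}
    (h : StackIndexBdd N S) : ∀ σ ∈ S.headD [], ∀ a ∈ σ, a.2 ≤ N := by
  cases S
  · simp
  · exact h _ List.mem_cons_self

theorem StackIndexBdd.tail {N : ℕ} {S : List (List (List RawActivity))}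
    (h : StackIndexBdd N S) : StackIndexBdd N S.tail :=
  fun X hX => h X (List.mem_of_mem_tail hX)

theorem StackIndexBdd.evalStep {N : ℕ} {t : List ℕ × List ℕ} {S : List (List (List RawActivity))}
    {a : Token} (h : StackIndexBdd N S) (ha : ∀ b, a = .inl b → b.2 ≤ N) :
    StackIndexBdd N (evalStep t S a) := by
  intro X hX
  rcases a with a | k
  · rcases List.mem_cons.1 hX with rfl | hX
    · intro σ hσ b hb
      rw [List.mem_singleton.1 hσ, List.mem_singleton] at hb
      exact hb ▸ ha a rfl
    · exact h X hX
  · rcases List.mem_cons.1 hX with rfl | hX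
    · intro ρ hρ a ha
      rcases mem_combine hρ with ⟨σ, hσ, τ, hτ, hp⟩ | hρ | hρ
      · rcases List.mem_append.1 (hp.mem_iff.1 ha) with ha | ha
        · exact h.tail.headD σ hσ a ha
        · exact h.headD τ hτ a ha
      · exact h.tail.headD ρ hρ a ha
      · exact h.headD ρ hρ a ha
    · exact h.tail.tail X hX

section
variable {ι : Type} {F : Frame ι} {Γ : ι → Data}

/-- The program evaluates the postfix notation with a stack. The invariant is that `stackCount`,
multiplied by two for every xor branching still to be read, is at most the time factor: no list on
the way is longer than the bound for the final one. -/
theorem Computes.canonical {t : ι → List ℕ × List ℕ} {G : ι → RawWorkflow} {N : ι → ℕ}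
    (hN : F.PolyBdd N) (ht : Computes (F.setTime fun _ => 0) Γ fun i => encTables (t i))
    (htN : ∀ i, F.Valid i → ∀ k ∈ (t i).1 ++ (t i).2, k ≤ N i)
    (hG : Computes (F.setTime fun _ => 0) Γ fun i => encRaw (G i))
    (hlen : ∀ i, F.Valid i → (G i).postfixTokens.length ≤ N i)
    (hidx : ∀ i, F.Valid i → ∀ a, Sum.inl a ∈ (G i).postfixTokens → a.2 ≤ N i) :
    Computes (F.setTime fun i => 2 ^ (G i).postfixTokens.countP Token.isXor) Γ
      fun i => encList encSeq ((G i).canonical (t i)) := by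
  set B : ι → ℕ := fun i => (G i).postfixTokens.countP Token.isXor with hB
  have hp : Computes (F.setTime fun i => 2 ^ B i) Γ
      fun i => encList encToken (G i).postfixTokens :=
    hG.slow.postfixTokens (hN.of_le hlen)
  let eS : List (List (List RawActivity)) → Data := encList (encList encSeq)
  have h : Computes (F.setTime fun i => 2 ^ B i) Γ
      fun i => eS ((G i).postfixTokens.foldl (evalStep (t i)) []) := by
    refine Computes.foldlTime (b := fun _ => []) (fun i => 2 ^ B i)
      (fun i l S => stackCount S * 2 ^ l.countP Token.isXor ≤ 2 ^ B i ∧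
        stackLength S + l.length ≤ N i ∧ StackIndexBdd (N i) S ∧
        ∀ a, Sum.inl a ∈ l → a.2 ≤ N i) hp (.const .nil) ?_ ?_ ?_ ?_
    · -- the two kinds of tokens are told apart by the left subtree of their encoding
      set F' := ((((F.setTime fun i => 2 ^ B i).setTime fun i => 2 ^ B i).ext
        fun _ (_ : Token) => True).ext fun x S => ∃ l,
        stackCount S * 2 ^ (x.2 :: l).countP Token.isXor ≤ 2 ^ B x.1 ∧
        stackLength S + (x.2 :: l).length ≤ N x.1 ∧ StackIndexBdd (N x.1) S ∧
        ∀ a, Sum.inl a ∈ x.2 :: l → a.2 ≤ N x.1) with hF'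
      have tok : Computes (F'.setTime fun _ => 0) (push (push Γ encToken) eS)
          fun x => encToken x.1.2 :=
        (Computes.top₀ (F := F.setTime fun i => 2 ^ B i) (Q := fun _ _ => True)).lift₀
      have stk : Computes (F'.setTime fun _ => 0) (push (push Γ encToken) eS) fun x => eS x.2 :=
        Computes.top₀ (F := (F.setTime fun i => 2 ^ B i).ext fun _ _ => True)
      have tab : Computes (F'.setTime fun _ => 0) (push (push Γ encToken) eS)
          fun x => encTables (t x.1.1) :=
        Computes.lift₀ (F := (F.setTime fun i => 2 ^ B i).ext fun _ _ => True)
          (Computes.lift₀ (F := F.setTime fun i => 2 ^ B i) ht)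
      have bdd : F'.PolyBdd fun x => N x.1.1 :=
        ((hN.setTime (T := fun i => 2 ^ B i)).lift (Q := fun _ (_ : Token) => True)).lift
      have h1 : Computes (F'.and fun x => (encToken x.1.2).hd = .nil) (push (push Γ encToken) eS)
          fun x => eS (evalStep (t x.1.1) x.2 x.1.2) := by
        refine (((Computes.cons (tok.slow (T := F'.time)).tl .nil).cons .nil).cons
          stk.slow).and.congr ?_
        rintro ⟨⟨i, a | k⟩, S⟩ ⟨-, h⟩
        · rfl
        · cases h
      have h2 : Computes (F'.and fun x => (encToken x.1.2).hd ≠ .nil) (push (push Γ encToken) eS)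
          fun x => eS (evalStep (t x.1.1) x.2 x.1.2) := by
        have hd := stk.headD (e := encList encSeq) (d := []) rfl
        have hd' := stk.ltail.headD (e := encList encSeq) (d := []) rfl
        have hc := Computes.combine (F := F'.and fun x => (encToken x.1.2).hd ≠ .nil)
          (N := fun x => N x.1.1) (k := fun x => x.1.2.elim (fun _ => 0) fun k => k)
          (X := fun x => x.2.tail.headD []) (Y := fun x => x.2.headD []) bdd.and tab.and
          (fun x hx => htN _ hx.1.1.1) (tok.tl.and.congr ?_) hd'.and hd.and ?_ ?_
        · refine (Computes.lcons (e := encList encSeq) (hc.ofTime ?_)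
            (stk.slow (T := F'.time)).ltail.ltail.and).congr ?_
          · refine ⟨2, fun x hx => ?_⟩
            obtain ⟨⟨-, l, hl, -⟩, -⟩ := hx
            have h3 : 1 ≤ 2 ^ (x.1.2 :: l).countP Token.isXor := Nat.one_le_two_pow
            have h4 := stackCount_pos x.2.tail.tail
            rw [stackCount_eq, stackCount_eq x.2.tail] at hl
            have h5 : max (x.2.tail.headD []).length 1 * max (x.2.headD []).length 1 ≤
                2 ^ B x.1.1 := by
              refine le_trans ?_ hl
              rw [← mul_assoc, mul_assoc, mul_comm (max (x.2.tail.headD []).length 1)]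
              exact Nat.le_mul_of_pos_right _ (Nat.mul_pos h4 h3)
            change _ ≤ (2 ^ B x.1.1 + 1) * _
            simp only [Polynomial.eval_ofNat]
            omega
          · rintro ⟨⟨i, a | k⟩, S⟩ ⟨-, h⟩
            · exact absurd rfl h
            · rfl
        · rintro ⟨⟨i, a | k⟩, S⟩ ⟨-, h⟩
          · exact absurd rfl h
          · rfl
        · rintro x ⟨⟨-, l, -, hl, hi, -⟩, -⟩ σ hσ
          refine ⟨(length_le_maxLength hσ).trans (le_trans ?_ hl), hi.tail.headD σ hσ⟩
          rw [stackLength_eq, stackLength_eq x.2.tail]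
          omega
        · rintro x ⟨⟨-, l, -, hl, hi, -⟩, -⟩ σ hσ
          refine ⟨(length_le_maxLength hσ).trans (le_trans ?_ hl), hi.headD σ hσ⟩
          rw [stackLength_eq]
          omega
      exact Computes.cases (tok.slow (T := F'.time)).hd h2 h1
    · intro i hi
      refine ⟨by simp [stackCount, hB], ?_, fun X hX => by simp at hX, hidx i hi⟩
      simpa [stackLength] using hlen i hi
    · rintro i a l S hi ⟨h1, h2, h3, h4⟩
      refine ⟨?_, ?_, h3.evalStep fun b hb => h4 b (by simp [hb]), fun b hb => h4 b (by simp [hb])⟩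
      · refine le_trans ?_ h1
        rw [List.countP_cons, pow_add, mul_comm (2 ^ _), ← mul_assoc]
        refine Nat.mul_le_mul_right _ ((stackCount_evalStep_le _ _ _).trans ?_)
        exact Nat.mul_le_mul_left _ (by split <;> simp)
      · have := stackLength_evalStep_le (t i) S a
        rw [List.length_cons] at h2
        omega
    · exact ((hN.of_le hlen).allows (F := F.setTime fun i => 2 ^ B i)).of_le fun _ _ => le_rfl
  refine (h.hd).congr fun i _ => ?_
  rw [foldl_evalStep]; rfl

end

/-! ### Canonical sequences represent all execution sequences -/

theorem rawActivity_injective {s r : ℕ} :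
    Function.Injective (rawActivity : Activity s r → RawActivity) := by
  rintro (x | x) (y | y) h <;> simp_all [rawActivity, Fin.ext_iff]

theorem perm_of_mem_interleavings {α : Type} [DecidableEq α] {l m o : List α}
    (h : o ∈ interleavings l m) : o.Perm (l ++ m) ∧ l.Sublist o ∧ m.Sublist o := by
  fun_induction interleavings l m generalizing o with
  | case1 m => rw [Finset.mem_singleton.1 h]; simp
  | case2 a l => rw [Finset.mem_singleton.1 h]; simp
  | case3 a l b m ih1 ih2 =>
    rcases Finset.mem_union.1 h with h | h
    · obtain ⟨o, ho, rfl⟩ := Finset.mem_image.1 h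
      obtain ⟨h1, h2, h3⟩ := ih1 ho
      exact ⟨h1.cons a, h2.cons_cons a, h3.cons a⟩
    · obtain ⟨o, ho, rfl⟩ := Finset.mem_image.1 h
      obtain ⟨h1, h2, h3⟩ := ih2 ho
      exact ⟨(h1.cons b).trans List.perm_middle.symm, h2.cons b, h3.cons_cons b⟩

theorem exists_merge_eq {α β : Type} [DecidableEq α] (f : α → β) (le : β → β → Bool)
    (l m : List α) : ∃ o ∈ interleavings l m, (l.map f).merge (m.map f) le = o.map f := by
  fun_induction interleavings l m with
  | case1 m => exact ⟨m, by simp, by simp⟩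
  | case2 a l => exact ⟨a :: l, by simp, by simp⟩
  | case3 a l b m ih1 ih2 =>
    rw [List.map_cons, List.map_cons, List.cons_merge_cons]
    split
    · obtain ⟨o, ho, h⟩ := ih1
      exact ⟨a :: o, Finset.mem_union_left _ (Finset.mem_image_of_mem _ ho), by
        rw [← List.map_cons, h, List.map_cons]⟩
    · obtain ⟨o, ho, h⟩ := ih2
      exact ⟨b :: o, Finset.mem_union_right _ (Finset.mem_image_of_mem _ ho), by
        rw [← List.map_cons, h, List.map_cons]⟩

section
variable {s r : ℕ}

/-- Soundness: canonical sequences are execution sequences. No condition on the keys is needed. -/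
theorem exists_execSeq_of_mem_canonical (t : List ℕ × List ℕ) (G : Workflow s r)
    {ρ : List RawActivity} (h : ρ ∈ G.raw.canonical t) :
    ∃ σ ∈ G.execSeqs, ρ = σ.map rawActivity := by
  induction G generalizing ρ with
  | atom v => exact ⟨[v], by simp [Workflow.execSeqs], by
      simpa [Workflow.raw, RawWorkflow.canonical] using h⟩
  | seq G H ihG ihH =>
    simp only [Workflow.raw, RawWorkflow.canonical, combine, if_true, List.mem_flatMap] at h
    obtain ⟨ρ₁, h1, ρ₂, h2, h⟩ := h
    split at h
    · obtain ⟨σ, hσ, rfl⟩ := ihG h1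
      obtain ⟨τ, hτ, rfl⟩ := ihH h2
      exact ⟨σ ++ τ, Finset.mem_image₂_of_mem hσ hτ, by simpa using h⟩
    · simp at h
  | par G H ihG ihH =>
    simp only [Workflow.raw, RawWorkflow.canonical, combine, one_ne_zero, if_false, if_true,
      List.mem_flatMap, List.mem_map] at h
    obtain ⟨ρ₁, h1, ρ₂, h2, rfl⟩ := h
    obtain ⟨σ, hσ, rfl⟩ := ihG h1
    obtain ⟨τ, hτ, rfl⟩ := ihH h2
    obtain ⟨o, ho, h⟩ := exists_merge_eq rawActivity (keyLe t) σ τ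
    exact ⟨o, Finset.mem_biUnion.2 ⟨σ, hσ, Finset.mem_biUnion.2 ⟨τ, hτ, ho⟩⟩, h⟩
  | xor G H ihG ihH =>
    simp only [Workflow.raw, RawWorkflow.canonical, combine, OfNat.ofNat_ne_zero, if_false,
      OfNat.ofNat_ne_one, List.mem_append] at h
    rcases h with h | h
    · obtain ⟨σ, hσ, rfl⟩ := ihG h
      exact ⟨σ, Finset.mem_union_left _ hσ, rfl⟩
    · obtain ⟨σ, hσ, rfl⟩ := ihH h
      exact ⟨σ, Finset.mem_union_right _ hσ, rfl⟩

/-- The sequence is sorted by the keys. -/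
def KeySorted (t : List ℕ × List ℕ) (ρ : List RawActivity) : Prop :=
  ρ.Pairwise fun a b => keyLe t a b = true

/-- Completeness: an execution sequence that is sorted by the keys has a canonical counterpart with
the same activities, obtained by resolving the xor branchings in the same way. -/
theorem exists_mem_canonical (t : List ℕ × List ℕ) (G : Workflow s r)
    {τ : List (Activity s r)} (hτ : τ ∈ G.execSeqs) (hs : KeySorted t (τ.map rawActivity)) :
    ∃ ρ ∈ G.raw.canonical t, ρ.Perm (τ.map rawActivity) ∧ KeySorted t ρ := by
  induction G generalizing τ with
  | atom v =>
    rw [Workflow.execSeqs, Finset.mem_singleton] at hτ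
    subst hτ
    exact ⟨_, by simp [Workflow.raw, RawWorkflow.canonical], by simp, hs⟩
  | seq G H ihG ihH =>
    obtain ⟨τ₁, h1, τ₂, h2, rfl⟩ := Finset.mem_image₂.1 hτ
    rw [KeySorted, List.map_append, List.pairwise_append] at hs
    obtain ⟨ρ₁, hρ1, hp1, hs1⟩ := ihG h1 hs.1
    obtain ⟨ρ₂, hρ2, hp2, hs2⟩ := ihH h2 hs.2.1
    have hle : ∀ a ∈ ρ₁, ∀ b ∈ ρ₂, keyLe t a b = true := fun a ha b hb =>
      hs.2.2 a (hp1.mem_iff.1 ha) b (hp2.mem_iff.1 hb)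
    refine ⟨ρ₁ ++ ρ₂, ?_, by simpa using hp1.append hp2, ?_⟩
    · simp only [Workflow.raw, RawWorkflow.canonical, combine, if_true, List.mem_flatMap]
      refine ⟨ρ₁, hρ1, ρ₂, hρ2, ?_⟩
      rw [if_pos (by simpa [List.all_eq_true] using hle)]
      simp
    · exact List.pairwise_append.2 ⟨hs1, hs2, hle⟩
  | par G H ihG ihH =>
    simp only [Workflow.execSeqs, Finset.mem_biUnion] at hτ
    obtain ⟨τ₁, h1, τ₂, h2, h⟩ := hτ
    obtain ⟨hp, hl, hr⟩ := perm_of_mem_interleavings h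
    obtain ⟨ρ₁, hρ1, hp1, hs1⟩ := ihG h1 (hs.sublist (hl.map _))
    obtain ⟨ρ₂, hρ2, hp2, hs2⟩ := ihH h2 (hs.sublist (hr.map _))
    refine ⟨ρ₁.merge ρ₂ (keyLe t), ?_, ?_, ?_⟩
    · simp only [Workflow.raw, RawWorkflow.canonical, combine, one_ne_zero, if_false, if_true,
        List.mem_flatMap, List.mem_map]
      exact ⟨ρ₁, hρ1, ρ₂, hρ2, rfl⟩
    · refine (List.merge_perm_append _).trans ((hp1.append hp2).trans ?_)
      rw [← List.map_append]
      exact (hp.map _).symm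
    · refine List.pairwise_merge (fun a b c => ?_) (fun a b => ?_) _ _ hs1 hs2
      · simp only [keyLe, decide_eq_true_eq]
        exact le_trans
      · simp only [keyLe, Bool.or_eq_true, decide_eq_true_eq]
        exact le_total _ _
  | xor G H ihG ihH =>
    simp only [Workflow.raw, RawWorkflow.canonical, combine, OfNat.ofNat_ne_zero, if_false,
      OfNat.ofNat_ne_one, List.mem_append]
    rcases Finset.mem_union.1 hτ with h | h
    · obtain ⟨ρ, hρ, h'⟩ := ihG h hs
      exact ⟨ρ, .inl hρ, h'⟩
    · obtain ⟨ρ, hρ, h'⟩ := ihH h hs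
      exact ⟨ρ, .inr hρ, h'⟩

/-- Only xor branchings add up the numbers of canonical sequences. The proof takes maxima with one,
which makes the bound stable under the sum at an xor branching:
`max (a + b) 1 ≤ 2 * (max a 1 * max b 1)`. -/
theorem length_canonical_le (t : List ℕ × List ℕ) (G : Workflow s r) :
    (G.raw.canonical t).length ≤ 2 ^ G.xorCount := by
  suffices h : max (G.raw.canonical t).length 1 ≤ 2 ^ G.xorCount from (le_max_left _ _).trans h
  induction G with
  | atom v => simp [Workflow.raw, RawWorkflow.canonical, Workflow.xorCount]
  | seq G H ihG ihH =>
    refine (length_combine_le _ _ _ _).trans ?_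
    simpa [Workflow.xorCount, pow_add] using Nat.mul_le_mul ihG ihH
  | par G H ihG ihH =>
    refine (length_combine_le _ _ _ _).trans ?_
    simpa [Workflow.xorCount, pow_add] using Nat.mul_le_mul ihG ihH
  | xor G H ihG ihH =>
    refine (length_combine_le _ _ _ _).trans ?_
    simpa [Workflow.xorCount, pow_add] using Nat.mul_le_mul ihG ihH

theorem countP_postfixTokens (G : Workflow s r) :
    G.raw.postfixTokens.countP Token.isXor = G.xorCount := by
  induction G with
  | atom v => rfl
  | _ => simp_all [Workflow.raw, RawWorkflow.postfixTokens, Workflow.xorCount, Token.isXor,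
      List.countP_append, add_assoc]

theorem length_postfixTokens_le (G : RawWorkflow) : G.postfixTokens.length ≤ (encRaw G).size := by
  induction G with
  | leaf a =>
    simp only [RawWorkflow.postfixTokens, encRaw, List.length_singleton]
    exact Nat.pos_of_ne_zero (Nat.ne_zero_of_lt (Data.height_lt_size _))
  | node k G H ihG ihH =>
    simp only [RawWorkflow.postfixTokens, encRaw, List.length_append, List.length_singleton,
      Data.size]
    omega

theorem index_le_of_mem_postfixTokens {G : RawWorkflow} {a : RawActivity}
    (h : Sum.inl a ∈ G.postfixTokens) : a.2 ≤ (encRaw G).size := by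
  induction G with
  | leaf b =>
    obtain rfl : a = b := by simpa [RawWorkflow.postfixTokens] using h
    have := lt_size_encUnary a.2
    simp only [encRaw, encActivity, encPair, Data.size]
    omega
  | node k G H ihG ihH =>
    simp only [encRaw, Data.size]
    rcases List.mem_append.1 h with h | h
    · have := ihG h; omega
    · rcases List.mem_append.1 h with h | h
      · have := ihH h; omega
      · simp at h

theorem subperm_activities (G : Workflow s r) {σ : List (Activity s r)} (h : σ ∈ G.execSeqs) :
    σ.Subperm G.activities := by
  induction G generalizing σ with
  | atom v => rw [Finset.mem_singleton.1 h]; exact List.Subperm.refl _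
  | seq G H ihG ihH =>
    obtain ⟨τ₁, h1, τ₂, h2, rfl⟩ := Finset.mem_image₂.1 h
    exact (ihG h1).append (ihH h2)
  | par G H ihG ihH =>
    simp only [Workflow.execSeqs, Finset.mem_biUnion] at h
    obtain ⟨τ₁, h1, τ₂, h2, h⟩ := h
    exact (perm_of_mem_interleavings h).1.subperm.trans ((ihG h1).append (ihH h2))
  | xor G H ihG ihH =>
    rcases Finset.mem_union.1 h with h | h
    · exact (ihG h).trans (List.sublist_append_left _ _).subperm
    · exact (ihH h).trans (List.sublist_append_right _ _).subperm

theorem nodup_of_mem_execSeqs {G : Workflow s r} (hG : G.activities.Nodup)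
    {σ : List (Activity s r)} (h : σ ∈ G.execSeqs) : σ.Nodup := by
  obtain ⟨l, hp, hl⟩ := subperm_activities G h
  exact hp.nodup_iff.1 (hG.sublist hl)

/-! ### Blocks of sorted sequences -/

theorem stepsOf_cons_inl (x : Fin s) (σ : List (Activity s r)) :
    stepsOf (.inl x :: σ) = {x} ∪ stepsOf σ := by
  simp [stepsOf]

theorem stepsOf_cons_inr (x : Fin r) (σ : List (Activity s r)) :
    stepsOf (.inr x :: σ) = stepsOf σ := rfl

theorem blocks_inl {u : ℕ} (c : ReleaseConstraint s r u) (x : Fin s) (σ : List (Activity s r)) :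
    c.blocks (.inl x :: σ) = (c.blocks σ).modifyHead fun Q => c.scope ∩ {x} ∪ Q := by
  unfold ReleaseConstraint.blocks
  rw [List.splitOnP_cons_eq_if_modifyHead, if_neg (by simp)]
  cases h : σ.splitOnP fun v => decide (∃ x ∈ c.releases, v = Sum.inr x) with
  | nil => rfl
  | cons τ L =>
    simp only [List.modifyHead_cons, List.map_cons, stepsOf_cons_inl,
      Finset.inter_union_distrib_left]

theorem blocks_inr {u : ℕ} (c : ReleaseConstraint s r u) (x : Fin r) (σ : List (Activity s r)) :
    c.blocks (.inr x :: σ) = if x ∈ c.releases then ∅ :: c.blocks σ else c.blocks σ := by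
  unfold ReleaseConstraint.blocks
  rw [List.splitOnP_cons_eq_if_modifyHead]
  by_cases hx : x ∈ c.releases
  · rw [if_pos (by simpa using hx), if_pos hx]
    simp [stepsOf]
  · rw [if_neg (by simpa using hx), if_neg hx]
    cases h : σ.splitOnP fun v => decide (∃ x ∈ c.releases, v = Sum.inr x) with
    | nil => rfl
    | cons τ L => simp only [List.modifyHead_cons, List.map_cons, stepsOf_cons_inr]

theorem blocks_congr_cons {u : ℕ} (c : ReleaseConstraint s r u) (v : Activity s r)
    {σ τ : List (Activity s r)} (h : c.blocks σ = c.blocks τ) :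
    c.blocks (v :: σ) = c.blocks (v :: τ) := by
  rcases v with x | x
  · rw [blocks_inl, blocks_inl, h]
  · rw [blocks_inr, blocks_inr, h]

/-- A step may be moved in front of other steps: as long as no release point is passed, only the
first block changes, and it is a union. -/
theorem blocks_swap {u : ℕ} (c : ReleaseConstraint s r u) (l : List (Fin s)) (x : Fin s)
    (σ : List (Activity s r)) :
    c.blocks (l.map .inl ++ .inl x :: σ) = c.blocks (.inl x :: (l.map .inl ++ σ)) := by
  induction l with
  | nil => rfl
  | cons y l ih =>
    rw [List.map_cons, List.cons_append, blocks_congr_cons c _ ih, List.cons_append]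
    simp only [blocks_inl]
    cases c.blocks (l.map .inl ++ σ) with
    | nil => rfl
    | cons Q L => simp only [List.modifyHead_cons, Finset.union_left_comm]

/-- A sorted sequence is determined by its elements, up to the order of steps with the same key;
this order has no influence on the blocks of a constraint. -/
theorem blocks_eq_of_sorted {u : ℕ} (c : ReleaseConstraint s r u) (k : Activity s r → ℕ)
    (hk : ∀ v w, k v = k w → v = w ∨ v.isLeft = true ∧ w.isLeft = true)
    {σ τ : List (Activity s r)} (hp : σ.Perm τ) (hσ : σ.Pairwise fun v w => k v ≤ k w)
    (hτ : τ.Pairwise fun v w => k v ≤ k w) : c.blocks σ = c.blocks τ := by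
  induction σ generalizing τ with
  | nil => rw [List.nil_perm.1 hp]
  | cons v σ ih =>
    rw [List.pairwise_cons] at hσ
    obtain ⟨τ₁, τ₂, rfl⟩ := List.append_of_mem (hp.mem_iff.1 List.mem_cons_self)
    have hp' : σ.Perm (τ₁ ++ τ₂) := (hp.trans List.perm_middle).cons_inv
    have heq : ∀ w ∈ τ₁, k w = k v := fun w hw =>
      le_antisymm ((List.pairwise_append.1 hτ).2.2 w hw v List.mem_cons_self)
        (hσ.1 w (hp'.mem_iff.2 (List.mem_append_left _ hw)))
    have h := blocks_congr_cons c v (ih hp' hσ.2 (hτ.sublist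
      (List.Sublist.append_left (List.sublist_cons_self _ _) _)))
    rw [h]
    rcases v with x | x
    · obtain ⟨l, rfl⟩ : ∃ l : List (Fin s), τ₁ = l.map .inl := by
        clear h hp hp' hτ
        induction τ₁ with
        | nil => exact ⟨[], rfl⟩
        | cons w τ₁ ih' =>
          obtain ⟨l, rfl⟩ := ih' fun w' hw' => heq w' (List.mem_cons_of_mem _ hw')
          rcases hk _ _ (heq w List.mem_cons_self) with rfl | hw
          · exact ⟨x :: l, rfl⟩
          · obtain ⟨y, rfl⟩ := Sum.isLeft_iff.1 hw.1
            exact ⟨y :: l, rfl⟩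
      exact (blocks_swap c l x τ₂).symm
    · have hτ₁ : ∀ w ∈ τ₁, w = .inr x := fun w hw => by
        rcases hk _ _ (heq w hw) with h | h
        · exact h
        · exact absurd h.2 (by simp)
      clear h hp hp' hτ heq
      induction τ₁ with
      | nil => rfl
      | cons w τ₁ ih' =>
        have h1 := hτ₁ w List.mem_cons_self
        rw [List.cons_append, List.cons_append, h1]
        exact blocks_congr_cons c _ (ih' fun w' hw' => hτ₁ w' (List.mem_cons_of_mem _ hw'))

/-! ### Keys that sort a given sequence -/

/-- The keys of steps are even, those of release points odd: a step with key `2 * g` lies between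
the release points with keys `2 * g - 1` and `2 * g + 1`. -/
theorem exists_keys {τ : List (Activity s r)} (hτ : τ.Nodup) :
    ∃ (e : Equiv.Perm (Fin r)) (g : Fin s → ℕ), (∀ x, g x < r + 1) ∧
      τ.Pairwise fun v w => v.elim (fun x => 2 * g x) (fun i => 2 * (e i : ℕ) + 1) ≤
        w.elim (fun x => 2 * g x) fun i => 2 * (e i : ℕ) + 1 := by
  let _ : BEq (Activity s r) := instBEqOfDecidableEq
  -- the number of release points in front of an activity
  let cnt : Activity s r → ℕ := fun v => (τ.take (τ.idxOf v)).countP Sum.isRight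
  have htot : τ.countP Sum.isRight ≤ r := by
    have h1 : (τ.filterMap Sum.getRight?).length = τ.countP Sum.isRight := by
      rw [List.length_filterMap_eq_countP]
      congr 1
      funext v
      cases v <;> rfl
    have h2 : (τ.filterMap Sum.getRight?).Nodup := hτ.filterMap (by
      rintro (a | a) (b | b) c h1 h2 <;> simp_all)
    rw [← h1]
    simpa using h2.length_le_card
  have hmono : ∀ j (hj : j < τ.length),
      (τ.take (j + 1)).countP Sum.isRight =
        (τ.take j).countP Sum.isRight + if τ[j].isRight then 1 else 0 := by
    intro j hj
    rw [List.take_succ_eq_append_getElem hj, List.countP_append, List.countP_singleton]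
  have hcnt : ∀ i j (hi : i < τ.length) (hj : j < τ.length), i < j →
      cnt τ[i] + (if τ[i].isRight then 1 else 0) ≤ cnt τ[j] := by
    intro i j hi hj hij
    simp only [cnt, hτ.idxOf_getElem]
    rw [← hmono i hi]
    exact List.Sublist.countP_le (List.take_sublist_take_left hij)
  have hle : ∀ v, cnt v ≤ r := fun v => ((List.take_sublist _ _).countP_le).trans htot
  have hlt : ∀ i : {i : Fin r // Sum.inr i ∈ τ}, cnt (.inr i.1) < r := by
    rintro ⟨i, hi⟩
    obtain ⟨j, hj, h⟩ := List.getElem_of_mem hi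
    have h1 := hmono j hj
    have h2 : (τ.take (j + 1)).countP Sum.isRight ≤ τ.countP Sum.isRight :=
      (List.take_sublist _ _).countP_le
    have h3 : cnt τ[j] = (τ.take j).countP Sum.isRight := by simp only [cnt, hτ.idxOf_getElem]
    rw [h] at h1 h3
    simp only [Sum.isRight_inr, if_true] at h1
    simp only
    omega
  obtain ⟨e, he⟩ := Equiv.Perm.exists_extending_pair
    (fun i : {i : Fin r // (Sum.inr i : Activity s r) ∈ τ} => i.1)
    (fun i => ⟨cnt (.inr i.1), hlt i⟩) Subtype.val_injective (by
      rintro ⟨i, hi⟩ ⟨j, hj⟩ h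
      simp only [Fin.mk.injEq] at h
      obtain ⟨a, ha, h1⟩ := List.getElem_of_mem hi
      obtain ⟨b, hb, h2⟩ := List.getElem_of_mem hj
      rcases lt_trichotomy a b with hab | rfl | hab
      · have := hcnt a b ha hb hab
        rw [h1, h2] at this
        simp only [Sum.isRight_inr, if_true] at this
        omega
      · rw [h1] at h2
        exact Subtype.ext (Sum.inr_injective h2)
      · have := hcnt b a hb ha hab
        rw [h1, h2] at this
        simp only [Sum.isRight_inr, if_true] at this
        omega)
  refine ⟨e, fun x => cnt (.inl x), fun x => Nat.lt_succ_of_le (hle _), ?_⟩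
  have hkey : ∀ v ∈ τ, v.elim (fun x => 2 * cnt (.inl x)) (fun i => 2 * (e i : ℕ) + 1) =
      2 * cnt v + if v.isRight then 1 else 0 := by
    rintro (x | i) hv
    · simp
    · simp only [Sum.elim_inr]
      rw [show (e i : ℕ) = cnt (.inr i) from congrArg Fin.val (he ⟨i, hv⟩)]
      simp
  rw [List.pairwise_iff_getElem]
  intro i j hi hj hij
  rw [hkey _ (List.getElem_mem hi), hkey _ (List.getElem_mem hj)]
  have := hcnt i j hi hj hij
  generalize (if τ[i].isRight then 1 else 0) = a at this ⊢
  generalize (if τ[j].isRight then 1 else 0) = b at this ⊢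
  omega

end

/-! ### Enumeration of vectors and permutations -/

/-- All lists of length `m` with entries from the list `l`. -/
def vectors (l : List ℕ) : ℕ → List (List ℕ)
  | 0 => [[]]
  | m + 1 => (vectors l m).flatMap fun v => l.map fun a => a :: v

theorem mem_vectors {l : List ℕ} {m : ℕ} {v : List ℕ} :
    v ∈ vectors l m ↔ v.length = m ∧ ∀ a ∈ v, a ∈ l := by
  induction m generalizing v with
  | zero => simp +contextual [vectors, List.length_eq_zero_iff]
  | succ m ih =>
    simp only [vectors, List.mem_flatMap, List.mem_map]
    constructor
    · rintro ⟨w, hw, a, ha, rfl⟩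
      obtain ⟨h1, h2⟩ := ih.1 hw
      exact ⟨by simp [h1], by simpa using ⟨ha, h2⟩⟩
    · rintro ⟨h1, h2⟩
      obtain ⟨a, w, rfl⟩ := List.exists_cons_of_length_eq_add_one h1
      exact ⟨w, ih.2 ⟨by simpa using h1, fun b hb => h2 b (List.mem_cons_of_mem _ hb)⟩, a,
        h2 a List.mem_cons_self, rfl⟩

theorem length_vectors (l : List ℕ) (m : ℕ) : (vectors l m).length = l.length ^ m := by
  induction m with
  | zero => rfl
  | succ m ih => simp [vectors, List.length_flatMap, ih, pow_succ]

theorem iterate_vectors (l : List ℕ) (m : ℕ) :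
    (fun L : List (List ℕ) => L.flatMap fun v => l.map fun a => a :: v)^[m] [[]] =
      vectors l m := by
  induction m with
  | zero => rfl
  | succ m ih => rw [Function.iterate_succ_apply', ih]; rfl

theorem length_permutations' {α : Type} (l : List α) :
    l.permutations'.length = l.length.factorial := by
  rw [← (List.permutations_perm_permutations' l).length_eq, List.length_permutations]

section
variable {ι α : Type} {F : Frame ι} {Γ : ι → Data}

theorem Computes.vectors {l : ι → List ℕ} {m : ι → ℕ}
    (hl : Computes (F.setTime fun _ => 0) Γ fun i => encList encUnary (l i))
    (hm : Computes (F.setTime fun _ => 0) Γ fun i => encUnary (m i))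
    (hbl : F.PolyBdd fun i => (l i).length) (hbm : F.PolyBdd m) :
    Computes (F.setTime fun i => (l i).length ^ m i) Γ
      fun i => encList (encList encUnary) (vectors (l i) (m i)) := by
  refine (Computes.iterate (e := encList (encList encUnary)) (b := fun _ => [[]])
    (st := fun i L => L.flatMap fun v => (l i).map fun a => a :: v) (fun i => (l i).length ^ m i)
    (fun i j L => L.length ≤ (l i).length ^ m i + 1 ∧ ∃ k, k + j = m i ∧
      L = BoundedWSP.vectors (l i) k) hm.slow (.const (.cons .nil .nil)) ?_
    (fun i _ => ⟨by simp, 0, by simp, rfl⟩) ?_ (hbm.setTime.allows)).congr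
    fun i _ => by rw [iterate_vectors]
  · set F' := ((F.setTime fun i => (l i).length ^ m i).setTime fun i => (l i).length ^ m i).ext
      fun i L => ∃ j, L.length ≤ (l i).length ^ m i + 1 ∧ ∃ k, k + (j + 1) = m i ∧
        L = BoundedWSP.vectors (l i) k
    refine Computes.flatMapTime (ea := encList encUnary) (eb := encList encUnary) (F := F')
      (fun _ => 0) Computes.top ?_ ?_ ?_
    · refine Computes.map (F := (F'.setTime fun _ => 0).ext fun x v => v ∈ x.2)
        (Computes.lift (F := F'.setTime fun _ => 0) (hl.liftTo (F' := F'.setTime fun _ => 0)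
          (fun x hx => hx.1) (fun _ _ => rfl) fun _ _ => le_rfl)) ?_ ?_
      · exact Computes.lcons (e := encUnary) Computes.var Computes.var₂
      · exact hbl.reindex (F' := (F'.setTime fun _ => 0).ext fun x v => v ∈ x.2)
          (fun x => x.1.1) (fun x hx => hx.1.1) fun _ _ => rfl
    · simp only [List.length_map]
      exact (hbl.reindex (F' := (F'.setTime fun _ => 0).ext fun x v => v ∈ x.2)
          (fun x => x.1.1) (fun x hx => hx.1.1) fun _ _ => rfl).toAllows
    · refine ⟨2, fun x hx => ?_⟩
      obtain ⟨-, j, h, -⟩ := hx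
      change _ ≤ ((l x.1).length ^ m x.1 + 1) * _
      simp only [Polynomial.eval_ofNat]
      omega
  · rintro i j L - ⟨-, k, hk, rfl⟩
    refine ⟨?_, k + 1, by omega, rfl⟩
    change (BoundedWSP.vectors (l i) (k + 1)).length ≤ _
    rw [length_vectors]
    rcases Nat.eq_zero_or_pos (l i).length with h | h
    · rw [h, zero_pow (Nat.succ_ne_zero k)]
      exact Nat.zero_le _
    · exact (Nat.pow_le_pow_right h (by omega)).trans (Nat.le_succ _)

/-- Insertion of a new entry at all positions of a list. -/
theorem Computes.permutationsAux {e : α → Data} {a : ι → α} {l : ι → List α}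
    (ha : Computes F Γ fun i => e (a i)) (hl : Computes F Γ fun i => encList e (l i))
    (hlen : F.PolyBdd fun i => (l i).length) :
    Computes F Γ fun i => encList (encList e) ((l i).permutations'Aux (a i)) := by
  let st : α → List α × List (List α) → α → List α × List (List α) :=
    fun a v y => (y :: v.1, (a :: y :: v.1) :: v.2.map (y :: ·))
  have h : Computes F Γ fun i => encPair (encList e) (encList (encList e))
      ((l i).reverse.foldl (st (a i)) ([], [[a i]])) := by
    refine Computes.foldlTime (eb := encPair (encList e) (encList (encList e)))
      (b := fun i => ([], [[a i]])) (st := fun i => st (a i)) F.time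
      (fun i m v => v.1.length + m.length = (l i).length ∧ v.2 = v.1.permutations'Aux (a i))
      (hl.reverse hlen.toAllows) (Computes.nil.cons ((ha.cons .nil).cons .nil)) ?_
      (fun i _ => ⟨by simp, rfl⟩) ?_ ?_
    · set F' := ((F.setTime F.time).ext fun _ (_ : α) => True).ext fun x v => ∃ m,
        (v : List α × List (List α)).1.length + (x.2 :: m).length = (l x.1).length ∧
          v.2 = v.1.permutations'Aux (a x.1)
      have v : Computes F' (push (push Γ e) (encPair (encList e) (encList (encList e))))
          fun x => encPair (encList e) (encList (encList e)) x.2 := Computes.var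
      have y : Computes F' (push (push Γ e) (encPair (encList e) (encList (encList e))))
          fun x => e x.1.2 := Computes.var₂
      refine (Computes.lcons (e := e) y v.pairFst).pairMk (eb := encList (encList e))
        (Computes.lcons (e := encList e) (Computes.lcons (e := e) (Computes.lift (Computes.lift ha))
          (Computes.lcons (e := e) y v.pairFst)) (Computes.map (eb := encList e)
            (h := fun x z => x.1.2 :: z) v.pairSnd
            (Computes.lcons (e := e) y.lift Computes.var) ?_))
      refine ((hlen.setTime (T := F.time)).lift (Q := fun _ (_ : α) => True)).lift.of_le ?_
      rintro x ⟨-, m, h1, h2⟩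
      rw [List.length_cons] at h1
      rw [h2, List.length_permutations'Aux]
      omega
    · rintro i y m v - ⟨h1, h2⟩
      refine ⟨by simp only [st, List.length_cons] at h1 ⊢; omega, ?_⟩
      simp only [st, h2, List.permutations'Aux]
    · simpa using hlen.allows
  refine h.pairSnd.congr fun i _ => ?_
  have key : ∀ m : List α, m.reverse.foldl (st (a i)) ([], [[a i]]) =
      (m, m.permutations'Aux (a i)) := by
    intro m
    induction m with
    | nil => rfl
    | cons y m ih => rw [List.reverse_cons, List.foldl_append, ih]; rfl
  rw [key]

theorem Computes.permutations {e : α → Data} {l : ι → List α}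
    (hl : Computes (F.setTime fun _ => 0) Γ fun i => encList e (l i))
    (hlen : F.PolyBdd fun i => (l i).length) :
    Computes (F.setTime fun i => (l i).length.factorial) Γ
      fun i => encList (encList e) (l i).permutations' := by
  have key : ∀ m : List α, m.reverse.foldl
      (fun L a => L.flatMap (List.permutations'Aux a)) [[]] = m.permutations' := by
    intro m
    induction m with
    | nil => rfl
    | cons y m ih => rw [List.reverse_cons, List.foldl_append, ih]; rfl
  refine (Computes.foldlTime (l := fun i => (l i).reverse) (eb := encList (encList e))
    (b := fun _ => [[]])
    (st := fun _ L a => L.flatMap (List.permutations'Aux a)) (fun i => (l i).length.factorial)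
    (fun i m L => ∃ k, k.length + m.length = (l i).length ∧ L = List.permutations' k)
    (hl.slow.reverse hlen.setTime.toAllows) (.const (.cons .nil .nil)) ?_
    (fun i _ => ⟨[], by simp, rfl⟩) ?_ ?_).congr fun i _ => by rw [key]
  · set F' := (((F.setTime fun i => (l i).length.factorial).setTime
      fun i => (l i).length.factorial).ext fun _ (_ : α) => True).ext fun x L => ∃ m,
        ∃ k : List α, k.length + (x.2 :: m).length = (l x.1).length ∧ L = List.permutations' k
    have hb : ((F'.setTime fun _ => 0).ext fun x v => v ∈ x.2).PolyBdd fun x => x.2.length := by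
      refine (hlen.reindex (F' := (F'.setTime fun _ => 0).ext fun x v => v ∈ x.2)
        (fun x => x.1.1.1) (fun x hx => hx.1.1.1) fun _ _ => rfl).of_le ?_
      rintro x ⟨⟨-, m, k, hk, hL⟩, hx⟩
      rw [hL, List.mem_permutations'] at hx
      rw [hx.length_eq]
      omega
    refine Computes.flatMapTime (ea := encList e) (eb := encList e) (F := F')
      (h := fun x => List.permutations'Aux x.1.2) (fun _ => 0) Computes.top ?_ ?_ ?_
    · exact Computes.permutationsAux (F := (F'.setTime fun _ => 0).ext fun x v => v ∈ x.2)
        (Computes.lift (F := F'.setTime fun _ => 0) Computes.var₂) Computes.var hb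
    · simpa using (hb.add (.const 1)).toAllows
    · refine ⟨2, ?_⟩
      rintro x ⟨-, m, k, hk, hL⟩
      change _ ≤ ((l x.1.1).length.factorial + 1) * _
      simp only [Polynomial.eval_ofNat]
      rw [hL, length_permutations']
      have := Nat.factorial_le (show k.length ≤ (l x.1.1).length by omega)
      omega
  · rintro i a m L - ⟨k, h1, rfl⟩
    exact ⟨a :: k, by simp only [List.length_cons] at h1 ⊢; omega, rfl⟩
  · simp only [List.length_reverse]
    exact hlen.setTime.allows

end

/-! ### Tables of keys -/

/-- The possible keys of steps: even numbers. -/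
def stepKeys (r : ℕ) : List ℕ := (List.range (r + 1)).map fun k => 2 * k

/-- The possible keys of release points: odd numbers. -/
def releaseKeys (r : ℕ) : List ℕ := (List.range r).map fun k => 2 * k + 1

section
variable {s r : ℕ}

theorem getD_mem {l : List ℕ} {k : ℕ} (hk : k < l.length) : l.getD k 0 ∈ l := by
  rw [List.getD_eq_getElem _ _ hk]; exact List.getElem_mem hk

/-- Two activities with the same key are equal or are both steps, as `blocks_eq_of_sorted`
requires. -/
theorem keys_separate {g K : List ℕ} (hg : g ∈ vectors (stepKeys r) s)
    (hK : K ∈ (releaseKeys r).permutations') (v w : Activity s r)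
    (h : keyOf (g, K) (rawActivity v) = keyOf (g, K) (rawActivity w)) :
    v = w ∨ v.isLeft = true ∧ w.isLeft = true := by
  rw [mem_vectors] at hg
  rw [List.mem_permutations'] at hK
  have hKl : K.length = r := by rw [hK.length_eq]; simp [releaseKeys]
  have hKn : K.Nodup := hK.nodup_iff.2 (List.Nodup.map (fun a b h => by
    omega) List.nodup_range)
  have heven : ∀ x : Fin s, ∃ k, g.getD x 0 = 2 * k := fun x => by
    obtain ⟨k, -, hk⟩ := List.mem_map.1 (hg.2 _ (getD_mem (k := x) (by rw [hg.1]; exact x.2)))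
    exact ⟨k, hk.symm⟩
  have hodd : ∀ x : Fin r, ∃ k, K.getD x 0 = 2 * k + 1 := fun x => by
    obtain ⟨k, -, hk⟩ := List.mem_map.1
      (hK.mem_iff.1 (getD_mem (k := x) (by rw [hKl]; exact x.2)))
    exact ⟨k, hk.symm⟩
  rcases v with x | x <;> rcases w with y | y
  · exact .inr ⟨rfl, rfl⟩
  · obtain ⟨a, ha⟩ := heven x
    obtain ⟨b, hb⟩ := hodd y
    simp only [keyOf, rawActivity, Bool.false_eq_true, if_false, if_true] at h
    omega
  · obtain ⟨a, ha⟩ := heven y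
    obtain ⟨b, hb⟩ := hodd x
    simp only [keyOf, rawActivity, Bool.false_eq_true, if_false, if_true] at h
    omega
  · simp only [keyOf, rawActivity, if_true] at h
    rw [List.getD_eq_getElem _ _ (by rw [hKl]; exact x.2),
      List.getD_eq_getElem _ _ (by rw [hKl]; exact y.2), hKn.getElem_inj_iff] at h
    exact .inl (congrArg _ (Fin.ext h))

theorem keys_le {g K : List ℕ} (hg : g ∈ vectors (stepKeys r) s)
    (hK : K ∈ (releaseKeys r).permutations') : ∀ k ∈ g ++ K, k ≤ 2 * r := by
  rw [mem_vectors] at hg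
  rw [List.mem_permutations'] at hK
  intro k hk
  rcases List.mem_append.1 hk with hk | hk
  · obtain ⟨j, hj, rfl⟩ := List.mem_map.1 (hg.2 k hk)
    have := List.mem_range.1 hj
    omega
  · obtain ⟨j, hj, rfl⟩ := List.mem_map.1 (hK.mem_iff.1 hk)
    have := List.mem_range.1 hj
    omega

/-- For every sequence without repetitions, the enumerated tables contain one that sorts it. -/
theorem exists_tables {τ : List (Activity s r)} (hτ : τ.Nodup) :
    ∃ K ∈ (releaseKeys r).permutations', ∃ g ∈ vectors (stepKeys r) s,
      KeySorted (g, K) (τ.map rawActivity) := by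
  obtain ⟨e, g, hg, h⟩ := exists_keys hτ
  refine ⟨List.ofFn fun i => 2 * (e i : ℕ) + 1, ?_, List.ofFn fun x => 2 * g x, ?_, ?_⟩
  · rw [List.mem_permutations']
    refine (Equiv.Perm.ofFn_comp_perm e fun i => 2 * (i : ℕ) + 1).trans (List.Perm.of_eq ?_)
    apply List.ext_getElem <;> simp [releaseKeys]
  · rw [mem_vectors]
    refine ⟨by simp, fun a ha => ?_⟩
    obtain ⟨x, rfl⟩ := List.mem_ofFn.1 ha
    exact List.mem_map.2 ⟨g x, List.mem_range.2 (hg x), rfl⟩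
  · rw [KeySorted, List.pairwise_map]
    refine h.imp fun {v w} h => ?_
    have key : ∀ v : Activity s r, keyOf (List.ofFn fun x => 2 * g x,
        List.ofFn fun i => 2 * (e i : ℕ) + 1) (rawActivity v) =
          v.elim (fun x => 2 * g x) fun i => 2 * (e i : ℕ) + 1 := by
      rintro (x | i) <;> simp [keyOf, rawActivity, List.getD_eq_getElem?_getD]
    simpa [keyLe, key] using h

end

section
variable {ι : Type} {F : Frame ι} {Γ : ι → Data} {r : ι → ℕ}

theorem Computes.stepKeys (hr : Computes F Γ fun i => encUnary (r i)) (hb : F.PolyBdd r) :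
    Computes F Γ fun i => encList encUnary (stepKeys (r i)) :=
  hr.succ.tab (hb.add (.const 1)) (Computes.double Computes.top
    ((hb.add (.const 1)).lift.of_le fun _ hx => hx.2.le))

theorem Computes.releaseKeys (hr : Computes F Γ fun i => encUnary (r i)) (hb : F.PolyBdd r) :
    Computes F Γ fun i => encList encUnary (releaseKeys (r i)) :=
  hr.tab hb (Computes.double Computes.top (hb.lift.of_le fun _ hx => hx.2.le)).succ

end

/-! ### Serial assignment -/

/-- If every block of `B` is assigned to a different user in `V`, then some reassignment of at most
the same total weight gives some block the user that it would pick from `V`. -/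
theorem exists_reassignment {U : Type} [DecidableEq U] (ω : U → U → ℕ) (fav : U → U)
    {B V : Finset U} (hB : B.Nonempty) (hfav : ∀ b ∈ B, fav b ∈ V ∧ ∀ v ∈ V, ω b (fav b) ≤ ω b v)
    (A : U → U) (hA : Set.InjOn A B) (hAV : ∀ b ∈ B, A b ∈ V) :
    ∃ b₀ ∈ B, ∃ A' : U → U, Set.InjOn A' B ∧ (∀ b ∈ B, A' b ∈ V) ∧
      ∑ b ∈ B, ω b (A' b) ≤ ∑ b ∈ B, ω b (A b) ∧ A' b₀ = fav b₀ := by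
  by_cases h : ∃ b₀ ∈ B, ∀ b ∈ B, b ≠ b₀ → A b ≠ fav b₀
  · -- the favourite user of some block is not taken by another block
    obtain ⟨b₀, hb₀, h⟩ := h
    refine ⟨b₀, hb₀, Function.update A b₀ (fav b₀), ?_, ?_, ?_, Function.update_self ..⟩
    · intro b hb b' hb' he
      by_cases h1 : b = b₀ <;> by_cases h2 : b' = b₀
      · rw [h1, h2]
      · subst h1
        rw [Function.update_self, Function.update_of_ne h2] at he
        exact absurd he.symm (h b' hb' h2)
      · subst h2
        rw [Function.update_self, Function.update_of_ne h1] at he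
        exact absurd he (h b hb h1)
      · rw [Function.update_of_ne h1, Function.update_of_ne h2] at he
        exact hA hb hb' he
    · intro b hb
      by_cases h1 : b = b₀
      · subst h1
        rw [Function.update_self]
        exact (hfav _ hb).1
      · rw [Function.update_of_ne h1]
        exact hAV b hb
    · refine Finset.sum_le_sum fun b hb => ?_
      by_cases h1 : b = b₀
      · subst h1
        rw [Function.update_self]
        exact (hfav _ hb).2 _ (hAV _ hb)
      · rw [Function.update_of_ne h1]
  · -- otherwise rotate along the cycles of the map from a block to the holder of its favourite user
    push Not at h
    choose! p hpB _ hp using h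
    let P : B → B := fun b => ⟨p b, hpB b b.2⟩
    obtain ⟨b₁, hb₁⟩ := hB
    obtain ⟨m, n, hmn, he⟩ := Finite.exists_ne_map_eq_of_infinite fun n : ℕ => P^[n] ⟨b₁, hb₁⟩
    have hper : ∃ c : B, c ∈ Function.periodicPts P := by
      have aux : ∀ m n, m < n → P^[m] ⟨b₁, hb₁⟩ = P^[n] ⟨b₁, hb₁⟩ →
          ∃ c : B, c ∈ Function.periodicPts P := by
        intro m n hmn he
        refine ⟨P^[m] ⟨b₁, hb₁⟩, Function.mem_periodicPts.2 ⟨n - m, by omega, ?_⟩⟩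
        rw [Function.IsPeriodicPt, Function.IsFixedPt, ← Function.iterate_add_apply,
          Nat.sub_add_cancel hmn.le, he]
      rcases lt_or_gt_of_ne hmn with h | h
      · exact aux m n h he
      · exact aux n m h he.symm
    obtain ⟨c, hc⟩ := hper
    classical
    let C : U → Prop := fun b => ∃ hb : b ∈ B, (⟨b, hb⟩ : B) ∈ Function.periodicPts P
    have hbij := Function.bijOn_periodicPts P
    have hCp : ∀ b, C b → C (p b) := fun b ⟨hb, h⟩ => ⟨hpB b hb, hbij.mapsTo h⟩
    refine ⟨c, c.2, fun b => if C b then fav b else A b, ?_, ?_, ?_, if_pos ⟨c.2, hc⟩⟩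
    · intro b hb b' hb' he
      simp only at he
      have hb : b ∈ B := hb
      have hb' : b' ∈ B := hb'
      split at he <;> split at he
      · rename_i h1 h2
        rw [← hp b hb, ← hp b' hb'] at he
        have h3 := hA (hpB b hb) (hpB b' hb') he
        have h4 := hbij.injOn h1.2 h2.2 (Subtype.ext h3)
        exact congrArg Subtype.val h4
      · rename_i h1 h2
        rw [← hp b hb] at he
        exact absurd (hA (hpB b hb) hb' he ▸ hCp b h1) h2
      · rename_i h1 h2
        rw [← hp b' hb'] at he
        exact absurd (hA (hpB b' hb') hb he.symm ▸ hCp b' h2) h1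
      · exact hA hb hb' he
    · intro b hb
      simp only
      split
      · exact (hfav b hb).1
      · exact hAV b hb
    · refine Finset.sum_le_sum fun b hb => ?_
      simp only
      split
      · exact (hfav b hb).2 _ (hAV b hb)
      · exact le_rfl

/-- An optimal assignment of blocks to different users can be obtained by letting the blocks, in a
suitable order, pick their best user among those that are left. -/
theorem exists_serial_order {U : Type} [DecidableEq U] (ω : U → U → ℕ) (pick : U → Finset U → U)
    (hpick : ∀ b V, V.Nonempty → pick b V ∈ V ∧ ∀ v ∈ V, ω b (pick b V) ≤ ω b v)
    (B V : Finset U) (A : U → U) (hA : Set.InjOn A B) (hAV : ∀ b ∈ B, A b ∈ V) :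
    ∃ (L : List U) (A' : U → U), L.Nodup ∧ L.toFinset = B ∧ Set.InjOn A' B ∧
      (∀ b ∈ B, A' b ∈ V) ∧ ∑ b ∈ B, ω b (A' b) ≤ ∑ b ∈ B, ω b (A b) ∧
      ∀ j (hj : j < L.length), A' L[j] = pick L[j] (V \ (L.take j).toFinset.image A') := by
  induction h : B.card generalizing B V A with
  | zero =>
    obtain rfl := Finset.card_eq_zero.1 h
    exact ⟨[], A, by simp⟩
  | succ n ih =>
    have hB : B.Nonempty := Finset.card_pos.1 (by omega)
    obtain ⟨b₀, hb₀, A₁, hA₁, hA₁V, hsum, hfav⟩ := exists_reassignment ω (fun b => pick b V) hB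
      (fun b hb => hpick b V ⟨_, hAV b hb⟩) A hA hAV
    obtain ⟨L, A₂, hL, hLB, hA₂, hA₂V, hsum₂, hser⟩ := ih (B.erase b₀) (V.erase (pick b₀ V)) A₁
      (hA₁.mono (by simp)) (fun b hb => by
        have hb' := Finset.mem_erase.1 hb
        refine Finset.mem_erase.2 ⟨fun he => hb'.1 (hA₁ hb'.2 hb₀ ?_), hA₁V b hb'.2⟩
        rw [he, hfav]) (by rw [Finset.card_erase_of_mem hb₀, h]; rfl)
    have hbL : b₀ ∉ L := fun hb => by
      rw [← List.mem_toFinset, hLB] at hb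
      simp at hb
    have hne : ∀ b ∈ L, Function.update A₂ b₀ (pick b₀ V) b = A₂ b := fun b hb =>
      Function.update_of_ne (fun he => hbL (by rwa [← he])) _ _
    have hne' : ∀ b ∈ B.erase b₀, Function.update A₂ b₀ (pick b₀ V) b = A₂ b := fun b hb =>
      Function.update_of_ne (Finset.mem_erase.1 hb).1 _ _
    refine ⟨b₀ :: L, Function.update A₂ b₀ (pick b₀ V), List.nodup_cons.2 ⟨hbL, hL⟩, ?_, ?_, ?_,
      ?_, ?_⟩
    · rw [List.toFinset_cons, hLB, Finset.insert_erase hb₀]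
    · rw [← Finset.insert_erase hb₀, Finset.coe_insert, Set.injOn_insert (by simp)]
      refine ⟨hA₂.congr fun b hb => (hne' b hb).symm, ?_⟩
      rintro ⟨b, hb, he⟩
      rw [hne' b hb, Function.update_self] at he
      exact (Finset.mem_erase.1 (hA₂V b hb)).1 he
    · intro b hb
      by_cases hbb : b = b₀
      · subst hbb
        rw [Function.update_self, ← hfav]
        exact hA₁V _ hb₀
      · rw [Function.update_of_ne hbb]
        exact (Finset.mem_erase.1 (hA₂V b (Finset.mem_erase.2 ⟨hbb, hb⟩))).2
    · refine le_trans ?_ hsum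
      rw [← Finset.add_sum_erase _ _ hb₀, ← Finset.add_sum_erase B (fun b => ω b (A₁ b)) hb₀,
        Function.update_self, hfav]
      refine Nat.add_le_add_left (le_trans (le_of_eq ?_) hsum₂) _
      exact Finset.sum_congr rfl fun b hb => by rw [hne' b hb]
    · rintro (_ | j) hj
      · simp
      · have hj' : j < L.length := by simpa using hj
        simp only [List.getElem_cons_succ, List.take_succ_cons, List.toFinset_cons,
          Finset.image_insert, Function.update_self]
        rw [hne _ (List.getElem_mem hj'), hser j hj']
        congr 1
        rw [Finset.sdiff_insert, Finset.erase_sdiff_comm]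
        congr 2
        refine Finset.image_congr fun b hb => (hne b ?_).symm
        exact List.mem_of_mem_take (List.mem_toFinset.1 hb)

/-! ### Plans as vectors -/

/-- The characteristic vector of a set. -/
def vec {n : ℕ} (D : Finset (Fin n)) : List Bool := List.ofFn fun x => decide (x ∈ D)

/-- The set with a given characteristic vector. -/
def unvec (n : ℕ) (l : List Bool) : Finset (Fin n) :=
  Finset.univ.filter fun x => l.getD x false = true

theorem unvec_vec {n : ℕ} (D : Finset (Fin n)) : unvec n (vec D) = D := by
  ext x
  simp [unvec, vec, List.getD_eq_getElem?_getD]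

/-- The entry of a plan: zero for steps outside of the domain, and otherwise the successor of the
user. -/
def planEntry {u : ℕ} : Option (Fin u) → ℕ
  | none => 0
  | some a => a + 1

/-- The list of the entries of a plan. -/
def planVec {s u : ℕ} (π : Plan s u) : List ℕ := List.ofFn fun x => planEntry (π x)

/-- The plan with given entries. -/
def unplan (s u : ℕ) (l : List ℕ) : Plan s u := fun x =>
  if h : l.getD x 0 - 1 < u then if l.getD x 0 = 0 then none else some ⟨l.getD x 0 - 1, h⟩ else none

theorem getD_planVec {s u : ℕ} (π : Plan s u) (x : Fin s) :
    (planVec π).getD x 0 = planEntry (π x) := by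
  simp [planVec, List.getD_eq_getElem?_getD]

theorem unplan_planVec {s u : ℕ} (π : Plan s u) : unplan s u (planVec π) = π := by
  funext x
  unfold unplan
  simp only [getD_planVec]
  obtain h | ⟨a, h⟩ := Option.eq_none_or_eq_some (π x) <;> simp [planEntry, h]

theorem encPlan_eq {s u : ℕ} (π : Plan s u) : encPlan π = encList encUnary (planVec π) := by
  have key : ∀ {α β : Type} (e : β → Data) (h : α → β) (l : List α),
      encList (fun a => e (h a)) l = encList e (l.map h) := by
    intro α β e h l
    induction l with
    | nil => rfl
    | cons a l ih => rw [encList, ih]; rfl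
  have h : encPlan π = encList (fun o => encUnary (planEntry o)) (List.ofFn π) := by
    unfold encPlan
    congr 1
    funext o
    cases o <;> rfl
  rw [h, key, planVec, List.map_ofFn]
  rfl

theorem encFinset_eq {n : ℕ} (D : Finset (Fin n)) : encFinset D = encList encBool (vec D) := rfl

/-- The characteristic vector of the set of steps with user `a`. -/
def fiberVec (π : List ℕ) (a : ℕ) : List Bool := π.map fun y => decide (y = a + 1)

theorem fiberVec_planVec {s u : ℕ} (π : Plan s u) (a : Fin u) :
    fiberVec (planVec π) a = vec (π.fiber a) := by
  unfold fiberVec planVec vec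
  rw [List.map_ofFn]
  congr 1
  funext x
  simp only [Function.comp, Plan.fiber, Finset.mem_filter, Finset.mem_univ, true_and]
  obtain h | ⟨b, h⟩ := Option.eq_none_or_eq_some (π x) <;> simp [planEntry, h, Fin.ext_iff]

theorem any_vec {n : ℕ} (D : Finset (Fin n)) : (vec D).any (fun b => b) = true ↔ D.Nonempty := by
  simp only [vec, List.any_eq_true, List.mem_ofFn, exists_eq_right]
  constructor
  · rintro ⟨x, hx⟩
    exact ⟨x, by simpa using hx⟩
  · rintro ⟨x, hx⟩
    exact ⟨x, by simpa using hx⟩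

/-! ### Greedy assignment of the colours of a colouring -/

/-- One step of the search for the best free user: the best one so far, with its weight, is replaced
if the user `a` is free and has a smaller weight `w a`. -/
def pickStep (w : ℕ → List Bool) (free : ℕ → Bool) (best : Option (ℕ × List Bool)) (a : ℕ) :
    Option (ℕ × List Bool) :=
  if free a then
    if best.isNone || !leBits (best.getD (0, [])).2 (w a) then some (a, w a) else best
  else best

/-- A free user with the smallest weight, together with its weight. -/
def pickUser (u : ℕ) (w : ℕ → List Bool) (free : ℕ → Bool) : Option (ℕ × List Bool) :=
  (List.range u).foldl (pickStep w free) none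

theorem pickUser_spec (u : ℕ) (w : ℕ → List Bool) (free : ℕ → Bool) :
    (∀ b, pickUser u w free = some b → b.1 < u ∧ free b.1 = true ∧ b.2 = w b.1 ∧
      ∀ a < u, free a = true → bitsVal (w b.1) ≤ bitsVal (w a)) ∧
    (pickUser u w free = none → ∀ a < u, free a = false) := by
  unfold pickUser
  induction u with
  | zero => simp
  | succ u ih =>
    rw [List.range_succ, List.foldl_append, List.foldl_cons, List.foldl_nil]
    generalize (List.range u).foldl (pickStep w free) none = best at ih ⊢
    obtain ⟨ih1, ih2⟩ := ih
    unfold pickStep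
    by_cases hf : free u = true
    · rw [if_pos hf]
      cases best with
      | none =>
        have := ih2 rfl
        simp only [Option.isNone_none, Bool.true_or, if_true]
        refine ⟨?_, by simp⟩
        rintro b hb
        obtain rfl : (u, w u) = b := by simpa using hb
        refine ⟨Nat.lt_succ_self u, hf, rfl, fun a ha hfa => ?_⟩
        rcases Nat.lt_succ_iff_lt_or_eq.1 ha with h | rfl
        · rw [this a h] at hfa; cases hfa
        · exact le_rfl
      | some c =>
        obtain ⟨h1, h2, h3, h4⟩ := ih1 c rfl
        simp only [Option.isNone_some, Bool.false_or, Option.getD_some]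
        cases hle : leBits c.2 (w u)
        · have hlt : bitsVal (w u) < bitsVal (w c.1) := by
            rw [← h3]
            exact not_le.1 fun h => by rw [(leBits_iff _ _).2 h] at hle; cases hle
          refine ⟨?_, by simp⟩
          rintro b hb
          obtain rfl : (u, w u) = b := by simpa using hb
          refine ⟨Nat.lt_succ_self u, hf, rfl, fun a ha hfa => ?_⟩
          rcases Nat.lt_succ_iff_lt_or_eq.1 ha with h | rfl
          · exact hlt.le.trans (h4 a h hfa)
          · exact le_rfl
        · have hle' := (leBits_iff _ _).1 hle
          refine ⟨?_, by simp⟩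
          rintro b hb
          obtain rfl : c = b := by simpa using hb
          refine ⟨h1.trans (Nat.lt_succ_self u), h2, h3, fun a ha hfa => ?_⟩
          rcases Nat.lt_succ_iff_lt_or_eq.1 ha with h | rfl
          · exact h4 a h hfa
          · rw [← h3]; exact hle'
    · rw [if_neg hf]
      refine ⟨fun b hb => ?_, fun h a ha => ?_⟩
      · obtain ⟨h1, h2, h3, h4⟩ := ih1 b hb
        refine ⟨h1.trans (Nat.lt_succ_self u), h2, h3, fun a ha hfa => ?_⟩
        rcases Nat.lt_succ_iff_lt_or_eq.1 ha with h | rfl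
        · exact h4 a h hfa
        · exact absurd hfa hf
      · rcases Nat.lt_succ_iff_lt_or_eq.1 ha with h' | rfl
        · exact ih2 h a h'
        · simpa using hf

theorem pickUser_congr {u : ℕ} {w : ℕ → List Bool} {free free' : ℕ → Bool}
    (h : ∀ a < u, free a = free' a) : pickUser u w free = pickUser u w free' := by
  unfold pickUser
  induction u with
  | zero => rfl
  | succ u ih =>
    rw [List.range_succ, List.foldl_append, List.foldl_append,
      ih fun a ha => h a (ha.trans (Nat.lt_succ_self u))]
    simp only [List.foldl_cons, List.foldl_nil, pickStep, h u (Nat.lt_succ_self u)]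

/-- Assignment of the best free user to all steps with colour `j` in the colouring `f`, whose
entries are zero for absent steps and otherwise the successor of the colour. -/
def greedyStep (s u : ℕ) (w : List Bool → ℕ → List Bool) (f : List ℕ) (π : List ℕ) (j : ℕ) :
    List ℕ :=
  (List.range s).map fun x =>
    if decide (f.getD x 0 = j + 1) &&
      (pickUser u (w (fiberVec f j)) fun a => !(fiberVec π a).any fun b => b).isSome
    then
      ((pickUser u (w (fiberVec f j)) fun a => !(fiberVec π a).any fun b => b).getD (0, [])).1 + 1
    else π.getD x 0

/-- The plan that results if the colours pick their users one after the other. -/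
def greedyPlan (s u : ℕ) (w : List Bool → ℕ → List Bool) (f : List ℕ) : List ℕ :=
  (List.range s).foldl (greedyStep s u w f) ((List.range s).map fun _ => 0)

theorem range_map_eq_ofFn {α : Type} (n : ℕ) (h : ℕ → α) :
    (List.range n).map h = List.ofFn fun x : Fin n => h x := by
  apply List.ext_getElem <;> simp

theorem exists_planVec_greedyStep {s u : ℕ} (w : List Bool → ℕ → List Bool) (f : List ℕ)
    (π : Plan s u) (j : ℕ) : ∃ ρ : Plan s u, greedyStep s u w f (planVec π) j = planVec ρ := by
  unfold greedyStep
  cases h : pickUser u (w (fiberVec f j)) fun a => !(fiberVec (planVec π) a).any fun b => b with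
  | none =>
    refine ⟨π, ?_⟩
    rw [range_map_eq_ofFn]
    simp only [Option.isSome_none, Bool.and_false, Bool.false_eq_true, if_false, getD_planVec]
    rfl
  | some b =>
    obtain ⟨h1, -⟩ := (pickUser_spec _ _ _).1 b h
    refine ⟨fun x => if f.getD x 0 = j + 1 then some ⟨b.1, h1⟩ else π x, ?_⟩
    rw [range_map_eq_ofFn]
    unfold planVec
    congr 1
    funext x
    simp only [Option.isSome_some, Bool.and_true, decide_eq_true_eq, Option.getD_some]
    split
    · rfl
    · exact getD_planVec π x

theorem zero_eq_planVec (s u : ℕ) :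
    ((List.range s).map fun _ => 0) = planVec (fun _ => none : Plan s u) := by
  rw [range_map_eq_ofFn]; rfl

theorem exists_planVec_greedyPlan (s u : ℕ) (w : List Bool → ℕ → List Bool) (f : List ℕ) :
    ∃ ρ : Plan s u, greedyPlan s u w f = planVec ρ := by
  unfold greedyPlan
  rw [zero_eq_planVec s u]
  generalize (fun _ => none : Plan s u) = π
  generalize List.range s = l
  induction l generalizing π with
  | nil => exact ⟨π, rfl⟩
  | cons j l ih =>
    obtain ⟨ρ, hρ⟩ := exists_planVec_greedyStep w f π j
    rw [List.foldl_cons, hρ]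
    exact ih ρ

/-- For every plan there is a colouring from which the greedy assignment leads to a plan with the
same sets of steps that are executed by the same user, and at most the same authorization
weight. -/
theorem exists_greedyPlan_eq {s u : ℕ} (ω : Finset (Fin s) → Fin u → ℕ) (hω : ∀ a, ω ∅ a = 0)
    (w : List Bool → ℕ → List Bool) (hw : ∀ D (a : Fin u), bitsVal (w (vec D) a) = ω D a)
    (π : Plan s u) :
    ∃ (f : Fin s → ℕ) (φ : Equiv.Perm (Fin u)), (∀ x, f x < s) ∧
      greedyPlan s u w (List.ofFn fun x => if (π x).isSome then f x + 1 else 0) =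
        planVec (π.permute φ) ∧
      ∑ a, ω ((π.permute φ).fiber a) a ≤ ∑ a, ω (π.fiber a) a := by
  classical
  let B : Finset (Fin u) := Finset.univ.filter fun a => (π.fiber a).Nonempty
  have hmemB : ∀ x a, π x = some a → a ∈ B := fun x a h =>
    Finset.mem_filter.2 ⟨Finset.mem_univ _, x, by simp [Plan.fiber, h]⟩
  let W : Fin u → ℕ → List Bool := fun b => w (vec (π.fiber b))
  let res : Fin u → Finset (Fin u) → Option (ℕ × List Bool) := fun b V =>
    pickUser u (W b) fun a => decide (∃ h : a < u, (⟨a, h⟩ : Fin u) ∈ V)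
  let pick : Fin u → Finset (Fin u) → Fin u := fun b V =>
    if h : ((res b V).getD (0, [])).1 < u then ⟨_, h⟩ else b
  have hres : ∀ b (V : Finset (Fin u)), V.Nonempty → ∃ c, res b V = some c ∧
      (pick b V : ℕ) = c.1 ∧ pick b V ∈ V ∧
        ∀ v ∈ V, ω (π.fiber b) (pick b V) ≤ ω (π.fiber b) v := by
    rintro b V ⟨v₀, hv₀⟩
    obtain ⟨h1, h2⟩ := pickUser_spec u (W b) fun a => decide (∃ h : a < u, (⟨a, h⟩ : Fin u) ∈ V)
    cases hr : res b V with
    | none =>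
      have := h2 hr v₀ v₀.2
      simp [hv₀] at this
    | some c =>
      obtain ⟨h3, h4, h5, h6⟩ := h1 c hr
      have hp : pick b V = ⟨c.1, h3⟩ := by
        simp only [pick, hr, Option.getD_some, h3, dif_pos]
      refine ⟨c, rfl, by rw [hp], ?_, fun v hv => ?_⟩
      · rw [hp]
        obtain ⟨_, h⟩ := of_decide_eq_true h4
        exact h
      · rw [hp, ← hw, ← hw]
        exact h6 v v.2 (by simpa using hv)
  obtain ⟨L, A, hL, hLB, hAB, -, hsum, hser⟩ := exists_serial_order (fun b => ω (π.fiber b)) pick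
    (fun b V hV => by
      obtain ⟨c, -, -, h1, h2⟩ := hres b V hV
      exact ⟨h1, h2⟩) B Finset.univ id (Set.injOn_id _) (fun _ _ => Finset.mem_univ _)
  obtain ⟨φ, hφ⟩ := Equiv.Perm.exists_extending_pair (fun b : B => b.1) (fun b => A b)
    Subtype.val_injective hAB.injective
  have hφB : ∀ b ∈ B, φ b = A b := fun b hb => hφ ⟨b, hb⟩
  have hmemL : ∀ x a, π x = some a → a ∈ L := fun x a h =>
    List.mem_toFinset.1 (hLB ▸ hmemB x a h)
  have hlen : L.length ≤ s := by
    rw [← List.toFinset_card_of_nodup hL, hLB]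
    have hex : ∀ b : B, ∃ x, π x = some b.1 := fun b => by
      obtain ⟨x, hx⟩ := (Finset.mem_filter.1 b.2).2
      exact ⟨x, (Finset.mem_filter.1 hx).2⟩
    choose g hg using hex
    have hinj : Function.Injective g := fun b c h => Subtype.ext
      (Option.some_injective _ ((hg b).symm.trans (by rw [h, hg])))
    simpa using Fintype.card_le_of_injective g hinj
  let f : Fin s → ℕ := fun x => (π x).elim 0 L.idxOf
  have hf : ∀ x, f x < s := fun x => by
    cases h : π x with
    | none => simp only [f, h, Option.elim_none]; exact x.pos
    | some a =>
      simp only [f, h, Option.elim_some]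
      exact (List.idxOf_lt_length_of_mem (hmemL x a h)).trans_le hlen
  refine ⟨f, φ, hf, ?_, ?_⟩
  · set F : List ℕ := List.ofFn fun x => if (π x).isSome then f x + 1 else 0 with hF
    have hFD : ∀ x : Fin s, F.getD x 0 = if (π x).isSome then f x + 1 else 0 := fun x => by
      simp [F, List.getD_eq_getElem?_getD]
    have hcol : ∀ j (hj : j < L.length) (x : Fin s), F.getD x 0 = j + 1 ↔ π x = some L[j] := by
      intro j hj x
      rw [hFD]
      cases h : π x with
      | none => simp
      | some a =>
        simp only [Option.isSome_some, if_true, f, h, Option.elim_some, Nat.add_right_cancel_iff,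
          Option.some.injEq]
        constructor
        · rintro rfl
          simp
        · rintro rfl
          exact hL.idxOf_getElem j hj
    have hbig : ∀ j, L.length ≤ j → ∀ x : Fin s, F.getD x 0 ≠ j + 1 := by
      intro j hj x
      rw [hFD]
      cases h : π x with
      | none => simp
      | some a =>
        simp only [Option.isSome_some, if_true, f, h, Option.elim_some]
        have := List.idxOf_lt_length_of_mem (hmemL x a h)
        omega
    -- the plan after the first colours have picked
    let ρ : ℕ → Plan s u := fun j x =>
      (π x).bind fun a => if a ∈ L.take j then some (φ a) else none
    have hρfib : ∀ j (a : Fin u), ((ρ j).fiber a).Nonempty ↔ a ∈ (L.take j).toFinset.image A := by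
      intro j a
      rw [Finset.mem_image]
      constructor
      · rintro ⟨x, hx⟩
        have hx := (Finset.mem_filter.1 hx).2
        obtain ⟨b, hb, h⟩ := Option.bind_eq_some_iff.1 hx
        split at h
        · rename_i hbL
          refine ⟨b, List.mem_toFinset.2 hbL, ?_⟩
          rw [← hφB b (hmemB x b hb)]
          exact Option.some_injective _ h
        · cases h
      · rintro ⟨b, hb, rfl⟩
        have hb := List.mem_toFinset.1 hb
        have hbB : b ∈ B := hLB ▸ List.mem_toFinset.2 (List.mem_of_mem_take hb)
        obtain ⟨x, hx⟩ := (Finset.mem_filter.1 hbB).2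
        have hx := (Finset.mem_filter.1 hx).2
        refine ⟨x, Finset.mem_filter.2 ⟨Finset.mem_univ _, ?_⟩⟩
        simp only [ρ, hx, Option.bind_some, if_pos hb, hφB b hbB]
    have hstep : ∀ j, greedyStep s u w F (planVec (ρ j)) j = planVec (ρ (j + 1)) := by
      intro j
      unfold greedyStep
      rw [range_map_eq_ofFn]
      unfold planVec
      congr 1
      funext x
      by_cases hj : j < L.length
      · have hvec : fiberVec F j = vec (π.fiber L[j]) := by
          unfold fiberVec vec
          rw [hF, List.map_ofFn]
          congr 1
          funext x
          have := hcol j hj x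
          rw [hFD] at this
          simp only [Function.comp, Plan.fiber, Finset.mem_filter, Finset.mem_univ, true_and, this]
        have hLB' : L[j] ∈ B := hLB ▸ List.mem_toFinset.2 (List.getElem_mem hj)
        have hV : (Finset.univ \ (L.take j).toFinset.image A).Nonempty := by
          refine ⟨A L[j], Finset.mem_sdiff.2 ⟨Finset.mem_univ _, fun h => ?_⟩⟩
          obtain ⟨b, hb, he⟩ := Finset.mem_image.1 h
          have hb := List.mem_toFinset.1 hb
          have hbB : b ∈ B := hLB ▸ List.mem_toFinset.2 (List.mem_of_mem_take hb)
          rw [hAB hbB hLB' he, List.mem_take_iff_getElem] at hb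
          obtain ⟨i, hi, he⟩ := hb
          have := (hL.getElem_inj_iff).1 he
          omega
        obtain ⟨c, hc, hpc, -⟩ := hres L[j] _ hV
        have hpick : pickUser u (w (fiberVec F j))
            (fun a => !(fiberVec (planVec (ρ j)) a).any fun b => b) = some c := by
          rw [hvec, ← hc]
          refine pickUser_congr fun a ha => ?_
          have h1 := hρfib j ⟨a, ha⟩
          rw [← any_vec, ← fiberVec_planVec] at h1
          simp only at h1
          rw [Bool.eq_iff_iff]
          simp only [Bool.not_eq_true', ← Bool.not_eq_true, h1, Finset.mem_sdiff, Finset.mem_univ,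
            true_and, decide_eq_true_eq, ha, exists_true_left]
        have hpick' := hpick
        unfold planVec at hpick'
        rw [hpick']
        simp only [Option.isSome_some, Bool.and_true, decide_eq_true_eq, Option.getD_some]
        rw [← hpc, ← hser j hj, ← hφB _ hLB']
        simp only [hcol j hj x]
        have hmem : ∀ a, a ∈ L.take (j + 1) ↔ a ∈ L.take j ∨ a = L[j] := fun a => by
          rw [List.take_succ_eq_append_getElem hj, List.mem_append, List.mem_singleton]
        split
        · rename_i hx
          simp only [ρ, hx, Option.bind_some, hmem, or_true, if_true, planEntry]
        · rename_i hx
          refine (getD_planVec (ρ j) x).trans ?_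
          congr 1
          cases h : π x with
          | none => simp only [ρ, h, Option.bind_none]
          | some a =>
            have : a ≠ L[j] := fun he => hx (he ▸ h)
            simp only [ρ, h, Option.bind_some, hmem, this, or_false]
      · rw [if_neg (by simp [-List.getD_eq_getElem?_getD, hbig j (not_lt.1 hj) x])]
        refine (getD_planVec (ρ j) x).trans ?_
        simp only [ρ, List.take_of_length_le (not_lt.1 hj),
          List.take_of_length_le ((not_lt.1 hj).trans (Nat.le_succ j))]
    have hfold : ∀ j, (List.range j).foldl (greedyStep s u w F) ((List.range s).map fun _ => 0) =
        planVec (ρ j) := by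
      intro j
      induction j with
      | zero =>
        rw [zero_eq_planVec s u]
        refine congrArg planVec ?_
        funext x
        cases h : π x <;> simp [ρ, h]
      | succ j ih => rw [List.range_succ, List.foldl_append, ih]; exact hstep j
    refine (hfold s).trans (congrArg planVec ?_)
    funext x
    cases h : π x with
    | none => simp [ρ, Plan.permute, h]
    | some a =>
      simp only [ρ, Plan.permute, h, Option.bind_some, Option.map_some,
        List.take_of_length_le hlen, hmemL x a h, if_true]
  · have hfib : ∀ a, (π.permute φ).fiber (φ a) = π.fiber a := fun a => by
      ext x
      simp only [Plan.fiber, Plan.permute, Finset.mem_filter, Finset.mem_univ, true_and,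
        Option.map_eq_some_iff]
      constructor
      · rintro ⟨b, hb, he⟩
        rw [hb, φ.injective he]
      · exact fun h => ⟨a, h, rfl⟩
    rw [← Equiv.sum_comp φ]
    simp only [hfib]
    have hzero : ∀ A : Fin u → Fin u,
        ∑ a, ω (π.fiber a) (A a) = ∑ a ∈ B, ω (π.fiber a) (A a) := by
      intro A
      refine (Finset.sum_subset (Finset.subset_univ B) fun a _ ha => ?_).symm
      have : π.fiber a = ∅ := Finset.not_nonempty_iff_eq_empty.1 fun h =>
        ha (Finset.mem_filter.2 ⟨Finset.mem_univ _, h⟩)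
      rw [this, hω]
    rw [hzero φ]
    refine le_trans ?_ (hsum.trans (hzero id).ge)
    exact Finset.sum_le_sum fun b hb => by rw [hφB b hb]

/-! ### The algorithm and its correctness -/

/-- The step with index `x` occurs in the sequence. -/
def hasStep (σ : List RawActivity) (x : ℕ) : Bool := σ.any fun a => !a.1 && decide (a.2 = x)

/-- The colouring `f` of the steps, restricted to those that occur in the sequence: the entries are
zero for absent steps and otherwise the successor of the colour. -/
def shade (s : ℕ) (σ : List RawActivity) (f : List ℕ) : List ℕ :=
  (List.range s).map fun x => if hasStep σ x then f.getD x 0 + 1 else 0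

/-- A constraint as it appears in the input, together with its weight in binary, as a function of
the characteristic vectors of the blocks and of the entries of the plan. -/
structure RawConstraint where
  scope : List Bool
  releases : List Bool
  descr : Data
  weight : List (List Bool) → List ℕ → List Bool

/-- The encoding of a constraint, the same as that of a constraint with bounds (`encList_toRaw`).
The weight is present only through its description. -/
def RawConstraint.enc (c : RawConstraint) : Data :=
  .cons (encList encBool c.scope) (.cons (encList encBool c.releases) c.descr)

/-- The constraint without its bounds and its set of admitted functions, which does not enter into
the cost. -/
def WeightedConstraint.toRaw {s r u : ℕ} (c : WeightedConstraint s r u) : RawConstraint where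
  scope := vec c.scope
  releases := vec c.releases
  descr := c.descr
  weight Qs π := (c.weight (Qs.map (unvec s)) (unplan s u π)).bits

theorem encList_toRaw {s r u : ℕ} (C : List (WeightedConstraint s r u)) :
    encList encConstraint C = encList RawConstraint.enc (C.map WeightedConstraint.toRaw) := by
  induction C with
  | nil => rfl
  | cons c C ih => rw [encList, ih]; rfl

/-- The effect of one more activity in front of a sequence on the list of the blocks: a release
point of the constraint opens a new block, and a step in the scope is added to the first block. -/
def blockStep (s : ℕ) (sc rl : List Bool) (L : List (List Bool)) (a : RawActivity) :
    List (List Bool) :=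
  if a.1 then
    if rl.getD a.2 false then ((List.range s).map fun _ => false) :: L else L
  else
    ((List.range s).map fun x =>
      (L.headD []).getD x false || (sc.getD x false && decide (x = a.2))) :: L.tail

/-- The characteristic vectors of the blocks of a constraint. -/
def rawBlocks (s : ℕ) (sc rl : List Bool) (σ : List RawActivity) : List (List Bool) :=
  σ.reverse.foldl (blockStep s sc rl) [(List.range s).map fun _ => false]

theorem rawBlocks_eq {s r u : ℕ} (c : ReleaseConstraint s r u) (σ : List (Activity s r)) :
    rawBlocks s (vec c.scope) (vec c.releases) (σ.map rawActivity) = (c.blocks σ).map vec := by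
  have hempty : ((List.range s).map fun _ => false) = vec (∅ : Finset (Fin s)) := by
    rw [range_map_eq_ofFn]; simp [vec]
  have hget : ∀ {n : ℕ} (D : Finset (Fin n)) (x : Fin n), (vec D).getD x false = decide (x ∈ D) :=
    fun D x => by simp [vec, List.getD_eq_getElem?_getD]
  unfold rawBlocks
  rw [List.foldl_reverse]
  induction σ with
  | nil => simp [ReleaseConstraint.blocks, hempty, stepsOf]
  | cons v σ ih =>
    rw [List.map_cons, List.foldr_cons, ih]
    rcases v with x | x
    · rw [blocks_inl]
      have hne : c.blocks σ ≠ [] := by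
        simp [ReleaseConstraint.blocks, List.splitOnP_ne_nil]
      obtain ⟨Q, L, hL⟩ := List.exists_cons_of_ne_nil hne
      rw [hL]
      simp only [rawActivity, blockStep, Bool.false_eq_true, if_false, List.map_cons,
        List.headD_cons, List.tail_cons, List.modifyHead_cons, List.cons.injEq, and_true]
      rw [range_map_eq_ofFn]
      simp only [hget]
      refine congrArg List.ofFn (funext fun y => ?_)
      rw [Bool.eq_iff_iff]
      simp only [Bool.or_eq_true, Bool.and_eq_true, decide_eq_true_eq, Finset.mem_union,
        Finset.mem_inter, Finset.mem_singleton, ← Fin.ext_iff]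
      exact or_comm
    · rw [blocks_inr]
      simp only [rawActivity, blockStep, if_true, hget, decide_eq_true_eq]
      split
      · rw [List.map_cons, hempty]
      · rfl

theorem hasStep_map {s r : ℕ} (σ : List (Activity s r)) (x : Fin s) :
    hasStep (σ.map rawActivity) x = decide (x ∈ stepsOf σ) := by
  rw [Bool.eq_iff_iff, decide_eq_true_eq]
  induction σ with
  | nil => simp [hasStep, stepsOf]
  | cons v σ ih =>
    rcases v with y | y
    · rw [stepsOf_cons_inl, Finset.mem_union, ← ih]
      simp [hasStep, rawActivity, Fin.ext_iff, eq_comm (a := (y : ℕ))]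
    · rw [stepsOf_cons_inr, ← ih]
      simp [hasStep, rawActivity]

/-- The authorization weight in binary, as a function of characteristic vectors and indices. -/
def Schema.authBits (W : Schema) (D : List Bool) (a : ℕ) : List Bool :=
  if h : a < W.u then (W.authWeight (unvec W.s D) ⟨a, h⟩).bits else []

theorem Schema.authBits_vec (W : Schema) (D : Finset (Fin W.s)) (a : Fin W.u) :
    W.authBits (vec D) a = (W.authWeight D a).bits := by
  rw [authBits, dif_pos a.2, unvec_vec]

/-- The cost of the plan with entries `π` for the sequence `σ`. -/
def Schema.costBits (W : Schema) (σ : List RawActivity) (π : List ℕ) : List Bool :=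
  addBits
    (sumBits ((W.constraints.map WeightedConstraint.toRaw).map fun c =>
      c.weight (rawBlocks W.s c.scope c.releases σ) π))
    (sumBits ((List.range W.u).map fun a => W.authBits (fiberVec π a) a))

theorem Schema.weight_toRaw (W : Schema) (c : WeightedConstraint W.s W.r W.u)
    (σ : List (Activity W.s W.r)) (π : Plan W.s W.u) :
    c.toRaw.weight (rawBlocks W.s c.toRaw.scope c.toRaw.releases (σ.map rawActivity)) (planVec π) =
      (c.weight (c.blocks σ) π).bits := by
  simp only [WeightedConstraint.toRaw, rawBlocks_eq, List.map_map, unplan_planVec]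
  congr 2
  exact (List.map_congr_left fun D _ => unvec_vec D).trans (List.map_id _)

theorem Schema.bitsVal_costBits (W : Schema) (σ : List (Activity W.s W.r)) (π : Plan W.s W.u) :
    bitsVal (W.costBits (σ.map rawActivity) (planVec π)) = W.cost σ π := by
  rw [costBits, bitsVal_addBits, bitsVal_sumBits, bitsVal_sumBits, cost, constraintCost, authCost]
  congr 1
  · rw [List.map_map, List.map_map]
    congr 1
    refine List.map_congr_left fun c _ => ?_
    simp only [Function.comp, W.weight_toRaw, bitsVal_bits]
  · rw [List.map_map, range_map_eq_ofFn, List.sum_ofFn]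
    refine Finset.sum_congr rfl fun a _ => ?_
    simp only [Function.comp, fiberVec_planVec, W.authBits_vec, bitsVal_bits]

/-- The entries of the plan are zero exactly for the steps that do not occur in the sequence. -/
def domainCheck (s : ℕ) (σ : List RawActivity) (π : List ℕ) : Bool :=
  (List.range s).all fun x => decide (π.getD x 0 = 0) == !hasStep σ x

theorem domainCheck_iff {s r u : ℕ} (σ : List (Activity s r)) (π : Plan s u) :
    domainCheck s (σ.map rawActivity) (planVec π) = true ↔ π.HasDomain (stepsOf σ) := by
  have key : ∀ x : Fin s, ((decide ((planVec π).getD x 0 = 0) == !hasStep (σ.map rawActivity) x) =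
      true ↔ ((π x).isSome ↔ x ∈ stepsOf σ)) := by
    intro x
    rw [getD_planVec, hasStep_map]
    obtain h | ⟨a, h⟩ := Option.eq_none_or_eq_some (π x) <;>
      by_cases hx : x ∈ stepsOf σ <;> simp [planEntry, h, hx]
  simp only [domainCheck, List.all_eq_true, List.mem_range]
  exact ⟨fun h x => (key x).1 (h x x.2), fun h x hx => (key ⟨x, hx⟩).2 (h ⟨x, hx⟩)⟩

/-- The plan that the greedy assignment makes of a colouring of the steps of a sequence. -/
def Schema.candidate (W : Schema) (σ : List RawActivity) (f : List ℕ) : List ℕ :=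
  greedyPlan W.s W.u W.authBits (shade W.s σ f)

/-- The greedy assignment leads from the colouring `f` to a plan within the budget. -/
def Schema.accepts (W : Schema) (σ : List RawActivity) (f : List ℕ) : Bool :=
  if domainCheck W.s σ (W.candidate σ f) then
    leBits (W.costBits σ (W.candidate σ f)) W.budget.bits
  else false

/-- For one sequence, some colouring is accepted if and only if some plan is within the budget: the
greedy assignment changes a plan by a permutation of the users, and the constraint weights are
user-independent. -/
theorem Schema.exists_accepts_iff (W : Schema) (σ : List (Activity W.s W.r)) :
    (∃ f ∈ vectors (List.range W.s) W.s, W.accepts (σ.map rawActivity) f = true) ↔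
      ∃ π : Plan W.s W.u, π.HasDomain (stepsOf σ) ∧ W.cost σ π ≤ W.budget := by
  constructor
  · rintro ⟨f, -, h⟩
    obtain ⟨ρ, hρ⟩ := exists_planVec_greedyPlan W.s W.u W.authBits (shade W.s (σ.map rawActivity) f)
    rw [accepts, candidate, hρ] at h
    split at h
    · rename_i hd
      refine ⟨ρ, (domainCheck_iff σ ρ).1 hd, ?_⟩
      rwa [leBits_iff, bitsVal_costBits, bitsVal_bits] at h
    · cases h
  · rintro ⟨π, hd, hc⟩
    obtain ⟨f, φ, hf, hg, hle⟩ := exists_greedyPlan_eq W.authWeight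
      (fun a => (W.authWeight_eq_zero_iff ∅ a).2 (by simp)) W.authBits
      (fun D a => by rw [W.authBits_vec, bitsVal_bits]) π
    refine ⟨List.ofFn f, mem_vectors.2 ⟨by simp, fun a ha => ?_⟩, ?_⟩
    · obtain ⟨x, rfl⟩ := List.mem_ofFn.1 ha
      exact List.mem_range.2 (hf x)
    · have hs : shade W.s (σ.map rawActivity) (List.ofFn f) =
          List.ofFn fun x => if (π x).isSome then f x + 1 else 0 := by
        rw [shade, range_map_eq_ofFn]
        congr 1
        funext x
        rw [hasStep_map]
        simp [hd x, List.getD_eq_getElem?_getD]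
      have hd' : (π.permute φ).HasDomain (stepsOf σ) := fun x => by
        rw [← hd x, Plan.permute, Option.isSome_map]
      rw [accepts, candidate, hs, hg, if_pos ((domainCheck_iff σ _).2 hd'), leBits_iff,
        bitsVal_costBits, bitsVal_bits]
      refine le_trans (Nat.add_le_add (le_of_eq ?_) hle) hc
      exact congrArg List.sum (List.map_congr_left fun c _ => c.weight_permute φ _ π)

/-- The decision procedure: for all tables of keys, every canonical sequence of the workflow has a
colouring of the steps that is accepted. -/
def Schema.decides (W : Schema) : Bool :=
  (releaseKeys W.r).permutations'.all fun K => (vectors (stepKeys W.r) W.s).all fun g =>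
    (W.workflow.raw.canonical (g, K)).all fun σ => (vectors (List.range W.s) W.s).any (W.accepts σ)

theorem Schema.relativeCost_le_iff (W : Schema) {σ : List (Activity W.s W.r)}
    (hσ : σ ∈ W.workflow.execSeqs) (π : Plan W.s W.u) :
    W.relativeCost σ π ≤ (W.budget : ℚ) / (W.workflow.execSeqs.card : ℚ) ↔
      W.cost σ π ≤ W.budget := by
  have : (0 : ℚ) < W.workflow.execSeqs.card := by
    exact_mod_cast Finset.card_pos.2 ⟨σ, hσ⟩
  rw [relativeCost, one_div_mul_eq_div, div_le_div_iff_of_pos_right this, Nat.cast_le]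

/-- It suffices to inspect the canonical sequences, since the cost of a plan depends only on the
set of steps and on the blocks of the constraints, and these are the same for any two sequences of
the same activities that are sorted by the same keys. -/
theorem Schema.decides_iff (W : Schema) : W.decides = true ↔ W.BoundedCost := by
  simp only [decides, List.all_eq_true, List.any_eq_true]
  constructor
  · intro h τ hτ
    simp only [W.relativeCost_le_iff hτ]
    obtain ⟨K, hK, g, hg, hs⟩ := exists_tables (nodup_of_mem_execSeqs W.nodup hτ)
    obtain ⟨ρ, hρ, hp, hρs⟩ := exists_mem_canonical (g, K) W.workflow hτ hs
    obtain ⟨σ, -, rfl⟩ := exists_execSeq_of_mem_canonical (g, K) W.workflow hρ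
    have hp := (List.map_perm_map_iff rawActivity_injective).1 hp
    obtain ⟨π, h1, h2⟩ := (W.exists_accepts_iff σ).1 (h K hK g hg _ hρ)
    have hsort : ∀ {σ : List (Activity W.s W.r)}, KeySorted (g, K) (σ.map rawActivity) →
        σ.Pairwise fun v w => keyOf (g, K) (rawActivity v) ≤ keyOf (g, K) (rawActivity w) :=
      fun h => (List.pairwise_map.1 h).imp fun h => of_decide_eq_true h
    refine ⟨π, ?_, ?_⟩
    · have : stepsOf σ = stepsOf τ := List.toFinset_eq_of_perm _ _ (hp.filterMap _)
      rwa [← this]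
    · refine le_trans (le_of_eq ?_) h2
      unfold cost constraintCost
      congr 2
      refine List.map_congr_left fun c _ => ?_
      rw [blocks_eq_of_sorted c.toReleaseConstraint _ (keys_separate hg hK) hp (hsort hρs)
        (hsort hs)]
  · intro h K _ g _ ρ hρ
    obtain ⟨σ, hσ, rfl⟩ := exists_execSeq_of_mem_canonical (g, K) W.workflow hρ
    obtain ⟨π, h1, h2⟩ := h σ hσ
    exact (W.exists_accepts_iff σ).2 ⟨π, h1, (W.relativeCost_le_iff hσ π).1 h2⟩

/-! ### Programs for the parts of the algorithm -/

theorem vec_unvec {n : ℕ} {l : List Bool} (h : l.length = n) : vec (unvec n l) = l := by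
  subst h
  apply List.ext_getElem
  · simp [vec]
  · intro j h1 h2
    simp [vec, unvec]

/-- The output of a program that runs for at most `t` steps has length at most the height of its
input plus `t`. -/
theorem Code.Runs.length_le {M : Code} {v : Data} {l : List Bool} {t : ℕ}
    (h : M.Runs v (encList encBool l) t) : l.length ≤ v.height + t :=
  (length_le_height encBool l).trans h.height_le

/-- The sequence is an execution sequence of the workflow. -/
def Schema.IsSeq (W : Schema) (σ : List RawActivity) : Prop :=
  ∃ τ ∈ W.workflow.execSeqs, σ = τ.map rawActivity

/-- The list consists of the entries of a plan. -/
def Schema.IsPlan (W : Schema) (π : List ℕ) : Prop := ∃ ρ : Plan W.s W.u, π = planVec ρ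

namespace Schema
variable (W : Schema)

theorem s_add_r_add_u_lt : W.s + W.r + W.u < W.enc.size := by
  have h1 := lt_size_encUnary W.s
  have h2 := lt_size_encUnary W.r
  have h3 := lt_size_encUnary W.u
  simp only [enc, encList, Data.size, id]
  omega

theorem s_le : W.s ≤ W.enc.size := by have := W.s_add_r_add_u_lt; omega
theorem r_le : W.r ≤ W.enc.size := by have := W.s_add_r_add_u_lt; omega
theorem u_le : W.u ≤ W.enc.size := by have := W.s_add_r_add_u_lt; omega

theorem authDescr_le : W.authDescr.size ≤ W.enc.size := by
  simp only [enc, encList, Data.size, id]; omega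

theorem workflow_le : (encWorkflow W.workflow).size ≤ W.enc.size := by
  simp only [enc, encList, Data.size, id]; omega

theorem constraints_le : (encList encConstraint W.constraints).size ≤ W.enc.size := by
  simp only [enc, encList, Data.size, id]; omega

theorem budget_le : W.budget.bits.length ≤ W.enc.size := by
  have := length_lt_size encBool W.budget.bits
  simp only [enc, encList, Data.size, id, encBinary]; omega

variable {W}

theorem IsSeq.length_le {σ : List RawActivity} (h : W.IsSeq σ) : σ.length ≤ W.enc.size := by
  obtain ⟨τ, hτ, rfl⟩ := h
  have := (nodup_of_mem_execSeqs W.nodup hτ).length_le_card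
  simp only [Fintype.card_sum, Fintype.card_fin] at this
  have := W.s_add_r_add_u_lt
  rw [List.length_map]
  omega

theorem IsSeq.index_le {σ : List RawActivity} (h : W.IsSeq σ) {a : RawActivity} (ha : a ∈ σ) :
    a.2 ≤ W.enc.size := by
  obtain ⟨τ, -, rfl⟩ := h
  obtain ⟨v, -, rfl⟩ := List.mem_map.1 ha
  rcases v with x | x
  · exact x.2.le.trans W.s_le
  · exact x.2.le.trans W.r_le

theorem IsPlan.length_eq {π : List ℕ} (h : W.IsPlan π) : π.length = W.s := by
  obtain ⟨ρ, rfl⟩ := h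
  simp [planVec]

theorem IsPlan.le {π : List ℕ} (h : W.IsPlan π) {y : ℕ} (hy : y ∈ π) : y ≤ W.u := by
  obtain ⟨ρ, rfl⟩ := h
  obtain ⟨x, rfl⟩ := List.mem_ofFn.1 hy
  cases ρ x with
  | none => exact Nat.zero_le _
  | some a => exact a.2

variable {mC mA : Code} {q : Polynomial ℕ}

/-- The input of the program for the authorization weight has height at most `W.enc.size + 5`, and
the program runs for at most `q.eval W.enc.size` steps. -/
theorem length_authBits_le (h : W.WeightsComputedBy mC mA q) (D : List Bool) (a : ℕ) :
    (W.authBits D a).length ≤ W.enc.size + 5 + q.eval W.enc.size := by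
  unfold authBits
  split
  · rename_i ha
    obtain ⟨t, ht, hr⟩ := h.auth (unvec W.s D) ⟨a, ha⟩
    have h1 := hr.length_le
    have h2 : ∀ d ∈ [W.authDescr, encUnary W.u, encFinset (unvec W.s D), encUnary a],
        (id d).height ≤ W.enc.size + 1 := by
      have := W.s_add_r_add_u_lt
      simp only [List.mem_cons, List.not_mem_nil, or_false]
      rintro d (rfl | rfl | rfl | rfl)
      · exact (Data.height_lt_size _).le.trans (W.authDescr_le.trans (Nat.le_succ _))
      · rw [id, height_encUnary]; omega
      · refine (height_encList_le fun b _ => height_encBool_le b).trans ?_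
        rw [List.length_ofFn]; omega
      · rw [id, height_encUnary]; omega
    refine h1.trans (Nat.add_le_add ((height_encList_le h2).trans ?_) ht)
    simp only [List.length_cons, List.length_nil]
    omega
  · exact Nat.zero_le _

end Schema

/-- The schema `W` can be read from the environment `Γ`, its size is that of the frame, and its
weights are computed by the given programs. -/
structure Reads (mC mA : Code) (q : Polynomial ℕ) {ι : Type} (F : Frame ι) (Γ : ι → Data)
    (W : ι → Schema) : Prop where
  enc : Computes (F.setTime fun _ => 0) Γ fun i => (W i).enc
  size : ∀ i, F.Valid i → (W i).enc.size = F.size i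
  weights : ∀ i, F.Valid i → (W i).WeightsComputedBy mC mA q

section
variable {mC mA : Code} {q : Polynomial ℕ} {ι α β : Type} {F : Frame ι} {Γ : ι → Data}
  {W : ι → Schema}

theorem Reads.lift (h : Reads mC mA q F Γ W) {Q : ι → α → Prop} {e : α → Data} :
    Reads mC mA q (F.ext Q) (push Γ e) fun x => W x.1 :=
  ⟨h.enc.lift, fun x hx => h.size x.1 hx.1, fun x hx => h.weights x.1 hx.1⟩

theorem Reads.and (h : Reads mC mA q F Γ W) {Q : ι → Prop} : Reads mC mA q (F.and Q) Γ W :=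
  ⟨h.enc.and, fun x hx => h.size x hx.1, fun x hx => h.weights x hx.1⟩

theorem Reads.setTime (h : Reads mC mA q F Γ W) {T : ι → ℕ} :
    Reads mC mA q (F.setTime T) Γ W :=
  ⟨h.enc, h.size, h.weights⟩

theorem Reads.code (h : Reads mC mA q F Γ W) : Computes F Γ fun i => (W i).enc :=
  h.enc.slow (T := F.time)

theorem Reads.s (h : Reads mC mA q F Γ W) : Computes F Γ fun i => encUnary (W i).s := h.code.hd

theorem Reads.r (h : Reads mC mA q F Γ W) : Computes F Γ fun i => encUnary (W i).r := h.code.tl.hd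

theorem Reads.u (h : Reads mC mA q F Γ W) : Computes F Γ fun i => encUnary (W i).u :=
  h.code.tl.tl.hd

theorem Reads.workflow (h : Reads mC mA q F Γ W) :
    Computes F Γ fun i => encRaw (W i).workflow.raw :=
  h.code.tl.tl.tl.hd.congr fun _ _ => (encRaw_raw _).symm

theorem Reads.authDescr (h : Reads mC mA q F Γ W) : Computes F Γ fun i => (W i).authDescr :=
  h.code.tl.tl.tl.tl.tl.hd

theorem Reads.constraints (h : Reads mC mA q F Γ W) : Computes F Γ fun i =>
    encList RawConstraint.enc ((W i).constraints.map WeightedConstraint.toRaw) :=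
  h.code.tl.tl.tl.tl.tl.tl.hd.congr fun _ _ => encList_toRaw _

theorem Reads.budget (h : Reads mC mA q F Γ W) :
    Computes F Γ fun i => encList encBool (W i).budget.bits := h.code.tl.tl.tl.tl.tl.tl.tl.hd

/-- Numbers up to the size of the schema are polynomially bounded. -/
theorem Reads.bdd (h : Reads mC mA q F Γ W) {m : ι → ℕ}
    (hm : ∀ i, F.Valid i → m i ≤ (W i).enc.size) : F.PolyBdd m :=
  Frame.PolyBdd.size.of_le fun i hi => (hm i hi).trans (h.size i hi).le

theorem Reads.bddEval (h : Reads mC mA q F Γ W) : F.PolyBdd fun i => q.eval (W i).enc.size :=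
  ⟨q, fun i hi => (congrArg (fun n => q.eval n) (h.size i hi)).le⟩

theorem Reads.bddSize (h : Reads mC mA q F Γ W) : F.PolyBdd fun i => (W i).enc.size :=
  h.bdd fun _ _ => le_rfl

/-- The bound for the length of a weight is polynomial. -/
theorem Reads.bddWeight (h : Reads mC mA q F Γ W) :
    F.PolyBdd fun i => (W i).enc.size + 5 + q.eval (W i).enc.size :=
  (h.bddSize.add (.const 5)).add h.bddEval

theorem Reads.hasStep (h : Reads mC mA q F Γ W) {σ : ι → List RawActivity} {x : ι → ℕ}
    (hσ : Computes F Γ fun i => encSeq (σ i)) (hx : Computes F Γ fun i => encUnary (x i))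
    (hσW : ∀ i, F.Valid i → (W i).IsSeq (σ i)) (hxW : ∀ i, F.Valid i → x i ≤ (W i).s) :
    Computes F Γ fun i => encBool (hasStep (σ i) (x i)) := by
  refine Computes.any (h := fun i a => !a.1 && decide (a.2 = x i)) hσ
    (Computes.bool₂ (fun y z => !y && z) (Computes.top (e := encActivity)).pairFst
      (Computes.eq (Computes.top (e := encActivity)).pairSnd hx.lift ?_ ?_))
    (h.bdd fun i hi => (hσW i hi).length_le)
  · exact h.bddSize.lift.of_le fun x hx => (hσW _ hx.1).index_le hx.2
  · exact h.bddSize.lift.of_le fun x hx => (hxW _ hx.1).trans (W x.1).s_le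

theorem Reads.shade (h : Reads mC mA q F Γ W) {σ : ι → List RawActivity} {f : ι → List ℕ}
    (hσ : Computes F Γ fun i => encSeq (σ i)) (hf : Computes F Γ fun i => encList encUnary (f i))
    (hσW : ∀ i, F.Valid i → (W i).IsSeq (σ i)) :
    Computes F Γ fun i => encList encUnary (shade (W i).s (σ i) (f i)) := by
  refine Computes.tab h.s (h.bdd fun i _ => (W i).s_le) (Computes.ite (e := encUnary)
    (h.lift.hasStep hσ.lift Computes.top (fun _ hx => hσW _ hx.1) fun _ hx => hx.2.le) ?_
    (.const (encUnary 0)))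
  exact ((Computes.getD (e := encUnary) rfl hf.lift Computes.top
    (h.bddSize.lift.of_le fun x hx => hx.2.le.trans (W x.1).s_le)).succ).and

theorem Computes.fiberVec {π : ι → List ℕ} {a N : ι → ℕ} (hN : F.PolyBdd N)
    (hπ : Computes F Γ fun i => encList encUnary (π i))
    (ha : Computes F Γ fun i => encUnary (a i))
    (hπN : ∀ i, F.Valid i → (π i).length ≤ N i ∧ ∀ y ∈ π i, y ≤ N i)
    (haN : ∀ i, F.Valid i → a i ≤ N i) :
    Computes F Γ fun i => encList encBool (fiberVec (π i) (a i)) :=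
  Computes.map (h := fun i y => decide (y = a i + 1)) hπ
    (Computes.eq Computes.top ha.lift.succ (hN.lift.of_le fun _ hx => (hπN _ hx.1).2 _ hx.2)
      ((hN.lift.add (.const 1)).of_le fun _ hx => Nat.succ_le_succ (haN _ hx.1)))
    (hN.of_le fun i hi => (hπN i hi).1)

theorem Reads.authBits (h : Reads mC mA q F Γ W) {D : ι → List Bool} {a : ι → ℕ}
    (hD : Computes F Γ fun i => encList encBool (D i)) (ha : Computes F Γ fun i => encUnary (a i))
    (hDW : ∀ i, F.Valid i → (D i).length = (W i).s) (haW : ∀ i, F.Valid i → a i < (W i).u) :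
    Computes F Γ fun i => encList encBool ((W i).authBits (D i) (a i)) := by
  refine Computes.call (M := mA) (h.authDescr.cons (h.u.cons (hD.cons (ha.cons .nil)))) h.bddEval
    fun i hi => ?_
  obtain ⟨t, ht, hr⟩ := (h.weights i hi).auth (unvec (W i).s (D i)) ⟨a i, haW i hi⟩
  refine ⟨t, ht, ?_⟩
  rw [Schema.authBits, dif_pos (haW i hi)]
  rw [encFinset_eq, vec_unvec (hDW i hi)] at hr
  exact hr

/-- Free users are those to whom the plan does not yet assign a step. -/
theorem Reads.pickUser (h : Reads mC mA q F Γ W) {D : ι → List Bool} {π : ι → List ℕ}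
    (hD : Computes F Γ fun i => encList encBool (D i))
    (hπ : Computes F Γ fun i => encList encUnary (π i))
    (hDW : ∀ i, F.Valid i → (D i).length = (W i).s) (hπW : ∀ i, F.Valid i → (W i).IsPlan (π i)) :
    Computes F Γ fun i => encOption (encPair encUnary (encList encBool))
      (pickUser (W i).u ((W i).authBits (D i)) fun a => !(fiberVec (π i) a).any fun b => b) := by
  -- invariant: the weight of the best user so far is short enough for a comparison
  refine Computes.foldl (eb := encOption (encPair encUnary (encList encBool)))
    (b := fun _ => none)
    (st := fun i => pickStep ((W i).authBits (D i)) fun a => !(fiberVec (π i) a).any fun b => b)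
    (fun i best => (best.getD (0, [])).2.length ≤
      (W i).enc.size + 5 + q.eval (W i).enc.size)
    (h.u.range (h.bdd fun i _ => (W i).u_le)) .nil ?_ (fun _ _ => Nat.zero_le _) ?_
    (by simpa using h.bdd fun i _ => (W i).u_le)
  · have best := Computes.top (F := F.ext fun i (a : ℕ) => a ∈ List.range (W i).u)
      (Γ := push Γ encUnary) (e := encOption (encPair encUnary (encList encBool)))
      (Q := fun x best => (best.getD (0, [])).2.length ≤
        (W x.1).enc.size + 5 + q.eval (W x.1).enc.size)
    have hbits := (h.lift.authBits (a := fun x => x.2)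
      (F := F.ext fun i (a : ℕ) => a ∈ List.range (W i).u) hD.lift Computes.top
      (fun _ hx => hDW _ hx.1) (fun _ hx => List.mem_range.1 hx.2)).lift
      (e := encOption (encPair encUnary (encList encBool)))
      (Q := fun x best => (best.getD (0, [])).2.length ≤
        (W x.1).enc.size + 5 + q.eval (W x.1).enc.size)
    have hfree : Computes (F.ext fun i (a : ℕ) => a ∈ List.range (W i).u) (push Γ encUnary)
        fun x => encBool (!(BoundedWSP.fiberVec (π x.1) x.2).any fun b => b) := by
      refine Computes.not (Computes.any (h := fun _ b => b) (Computes.fiberVec h.bddSize.lift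
        hπ.lift Computes.top ?_ ?_) Computes.top ?_)
      · intro x hx
        exact ⟨(hπW _ hx.1).length_eq.le.trans (W x.1).s_le, fun y hy =>
          ((hπW _ hx.1).le hy).trans (W x.1).u_le⟩
      · exact fun x hx => (List.mem_range.1 hx.2).le.trans (W x.1).u_le
      · refine h.bddSize.lift.of_le fun x hx => ?_
        rw [BoundedWSP.fiberVec, List.length_map, (hπW _ hx.1).length_eq]
        exact (W x.1).s_le
    have hnone := best.isNil (b := fun x => x.2.isNone)
      (by rintro ⟨x, _ | b⟩ - <;> simp [encOption])
    have hle := Computes.leBits (l := fun x => (x.2.getD (0, [])).2)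
      (best.tl.tl.congr (by rintro ⟨x, _ | b⟩ - <;> rfl)) hbits ?_ ?_
    · exact Computes.ite (e := encOption (encPair encUnary (encList encBool))) hfree.lift
        (Computes.ite (e := encOption (encPair encUnary (encList encBool)))
          (x := fun x => some (x.1.2, (W x.1.1).authBits (D x.1.1) x.1.2))
          (hnone.bool₂ (fun y z => y || !z) hle) (Computes.cons .nil (Computes.cons
            Computes.top.lift hbits)).and best.and).and best.and
    · exact h.bddWeight.lift.lift.of_le fun x hx => hx.2
    · exact h.bddWeight.lift.lift.of_le fun x hx =>
        Schema.length_authBits_le (h.weights _ hx.1.1) _ _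
  · intro i a best hi _ hb
    unfold pickStep
    split
    · split
      · exact Schema.length_authBits_le (h.weights i hi) _ _
      · exact hb
    · exact hb

theorem Reads.greedyStep (h : Reads mC mA q F Γ W) {f π : ι → List ℕ} {j : ι → ℕ}
    (hf : Computes F Γ fun i => encList encUnary (f i))
    (hπ : Computes F Γ fun i => encList encUnary (π i))
    (hj : Computes F Γ fun i => encUnary (j i))
    (hfW : ∀ i, F.Valid i → (f i).length = (W i).s ∧ ∀ y ∈ f i, y ≤ (W i).s)
    (hπW : ∀ i, F.Valid i → (W i).IsPlan (π i)) (hjW : ∀ i, F.Valid i → j i < (W i).s) :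
    Computes F Γ fun i =>
      encList encUnary (greedyStep (W i).s (W i).u (W i).authBits (f i) (π i) (j i)) := by
  have hp := h.pickUser (Computes.fiberVec h.bddSize hf hj
    (fun i hi => ⟨(hfW i hi).1.le.trans (W i).s_le, fun y hy =>
      ((hfW i hi).2 y hy).trans (W i).s_le⟩) fun i hi => (hjW i hi).le.trans (W i).s_le) hπ
    (fun i hi => by rw [fiberVec, List.length_map, (hfW i hi).1]) hπW
  refine Computes.tab h.s (h.bdd fun i _ => (W i).s_le) (Computes.ite (e := encUnary)
    (Computes.bool₂ (fun y z => y && z) (Computes.eq (Computes.getD (e := encUnary) rfl hf.lift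
      Computes.top ?_) hj.lift.succ ?_ ?_) (Computes.lift (g := fun i => encBool
        (BoundedWSP.pickUser (W i).u ((W i).authBits (BoundedWSP.fiberVec (f i) (j i)))
          fun a => !(BoundedWSP.fiberVec (π i) a).any fun b => b).isSome) ?_))
    (Computes.succ (Computes.lift (g := fun i => encUnary
        ((BoundedWSP.pickUser (W i).u ((W i).authBits (BoundedWSP.fiberVec (f i) (j i)))
          fun a => !(BoundedWSP.fiberVec (π i) a).any fun b => b).getD (0, [])).1)
            (hp.tl.hd.congr ?_))).and
    (Computes.getD (e := encUnary) rfl hπ.lift Computes.top ?_).and)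
  · exact h.bddSize.lift.of_le fun x hx => hx.2.le.trans (W x.1).s_le
  · refine h.bddSize.lift.of_le fun x hx => ?_
    rw [List.getD_eq_getElem?_getD]
    cases hy : (f x.1)[x.2]? with
    | none => exact Nat.zero_le _
    | some y => exact ((hfW _ hx.1).2 y (List.mem_of_getElem? hy)).trans (W x.1).s_le
  · exact h.bddSize.lift.of_le fun x hx => (Nat.succ_le_of_lt (hjW _ hx.1)).trans (W x.1).s_le
  · refine (Computes.not (Computes.isNil (b := fun i => (BoundedWSP.pickUser (W i).u
      ((W i).authBits (BoundedWSP.fiberVec (f i) (j i)))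
        fun a => !(BoundedWSP.fiberVec (π i) a).any fun b => b).isNone) hp ?_)).congr ?_
    · intro i _
      cases BoundedWSP.pickUser (W i).u _ _ <;> simp [encOption]
    · intro i _
      simp
  · intro i _
    cases BoundedWSP.pickUser (W i).u _ _ <;> rfl
  · exact h.bddSize.lift.of_le fun x hx => hx.2.le.trans (W x.1).s_le

theorem Reads.candidate (h : Reads mC mA q F Γ W) {σ : ι → List RawActivity} {f : ι → List ℕ}
    (hσ : Computes F Γ fun i => encSeq (σ i)) (hf : Computes F Γ fun i => encList encUnary (f i))
    (hσW : ∀ i, F.Valid i → (W i).IsSeq (σ i))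
    (hfW : ∀ i, F.Valid i → f i ∈ vectors (List.range (W i).s) (W i).s) :
    Computes F Γ fun i => encList encUnary ((W i).candidate (σ i) (f i)) := by
  have hs := h.shade hσ hf hσW
  refine Computes.foldl (eb := encList encUnary) (st := fun i =>
    BoundedWSP.greedyStep (W i).s (W i).u (W i).authBits (BoundedWSP.shade (W i).s (σ i) (f i)))
    (fun i π => (W i).IsPlan π) (h.s.range (h.bdd fun i _ => (W i).s_le))
    (Computes.tab h.s (h.bdd fun i _ => (W i).s_le) (.const (encUnary 0))) ?_
    (fun i _ => ⟨_, zero_eq_planVec _ _⟩) ?_ (by simpa using h.bdd fun i _ => (W i).s_le)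
  · refine h.lift.lift.greedyStep hs.lift.lift Computes.top Computes.top.lift ?_
      (fun x hx => hx.2) (fun x hx => List.mem_range.1 hx.1.2)
    intro x hx
    refine ⟨by simp [BoundedWSP.shade], fun y hy => ?_⟩
    obtain ⟨z, hz, rfl⟩ := List.mem_map.1 hy
    have hv := mem_vectors.1 (hfW _ hx.1.1)
    split
    · exact List.mem_range.1 (hv.2 _ (getD_mem (by rw [hv.1]; exact List.mem_range.1 hz)))
    · exact Nat.zero_le _
  · rintro i a _ hi - ⟨ρ, rfl⟩
    exact exists_planVec_greedyStep _ _ ρ a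

end

/-! ### The cost of a plan -/

theorem length_blocks_le {s r u : ℕ} (c : ReleaseConstraint s r u) (σ : List (Activity s r)) :
    (c.blocks σ).length ≤ σ.length + 1 := by
  induction σ with
  | nil => simp [ReleaseConstraint.blocks]
  | cons v σ ih =>
    rw [List.length_cons]
    rcases v with x | x
    · rw [blocks_inl, List.length_modifyHead]
      omega
    · rw [blocks_inr]
      split
      · rw [List.length_cons]; omega
      · omega

theorem sum_length_succ_le {L : List (List Bool)} {b : ℕ} (h : ∀ l ∈ L, l.length ≤ b) :
    (L.map fun l => l.length + 1).sum ≤ L.length * (b + 1) := by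
  induction L with
  | nil => simp
  | cons l L ih =>
    have h1 := h l List.mem_cons_self
    have h2 := ih fun m hm => h m (List.mem_cons_of_mem _ hm)
    rw [List.map_cons, List.sum_cons, List.length_cons, Nat.succ_mul]
    omega

/-- The sequence is an execution sequence, and the list consists of the entries of a plan for it. -/
def Schema.IsPlanFor (W : Schema) (σ : List RawActivity) (π : List ℕ) : Prop :=
  ∃ τ ∈ W.workflow.execSeqs, ∃ ρ : Plan W.s W.u,
    σ = τ.map rawActivity ∧ π = planVec ρ ∧ ρ.HasDomain (stepsOf τ)

/-- A bound for the length of the constraint weights. -/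
def Schema.weightBound (W : Schema) (q : Polynomial ℕ) : ℕ :=
  2 * W.enc.size + 6 + q.eval W.enc.size

namespace Schema
variable {W : Schema} {mC mA : Code} {q : Polynomial ℕ}

/-- The program for the constraint weights computes the weight of the blocks in polynomial time, and
the weight has polynomial length. The program is only guaranteed to halt for plans whose domain is
the set of steps of an execution sequence. -/
theorem runs_weight (h : W.WeightsComputedBy mC mA q) {c : WeightedConstraint W.s W.r W.u}
    (hc : c ∈ W.constraints) {σ : List RawActivity} {π : List ℕ} (hσπ : W.IsPlanFor σ π) :
    (∃ t ≤ q.eval W.enc.size,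
      mC.Runs (encList id [c.toRaw.enc, encUnary W.u, encList (encList encBool)
          (rawBlocks W.s c.toRaw.scope c.toRaw.releases σ), encList encUnary π])
        (encList encBool (c.toRaw.weight (rawBlocks W.s c.toRaw.scope c.toRaw.releases σ) π)) t) ∧
      (c.toRaw.weight (rawBlocks W.s c.toRaw.scope c.toRaw.releases σ) π).length ≤
        W.weightBound q := by
  obtain ⟨τ, hτ, ρ, rfl, rfl, hρ⟩ := hσπ
  obtain ⟨t, ht, hr⟩ := h.constraint c hc τ hτ ρ hρ
  have hlist : ∀ L : List (Finset (Fin W.s)),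
      encList encFinset L = encList (encList encBool) (L.map vec) := by
    intro L
    induction L with
    | nil => rfl
    | cons D L ih => rw [encList, ih]; rfl
  rw [W.weight_toRaw]
  refine ⟨⟨t, ht, ?_⟩, ?_⟩
  · rw [encPlan_eq, hlist, ← rawBlocks_eq] at hr
    exact hr
  · refine (Code.Runs.length_le hr).trans (Nat.add_le_add ?_ ht)
    have hsize := W.s_add_r_add_u_lt
    have h2 : ∀ d ∈ [encConstraint c, encUnary W.u, encList encFinset (c.blocks τ), encPlan ρ],
        (id d).height ≤ 2 * W.enc.size + 2 := by
      simp only [List.mem_cons, List.not_mem_nil, or_false]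
      rintro d (rfl | rfl | rfl | rfl)
      · have h1 := size_lt_of_mem (e := encConstraint) hc
        have h2 := W.constraints_le
        have h3 := Data.height_lt_size (encConstraint c)
        simp only [id]
        omega
      · rw [id, height_encUnary]; omega
      · refine (height_encList_le (k := W.s + 1) fun D _ => ?_).trans ?_
        · refine (height_encList_le fun b _ => height_encBool_le b).trans ?_
          rw [List.length_ofFn]
        · have h1 := length_blocks_le c.toReleaseConstraint τ
          have h2 := IsSeq.length_le ⟨τ, hτ, rfl⟩
          rw [List.length_map] at h2
          omega
      · rw [id, encPlan_eq]
        refine (height_encList_le (k := W.u) fun y hy => ?_).trans ?_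
        · rw [height_encUnary]
          exact IsPlan.le ⟨ρ, rfl⟩ hy
        · rw [IsPlan.length_eq (W := W) ⟨ρ, rfl⟩]; omega
    refine (height_encList_le h2).trans ?_
    simp only [List.length_cons, List.length_nil]
    omega

end Schema

section
variable {mC mA : Code} {q : Polynomial ℕ} {ι : Type} {F : Frame ι} {Γ : ι → Data}
  {W : ι → Schema}

theorem Reads.domainCheck (h : Reads mC mA q F Γ W) {σ : ι → List RawActivity} {π : ι → List ℕ}
    (hσ : Computes F Γ fun i => encSeq (σ i)) (hπ : Computes F Γ fun i => encList encUnary (π i))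
    (hσW : ∀ i, F.Valid i → (W i).IsSeq (σ i)) :
    Computes F Γ fun i => encBool (domainCheck (W i).s (σ i) (π i)) := by
  refine Computes.all (h := fun i x => decide ((π i).getD x 0 = 0) == !BoundedWSP.hasStep (σ i) x)
    (h.s.range (h.bdd fun i _ => (W i).s_le)) (Computes.bool₂ (fun y z => y == !z)
      (Computes.isZero (Computes.getD (e := encUnary) rfl hπ.lift Computes.top ?_))
      (h.lift.hasStep hσ.lift Computes.top (fun _ hx => hσW _ hx.1)
        fun _ hx => (List.mem_range.1 hx.2).le))
    (by simpa using h.bdd fun i _ => (W i).s_le)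
  exact h.bddSize.lift.of_le fun x hx => (List.mem_range.1 hx.2).le.trans (W x.1).s_le

theorem Reads.rawBlocks (h : Reads mC mA q F Γ W) {sc rl : ι → List Bool}
    {σ : ι → List RawActivity} (hsc : Computes F Γ fun i => encList encBool (sc i))
    (hrl : Computes F Γ fun i => encList encBool (rl i))
    (hσ : Computes F Γ fun i => encSeq (σ i)) (hσW : ∀ i, F.Valid i → (W i).IsSeq (σ i)) :
    Computes F Γ fun i => encList (encList encBool)
      (rawBlocks (W i).s (sc i) (rl i) (σ i)) := by
  have hlen : F.PolyBdd fun i => (σ i).length := h.bdd fun i hi => (hσW i hi).length_le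
  have hzero : Computes F Γ fun i => encList encBool ((List.range (W i).s).map fun _ => false) :=
    Computes.tab h.s (h.bdd fun i _ => (W i).s_le) (.const (encBool false))
  refine Computes.foldl (ea := encActivity) (eb := encList (encList encBool))
    (st := fun i => blockStep (W i).s (sc i) (rl i)) (fun _ _ => True)
    (Computes.reverse hσ hlen.toAllows) (hzero.lcons .nil) ?_ (fun _ _ => trivial)
    (fun _ _ _ _ _ _ => trivial) (by simpa using hlen)
  have act := (Computes.top (F := F) (Γ := Γ) (e := encActivity)
    (Q := fun i a => a ∈ (σ i).reverse)).lift (e := encList (encList encBool))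
    (Q := fun _ _ => True)
  have blk := Computes.top (F := F.ext fun i (a : RawActivity) => a ∈ (σ i).reverse)
    (Γ := push Γ encActivity) (e := encList (encList encBool)) (Q := fun _ _ => True)
  have hidx : ((F.ext fun i (a : RawActivity) => a ∈ (σ i).reverse).ext
      fun _ (_ : List (List Bool)) => True).PolyBdd fun x => x.1.2.2 :=
    h.bddSize.lift.lift.of_le fun x hx => (hσW _ hx.1.1).index_le (List.mem_reverse.1 hx.1.2)
  refine Computes.ite (e := encList (encList encBool)) act.pairFst
    (Computes.ite (e := encList (encList encBool))
      (Computes.getD (e := encBool) rfl hrl.lift.lift act.pairSnd hidx)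
      (hzero.lift.lift.lcons blk).and blk.and).and (Computes.and (Computes.lcons
        (Computes.tab h.lift.lift.s (h.bddSize.lift.lift.of_le fun x _ => (W x.1.1).s_le)
          (Computes.bool₃ (fun y z v => y || (z && v))
            (Computes.getD (e := encBool) rfl (blk.lift.headD (d := []) rfl) Computes.top ?_)
            (Computes.getD (e := encBool) rfl hsc.lift.lift.lift Computes.top ?_)
            (Computes.eq Computes.top act.lift.pairSnd ?_ hidx.lift))) blk.ltail))
  all_goals exact h.bddSize.lift.lift.lift.of_le fun x hx => hx.2.le.trans (W x.1.1.1).s_le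

/-- The lengths of the weights add up to a polynomial bound, so that they can be summed up in
binary. -/
theorem Reads.costBits (h : Reads mC mA q F Γ W) {σ : ι → List RawActivity} {π : ι → List ℕ}
    (hσ : Computes F Γ fun i => encSeq (σ i)) (hπ : Computes F Γ fun i => encList encUnary (π i))
    (hW : ∀ i, F.Valid i → (W i).IsPlanFor (σ i) (π i)) :
    (Computes F Γ fun i => encList encBool ((W i).costBits (σ i) (π i))) ∧
      F.PolyBdd fun i => ((W i).costBits (σ i) (π i)).length := by
  have hσW : ∀ i, F.Valid i → (W i).IsSeq (σ i) := fun i hi => by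
    obtain ⟨τ, hτ, -, hσ, -⟩ := hW i hi
    exact ⟨τ, hτ, hσ⟩
  have hπW : ∀ i, F.Valid i → (W i).IsPlan (π i) := fun i hi => by
    obtain ⟨-, -, ρ, -, hρ, -⟩ := hW i hi
    exact ⟨ρ, hρ⟩
  have hcount : F.PolyBdd fun i => (W i).constraints.length := h.bdd fun i _ =>
    (length_lt_size encConstraint _).le.trans (W i).constraints_le
  have hweight : F.PolyBdd fun i => (W i).weightBound q :=
    (((Frame.PolyBdd.const 2).mul h.bddSize).add (.const 6)).add h.bddEval
  have h1 : Computes F Γ fun i => encList (encList encBool)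
      (((W i).constraints.map WeightedConstraint.toRaw).map fun c =>
        c.weight (BoundedWSP.rawBlocks (W i).s c.scope c.releases (σ i)) (π i)) := by
    refine Computes.map (h := fun i (c : RawConstraint) =>
      c.weight (BoundedWSP.rawBlocks (W i).s c.scope c.releases (σ i)) (π i)) h.constraints
      (Computes.call (M := mC) (Computes.cons Computes.top (h.u.lift.cons (Computes.cons
        (h.lift.rawBlocks (sc := fun x => x.2.scope) (rl := fun x => x.2.releases)
          (Computes.top (e := RawConstraint.enc)).hd (Computes.top (e := RawConstraint.enc)).tl.hd
          hσ.lift fun _ hx => hσW _ hx.1) (hπ.lift.cons .nil)))) h.bddEval.lift ?_)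
      (by simpa using hcount)
    rintro ⟨i, c⟩ ⟨hi, hc⟩
    have hc : c ∈ (W i).constraints.map WeightedConstraint.toRaw := hc
    obtain ⟨c', hc', rfl⟩ := List.mem_map.1 hc
    exact (Schema.runs_weight (h.weights i hi) hc' (hW i hi)).1
  have hb1 : F.PolyBdd fun i => ((((W i).constraints.map WeightedConstraint.toRaw).map fun c =>
      c.weight (BoundedWSP.rawBlocks (W i).s c.scope c.releases (σ i)) (π i)).map
        fun l => l.length + 1).sum := by
    refine (hcount.mul (hweight.add (.const 1))).of_le fun i hi => ?_
    refine (sum_length_succ_le (b := (W i).weightBound q) fun l hl => ?_).trans (by simp)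
    obtain ⟨c, hc, rfl⟩ := List.mem_map.1 hl
    obtain ⟨c', hc', rfl⟩ := List.mem_map.1 hc
    exact (Schema.runs_weight (h.weights i hi) hc' (hW i hi)).2
  have h2 : Computes F Γ fun i => encList (encList encBool)
      ((List.range (W i).u).map fun a => (W i).authBits (fiberVec (π i) a) a) := by
    refine Computes.tab h.u (h.bdd fun i _ => (W i).u_le) (h.lift.authBits (Computes.fiberVec
      h.bddSize.lift hπ.lift Computes.top ?_ ?_) Computes.top ?_ fun _ hx => hx.2)
    · exact fun x hx => ⟨(hπW _ hx.1).length_eq.le.trans (W x.1).s_le, fun y hy =>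
        ((hπW _ hx.1).le hy).trans (W x.1).u_le⟩
    · exact fun x hx => hx.2.le.trans (W x.1).u_le
    · exact fun x hx => by rw [fiberVec, List.length_map, (hπW _ hx.1).length_eq]
  have hb2 : F.PolyBdd fun i => (((List.range (W i).u).map fun a =>
      (W i).authBits (fiberVec (π i) a) a).map fun l => l.length + 1).sum := by
    refine ((h.bdd fun i _ => (W i).u_le).mul (h.bddWeight.add (.const 1))).of_le fun i hi => ?_
    refine (sum_length_succ_le (b := (W i).enc.size + 5 + q.eval (W i).enc.size)
      fun l hl => ?_).trans (by simp)
    obtain ⟨a, -, rfl⟩ := List.mem_map.1 hl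
    exact Schema.length_authBits_le (h.weights i hi) _ _
  have hl : ∀ L : List (List Bool), (sumBits L).length = (L.map fun l => l.length + 1).sum :=
    fun L => (length_foldl_addBits L []).trans (Nat.zero_add _)
  refine ⟨Computes.addBits (h1.sumBits hb1) (h2.sumBits hb2) ?_ ?_, ?_⟩
  · simpa only [hl] using hb1
  · simpa only [hl] using hb2
  · simpa only [Schema.costBits, length_addBits, hl] using (hb1.add hb2).add (.const 1)

/-- The domain of the candidate is checked first, since the program for the constraint weights is
not guaranteed to halt otherwise. -/
theorem Reads.accepts (h : Reads mC mA q F Γ W) {σ : ι → List RawActivity} {f : ι → List ℕ}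
    (hσ : Computes F Γ fun i => encSeq (σ i)) (hf : Computes F Γ fun i => encList encUnary (f i))
    (hσW : ∀ i, F.Valid i → (W i).IsSeq (σ i))
    (hfW : ∀ i, F.Valid i → f i ∈ vectors (List.range (W i).s) (W i).s) :
    Computes F Γ fun i => encBool ((W i).accepts (σ i) (f i)) := by
  have hπ := h.candidate hσ hf hσW hfW
  have hcost := (h.and (Q := fun i => BoundedWSP.domainCheck (W i).s (σ i)
    ((W i).candidate (σ i) (f i)) = true)).costBits hσ.and hπ.and fun i hi => by
      obtain ⟨τ, hτ, hσ⟩ := hσW i hi.1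
      obtain ⟨ρ, hρ⟩ := exists_planVec_greedyPlan (W i).s (W i).u (W i).authBits
        (BoundedWSP.shade (W i).s (σ i) (f i))
      refine ⟨τ, hτ, ρ, hσ, hρ, ?_⟩
      have hd := hi.2
      simp only [Schema.candidate] at hd
      rw [hρ, hσ] at hd
      exact (domainCheck_iff τ ρ).1 hd
  exact Computes.ite (e := encBool) (h.domainCheck hσ hπ hσW)
    (Computes.leBits hcost.1 h.budget.and hcost.2
      (h.and.bdd fun i _ => (W i).budget_le)) (.const (encBool false))

end

/-! ### The running time of the decision procedure -/

section
variable {mC mA : Code} {q : Polynomial ℕ} {ι : Type} {F : Frame ι} {Γ : ι → Data}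
  {W : ι → Schema}

/-- The time factor may be enlarged. -/
theorem Computes.slower {T T' : ι → ℕ} {g : ι → Data} (h : Computes (F.setTime T) Γ g)
    (hT : ∀ i, F.Valid i → T i ≤ T' i) : Computes (F.setTime T') Γ g :=
  h.reindex (fun i => i) (fun _ h => h) (fun _ _ => rfl) hT

/-- A loop over at most `a` entries with rounds of `b` steps fits into `a * b` steps, up to a
constant factor. -/
theorem Frame.Allows.loop {l a b : ι → ℕ} (hl : ∀ i, F.Valid i → l i ≤ a i) (ha : ∀ i, 0 < a i)
    (hb : ∀ i, 0 < b i) :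
    (F.setTime fun i => a i * b i).Allows fun i => (l i + 1) * (b i + 1) := by
  refine ⟨4, fun i hi => (Nat.mul_le_mul_right _ (Nat.succ_le_succ (hl i hi))).trans ?_⟩
  have := succ_mul_succ_le (a i) (b i)
  rw [max_eq_left (ha i), max_eq_left (hb i)] at this
  rw [Polynomial.eval_ofNat]
  exact this

theorem Reads.anyAccepts (h : Reads mC mA q F Γ W) {σ : ι → List RawActivity}
    (hσ : Computes (F.setTime fun _ => 0) Γ fun i => encSeq (σ i))
    (hσW : ∀ i, F.Valid i → (W i).IsSeq (σ i)) :
    Computes (F.setTime fun i => (W i).s ^ (W i).s) Γ fun i =>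
      encBool ((vectors (List.range (W i).s) (W i).s).any ((W i).accepts (σ i))) := by
  have hb : F.PolyBdd fun i => (W i).s := h.bdd fun i _ => (W i).s_le
  have hv := Computes.vectors (F := F) (l := fun i => List.range (W i).s)
    (h.setTime.s.range hb) h.setTime.s (by simpa using hb) hb
  refine Computes.anyTime (h := fun i => (W i).accepts (σ i)) (fun _ => 0)
    (hv.slower fun i _ => by simp) (h.setTime.lift.accepts hσ.lift Computes.top
      (fun _ hx => hσW _ hx.1) fun _ hx => hx.2) ⟨1, fun i _ => ?_⟩
  simp [length_vectors, Frame.setTime]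

theorem Reads.allCanonical (h : Reads mC mA q F Γ W) {K g : ι → List ℕ}
    (hK : Computes (F.setTime fun _ => 0) Γ fun i => encList encUnary (K i))
    (hg : Computes (F.setTime fun _ => 0) Γ fun i => encList encUnary (g i))
    (hKW : ∀ i, F.Valid i → K i ∈ (releaseKeys (W i).r).permutations')
    (hgW : ∀ i, F.Valid i → g i ∈ vectors (stepKeys (W i).r) (W i).s) :
    Computes (F.setTime fun i => 2 ^ (W i).workflow.xorCount * (W i).s ^ (W i).s) Γ fun i =>
      encBool (((W i).workflow.raw.canonical (g i, K i)).all fun σ =>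
        (vectors (List.range (W i).s) (W i).s).any ((W i).accepts σ)) := by
  have hpos : ∀ i, 0 < (W i).s ^ (W i).s := fun i => Nat.pow_self_pos
  have hc := Computes.canonical (F := F) (t := fun i => (g i, K i))
    (G := fun i => (W i).workflow.raw) (N := fun i => 2 * (W i).enc.size)
    ((Frame.PolyBdd.const 2).mul h.bddSize) (hg.pairMk hK)
    (fun i hi k hk => (keys_le (hgW i hi) (hKW i hi) k hk).trans
      (Nat.mul_le_mul_left _ (W i).r_le)) h.setTime.workflow
    (fun i _ => by
      have h1 := length_postfixTokens_le (W i).workflow.raw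
      have h2 := (W i).workflow_le
      rw [encRaw_raw] at h1
      omega)
    (fun i _ a ha => by
      have h1 := index_le_of_mem_postfixTokens ha
      have h2 := (W i).workflow_le
      rw [encRaw_raw] at h1
      omega)
  refine Computes.allTime (h := fun i σ =>
    (vectors (List.range (W i).s) (W i).s).any ((W i).accepts σ)) (fun i => (W i).s ^ (W i).s)
    (hc.slower fun i _ => ?_) ((h.lift (Q := fun i σ =>
      σ ∈ (W i).workflow.raw.canonical (g i, K i))).anyAccepts Computes.top₀ fun _ hx =>
        exists_execSeq_of_mem_canonical _ _ hx.2)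
    (Frame.Allows.loop (F := F) (fun i _ => length_canonical_le _ _)
      (fun _ => Nat.two_pow_pos _) hpos)
  rw [countP_postfixTokens]
  exact Nat.le_mul_of_pos_right _ (hpos i)

theorem Reads.allStepKeys (h : Reads mC mA q F Γ W) {K : ι → List ℕ}
    (hK : Computes (F.setTime fun _ => 0) Γ fun i => encList encUnary (K i))
    (hKW : ∀ i, F.Valid i → K i ∈ (releaseKeys (W i).r).permutations') :
    Computes (F.setTime fun i => ((W i).r + 1) ^ (W i).s *
        (2 ^ (W i).workflow.xorCount * (W i).s ^ (W i).s)) Γ fun i =>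
      encBool ((vectors (stepKeys (W i).r) (W i).s).all fun g =>
        ((W i).workflow.raw.canonical (g, K i)).all fun σ =>
          (vectors (List.range (W i).s) (W i).s).any ((W i).accepts σ)) := by
  have hpos : ∀ i, 0 < 2 ^ (W i).workflow.xorCount * (W i).s ^ (W i).s := fun i =>
    Nat.mul_pos (Nat.two_pow_pos _) Nat.pow_self_pos
  have hr : F.PolyBdd fun i => (W i).r := h.bdd fun i _ => (W i).r_le
  have hv := Computes.vectors (F := F) (l := fun i => stepKeys (W i).r)
    (Computes.stepKeys h.setTime.r hr) h.setTime.s (by simpa [stepKeys] using hr.add (.const 1))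
    (h.bdd fun i _ => (W i).s_le)
  refine Computes.allTime (h := fun i g =>
    ((W i).workflow.raw.canonical (g, K i)).all fun σ =>
      (vectors (List.range (W i).s) (W i).s).any ((W i).accepts σ))
    (fun i => 2 ^ (W i).workflow.xorCount * (W i).s ^ (W i).s)
    (hv.slower fun i _ => ?_) ((h.lift (Q := fun i g =>
      g ∈ vectors (stepKeys (W i).r) (W i).s)).allCanonical hK.lift₀ Computes.top₀
      (fun _ hx => hKW _ hx.1) fun _ hx => hx.2)
    (Frame.Allows.loop (F := F) (fun i _ => ?_) (fun _ => Nat.pow_pos (Nat.succ_pos _)) hpos)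
  · rw [stepKeys, List.length_map, List.length_range]
    exact Nat.le_mul_of_pos_right _ (hpos i)
  · simp [length_vectors, stepKeys]

/-- Four nested loops, over the orders of the release points, the gaps of the steps, the canonical
sequences, and the colourings, with a polynomial time for every round of the innermost one. -/
theorem Reads.decides (h : Reads mC mA q F Γ W) :
    Computes (F.setTime fun i => (W i).r.factorial * (((W i).r + 1) ^ (W i).s *
        (2 ^ (W i).workflow.xorCount * (W i).s ^ (W i).s))) Γ fun i => encBool (W i).decides := by
  have hpos : ∀ i, 0 < ((W i).r + 1) ^ (W i).s *
      (2 ^ (W i).workflow.xorCount * (W i).s ^ (W i).s) := fun i =>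
    Nat.mul_pos (Nat.pow_pos (Nat.succ_pos _)) (Nat.mul_pos (Nat.two_pow_pos _) Nat.pow_self_pos)
  have hr : F.PolyBdd fun i => (W i).r := h.bdd fun i _ => (W i).r_le
  have hp := Computes.permutations (F := F) (e := encUnary) (l := fun i => releaseKeys (W i).r)
    (Computes.releaseKeys h.setTime.r hr) (by simpa [releaseKeys] using hr)
  refine Computes.allTime (h := fun i K => (vectors (stepKeys (W i).r) (W i).s).all fun g =>
    ((W i).workflow.raw.canonical (g, K)).all fun σ =>
      (vectors (List.range (W i).s) (W i).s).any ((W i).accepts σ))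
    (fun i => ((W i).r + 1) ^ (W i).s * (2 ^ (W i).workflow.xorCount * (W i).s ^ (W i).s))
    (hp.slower fun i _ => ?_) ((h.lift (Q := fun i K =>
      K ∈ (releaseKeys (W i).r).permutations')).allStepKeys Computes.top₀ fun _ hx => hx.2)
    (Frame.Allows.loop (F := F) (fun i _ => ?_) (fun _ => Nat.factorial_pos _) hpos)
  · rw [releaseKeys, List.length_map, List.length_range]
    exact Nat.le_mul_of_pos_right _ (hpos i)
  · rw [length_permutations']
    simp [releaseKeys]

end

/-! ### Fixed-parameter tractability -/

theorem DecisionProblem.SolvableInOStar.mono {Q : DecisionProblem} {g g' : Q.Inst → ℕ}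
    (h : Q.SolvableInOStar g) (hg : ∀ x, g x ≤ g' x) : Q.SolvableInOStar g' := by
  obtain ⟨M, p, h⟩ := h
  refine ⟨M, p, fun x => ?_⟩
  obtain ⟨out, t, h1, h2, h3⟩ := h x
  exact ⟨out, t, h1, h2.trans (Nat.mul_le_mul_right _ (hg x)), h3⟩

theorem boundedCostWSP_solvableInOStar (mC mA : Code) (q : Polynomial ℕ) :
    (boundedCostWSP mC mA q).SolvableInOStar fun W =>
      2 ^ W.1.workflow.xorCount * W.1.r.factorial * (W.1.r + 1) ^ W.1.s * W.1.s ^ W.1.s := by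
  let Q := boundedCostWSP mC mA q
  have h : Reads mC mA q (⟨fun _ => True, Q.size, fun _ => 0⟩ : Frame Q.Inst) Q.enc
      fun W => W.1 :=
    ⟨Computes.id, fun _ _ => rfl, fun W _ => W.2⟩
  obtain ⟨M, p, hM⟩ := h.decides
  refine ⟨M, 2 * p, fun W => ?_⟩
  obtain ⟨t, ht, hr⟩ := hM W trivial
  refine ⟨encBool W.1.decides, t, hr, ht.trans ?_, ?_⟩
  · have hpos : 0 < W.1.r.factorial * ((W.1.r + 1) ^ W.1.s *
        (2 ^ W.1.workflow.xorCount * W.1.s ^ W.1.s)) :=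
      Nat.mul_pos (Nat.factorial_pos _) (Nat.mul_pos (Nat.pow_pos (Nat.succ_pos _))
        (Nat.mul_pos (Nat.two_pow_pos _) Nat.pow_self_pos))
    have hT : 2 ^ W.1.workflow.xorCount * W.1.r.factorial * (W.1.r + 1) ^ W.1.s * W.1.s ^ W.1.s =
        W.1.r.factorial * ((W.1.r + 1) ^ W.1.s *
          (2 ^ W.1.workflow.xorCount * W.1.s ^ W.1.s)) := by ring
    -- the bound `T` is positive, also for `s = 0`, where `0 ^ 0 = 1`; hence `T + 1 ≤ 2 * T`
    have hkey : ∀ T e : ℕ, 0 < T → (T + 1) * e ≤ T * (2 * e) := fun T e hT => by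
      rw [← mul_assoc]
      exact Nat.mul_le_mul_right _ (by omega)
    simp only [hT, Polynomial.eval_mul, Polynomial.eval_ofNat]
    exact hkey _ _ hpos
  · refine Iff.trans ?_ (Schema.decides_iff W.1)
    cases W.1.decides
    · exact ⟨fun h => absurd rfl h, fun h => Bool.noConfusion h⟩
    · exact ⟨fun _ => rfl, fun _ h => Data.noConfusion h⟩

theorem computable_succ_pow : Computable fun κ : ℕ => (κ + 1) ^ (4 * κ) := by
  have hpow : Primrec₂ ((· ^ ·) : ℕ → ℕ → ℕ) := Primrec₂.unpaired'.1 Nat.Primrec.pow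
  exact (hpow.comp Primrec.succ (Primrec.nat_mul.comp (Primrec.const 4) Primrec.id)).to_comp

theorem two_pow_mul_factorial_le (s r b : ℕ) :
    2 ^ b * r.factorial * (r + 1) ^ s * s ^ s ≤ (s + r + b + 1) ^ (4 * (s + r + b)) := by
  set κ := s + r + b with hκ
  have key : ∀ a k : ℕ, a ≤ κ + 1 → k ≤ κ → a ^ k ≤ (κ + 1) ^ κ := fun a k ha hk =>
    (Nat.pow_le_pow_left ha k).trans (Nat.pow_le_pow_right (Nat.succ_pos _) hk)
  have h1 : 2 ^ b ≤ (κ + 1) ^ κ := by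
    rcases Nat.eq_zero_or_pos b with hb | hb
    · rw [hb, pow_zero]; exact Nat.pos_of_ne_zero (by positivity)
    · exact key 2 b (by omega) (by omega)
  have h2 : r.factorial ≤ (κ + 1) ^ κ :=
    (Nat.factorial_le_pow r).trans (key r r (by omega) (by omega))
  have h3 := key (r + 1) s (by omega) (by omega)
  have h4 := key s s (by omega) (by omega)
  calc _ ≤ (κ + 1) ^ κ * (κ + 1) ^ κ * (κ + 1) ^ κ * (κ + 1) ^ κ :=
        Nat.mul_le_mul (Nat.mul_le_mul (Nat.mul_le_mul h1 h2) h3) h4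
    _ = _ := by rw [← pow_add, ← pow_add, ← pow_add]; congr 1; ring

end BoundedWSP

theorem mainTheorem1 (mC mA : BoundedWSP.Code) (q : Polynomial ℕ) :
    (BoundedWSP.boundedCostWSP mC mA q).FPT
        (fun W => W.1.s + W.1.r + W.1.workflow.xorCount) ∧
      (BoundedWSP.boundedCostWSP mC mA q).SolvableInOStar
        (fun W => 2 ^ W.1.workflow.xorCount * W.1.r.factorial * (W.1.r + 1) ^ W.1.s *
          W.1.s ^ W.1.s) :=
  ⟨⟨_, BoundedWSP.computable_succ_pow,
    (BoundedWSP.boundedCostWSP_solvableInOStar mC mA q).mono fun _ =>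
      BoundedWSP.two_pow_mul_factorial_le _ _ _⟩,
    BoundedWSP.boundedCostWSP_solvableInOStar mC mA q⟩
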